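/- All graphs are finite, simple and connected. The Wiener polarity index $W_p(G)$ of a graph $G$ is the number of unordered pairs of vertices at distance $3$. A \emph{benzenoid graph} is a 2-connected plane graph in which the boundary of every inner face is a 6-cycle, every 6-cycle is the boundary of some inner face, any two distinct 6-cycles are either disjoint or have exactly one common edge, and no three 6-cycles share a common edge. It is \emph{catacondensed} if no vertex is shared by three hexagons. A \emph{phenylene} is a plane graph obtained from a catacondensed benzenoid graph with at least two hexagons by inserting a quadrilateral (a face bounded by a 4-cycle) between every pair of adjacent hexagons: the hexagons are pulled apart, and the two copies of each end vertex of a formerly common edge are joined by an edge. Let $G$ be a catacondensed benzenoid graph or a phenylene. Its \emph{hexagons} are the inner faces bounded by 6-cycles; two faces are adjacent if they share an edge. A hexagon is \emph{branched} if it is adjacent to exactly three other inner faces, and \emph{angular} if it is adjacent to exactly two other inner faces and its two vertices of degree two are adjacent. A catacondensed benzenoid graph or a phenylene is a \emph{linear chain} if it has no angular and no branched hexagon. A \emph{segment} of $G$ is a maximal linear chain which is a subgraph of $G$. Let $h(G)$, $s(G)$ and $b(G)$ be the numbers of hexagons, segments and branched hexagons of $G$. \textbf{Theorem.} For every catacondensed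 benzenoid graph $G_1$ and every phenylene $G_2$, $$W_p(G_1) = 9h(G_1) + s(G_1) + b(G_1) - 7, \qquad W_p(G_2) = 13h(G_2) + s(G_2) + b(G_2) - 11.$$ -/

import Mathlib

universe u

/-- The Wiener polarity index: the number of unordered pairs of vertices at distance three. -/
noncomputable def wienerPolarity {V : Type u} (G : SimpleGraph V) : ℕ :=
  {e : Sym2 V | ∃ x y : V, e = s(x, y) ∧ G.dist x y = 3}.ncard

/-- A graph is 2-connected: it has at least three vertices and deleting any vertex leaves a
connected graph. -/
def IsTwoConnected {V : Type u} (G : SimpleGraph V) : Prop :=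
  3 ≤ Nat.card V ∧ ∀ v : V, (G.induce {v}ᶜ).Connected

/-- The subgraph `C` is a cycle on `k` vertices. -/
def IsCycleOfLength {V : Type u} {G : SimpleGraph V} (C : G.Subgraph) (k : ℕ) : Prop :=
  ∃ (v : V) (p : G.Walk v v), p.IsCycle ∧ p.length = k ∧ p.toSubgraph = C

/-- The permutation of the darts (oriented edges) reversing every dart. -/
def dartSymm {V : Type u} (G : SimpleGraph V) : Equiv.Perm G.Dart where
  toFun d := d.symm
  invFun d := d.symm
  left_inv d := d.symm_symm
  right_inv d := d.symm_symm

/-- The face-tracing permutation of a rotation system: from a dart `d`, go to its end vertex and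
continue along the next dart there after the reverse of `d`. -/
def facePerm {V : Type u} {G : SimpleGraph V} (rot : Equiv.Perm G.Dart) : Equiv.Perm G.Dart :=
  (dartSymm G).trans rot

/-- A finite connected simple plane graph (with at least one edge), as a combinatorial map:
a rotation system `rot` gives the cyclic order of the darts around every vertex, the faces are the
orbits of the face-tracing permutation, Euler's formula `V - E + F = 2` says that the surface is
the sphere, and one face is marked as the outer face. -/
structure PlaneGraph (V : Type u) where
  /-- the underlying simple graph -/
  graph : SimpleGraph V
  finite : Finite V
  connected : graph.Connected
  /-- the next dart in the cyclic order around the initial vertex -/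
  rot : Equiv.Perm graph.Dart
  rot_fst : ∀ d, (rot d).fst = d.fst
  rot_cyclic : ∀ d d' : graph.Dart, d.fst = d'.fst → rot.SameCycle d d'
  euler : Nat.card V + Nat.card (Quotient (Equiv.Perm.SameCycle.setoid (facePerm rot))) =
    Nat.card graph.edgeSet + 2
  /-- the outer face -/
  outer : Quotient (Equiv.Perm.SameCycle.setoid (facePerm rot))

namespace PlaneGraph

variable {V : Type u} (P : PlaneGraph V)

/-- The faces of a plane graph. -/
abbrev Face : Type u := Quotient (Equiv.Perm.SameCycle.setoid (facePerm P.rot))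

/-- The face on whose boundary walk a dart lies. -/
def faceOf (d : P.graph.Dart) : P.Face :=
  Quotient.mk (Equiv.Perm.SameCycle.setoid (facePerm P.rot)) d

/-- The inner faces, i.e. all faces except the outer one. -/
abbrev InnerFace : Type u := {f : P.Face // f ≠ P.outer}

/-- The boundary of a face, as a subgraph. -/
def boundary (f : P.Face) : P.graph.Subgraph where
  verts := {v | ∃ d, P.faceOf d = f ∧ (v = d.fst ∨ v = d.snd)}
  Adj x y := ∃ d, P.faceOf d = f ∧ d.edge = s(x, y)
  adj_sub := by
    rintro x y ⟨d, -, h⟩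
    rw [← SimpleGraph.mem_edgeSet, ← h]
    exact d.edge_mem
  edge_vert := by
    rintro x y ⟨d, hd, h⟩
    refine ⟨d, hd, ?_⟩
    have hx : x ∈ d.edge := by rw [h]; exact Sym2.mem_mk_left x y
    rcases Sym2.mem_iff.mp (show x ∈ s(d.fst, d.snd) from hx) with rfl | rfl
    · exact Or.inl rfl
    · exact Or.inr rfl
  symm := ⟨by
    rintro x y ⟨d, hd, h⟩
    exact ⟨d, hd, h.trans Sym2.eq_swap⟩⟩

/-- The hexagons: inner faces whose boundary is a 6-cycle. -/
def hexagons : Set P.InnerFace := {f | IsCycleOfLength (P.boundary f.1) 6}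

/-- The number of hexagons. -/
noncomputable def numHexagons : ℕ := P.hexagons.ncard

/-- Benzenoid graphs: 2-connected plane graphs in which the boundary of any inner face is a
6-cycle, any 6-cycle is the boundary of some inner face, two 6-cycles are disjoint or have exactly
one common edge, and no three 6-cycles share a common edge. -/
structure IsBenzenoid : Prop where
  twoConnected : IsTwoConnected P.graph
  inner_cycle : ∀ f : P.InnerFace, IsCycleOfLength (P.boundary f.1) 6
  cycle_inner : ∀ C : P.graph.Subgraph, IsCycleOfLength C 6 →
    ∃ f : P.InnerFace, P.boundary f.1 = C
  two_cycles : ∀ C D : P.graph.Subgraph, IsCycleOfLength C 6 → IsCycleOfLength D 6 → C ≠ D →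
    Disjoint C.verts D.verts ∨ (C.edgeSet ∩ D.edgeSet).ncard = 1
  three_cycles : ∀ C D E : P.graph.Subgraph, IsCycleOfLength C 6 → IsCycleOfLength D 6 →
    IsCycleOfLength E 6 → C ≠ D → C ≠ E → D ≠ E → C.edgeSet ∩ D.edgeSet ∩ E.edgeSet = ∅

/-- Internal vertices: vertices shared by three hexagons. -/
def IsInternal (v : V) : Prop :=
  ∃ F ∈ P.hexagons, ∃ F' ∈ P.hexagons, ∃ F'' ∈ P.hexagons, F ≠ F' ∧ F ≠ F'' ∧ F' ≠ F'' ∧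
    v ∈ (P.boundary F.1).verts ∧ v ∈ (P.boundary F'.1).verts ∧ v ∈ (P.boundary F''.1).verts

/-- Catacondensed benzenoid graphs: benzenoid graphs without internal vertices. -/
def IsCatacondensed : Prop := P.IsBenzenoid ∧ ∀ v, ¬ P.IsInternal v

/-- Adjacency of inner faces: they are distinct and have at least one edge in common. -/
def innerDual : SimpleGraph P.InnerFace where
  Adj F F' := F ≠ F' ∧ ((P.boundary F.1).edgeSet ∩ (P.boundary F'.1).edgeSet).Nonempty
  symm := ⟨by
    rintro F F' ⟨h, h'⟩
    exact ⟨h.symm, by rwa [Set.inter_comm]⟩⟩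
  loopless := ⟨fun _ h => h.1 rfl⟩

/-- The graph obtained from a catacondensed benzenoid graph by pulling apart all pairs of adjacent
hexagons and inserting quadrilaterals between them. A vertex is a vertex `x` of a hexagon `F`
together with that hexagon. Every hexagon keeps its six edges; the two copies of an end vertex `x`
of an edge shared by two hexagons are joined by a new edge. -/
def expansion : SimpleGraph {p : V × P.InnerFace // p.1 ∈ (P.boundary p.2.1).verts} where
  Adj p q :=
    (p.1.2 = q.1.2 ∧ (P.boundary p.1.2.1).Adj p.1.1 q.1.1) ∨
    (p.1.2 ≠ q.1.2 ∧ p.1.1 = q.1.1 ∧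
      ∃ y, (P.boundary p.1.2.1).Adj p.1.1 y ∧ (P.boundary q.1.2.1).Adj p.1.1 y)
  symm := ⟨by
    rintro ⟨⟨x, F⟩, hx⟩ ⟨⟨y, F'⟩, hy⟩ h
    simp only at h ⊢
    rcases h with ⟨rfl, h⟩ | ⟨h, rfl, z, h1, h2⟩
    · exact Or.inl ⟨rfl, h.symm⟩
    · exact Or.inr ⟨h.symm, rfl, z, h2, h1⟩⟩
  loopless := ⟨by
    rintro ⟨⟨x, F⟩, hx⟩ h
    rcases h with ⟨-, h⟩ | ⟨h, -⟩
    · exact h.ne rfl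
    · exact h rfl⟩

/-- The copy of the hexagon `F` in the expansion. -/
def hexagonCopy (F : P.InnerFace) : P.expansion.Subgraph :=
  (⊤ : P.expansion.Subgraph).induce {p | p.1.2 = F}

/-- The quadrilateral inserted in the expansion between hexagons `F` and `F'` with common
edge `xy`. -/
def quadrilateral (F F' : P.InnerFace) (x y : V) : P.expansion.Subgraph :=
  (⊤ : P.expansion.Subgraph).induce {p | (p.1.2 = F ∨ p.1.2 = F') ∧ (p.1.1 = x ∨ p.1.1 = y)}

/-- The hexagons and quadrilaterals of the expansion. -/
def expansionCells : Set P.expansion.Subgraph :=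
  {C | (∃ F, C = P.hexagonCopy F) ∨
    ∃ F F' x y, F ≠ F' ∧ (P.boundary F.1).Adj x y ∧ (P.boundary F'.1).Adj x y ∧
      C = P.quadrilateral F F' x y}

/-- Phenylenes: plane graphs `P` obtained from a catacondensed benzenoid graph `G` (the hexagonal
squeeze of `P`) with at least two hexagons by adding quadrilaterals between all pairs of adjacent
hexagons; the inner faces of `P` are bounded by the hexagons and the added quadrilaterals. -/
def IsPhenylene : Prop :=
  ∃ (U : Type) (G : PlaneGraph U), G.IsCatacondensed ∧ 2 ≤ G.numHexagons ∧
    ∃ e : G.expansion ≃g P.graph,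
      Set.range (fun f : P.InnerFace => P.boundary f.1) =
        (fun C : G.expansion.Subgraph => C.map e.toHom) '' G.expansionCells

/-! ### Linear chains and segments

The notions below are used for catacondensed benzenoid graphs and phenylenes. A subgraph which is
again such a graph is, with the inherited embedding, the union of the boundaries of a set `X` of
inner faces; `X` is then its set of inner faces. -/

/-- The subgraph formed by the boundaries of a set of inner faces. -/
def union (X : Set P.InnerFace) : P.graph.Subgraph := ⨆ F ∈ X, P.boundary F.1

/-- The set `X` of inner faces forms a catacondensed benzenoid graph or a phenylene: it is
connected by face adjacency, and each quadrilateral in it lies between two hexagons in it. -/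
def IsSubsystem (X : Set P.InnerFace) : Prop :=
  (P.innerDual.induce X).Connected ∧
    ∀ Q ∈ X, Q ∉ P.hexagons → ∃ F ∈ X ∩ P.hexagons, ∃ F' ∈ X ∩ P.hexagons,
      F ≠ F' ∧ P.innerDual.Adj Q F ∧ P.innerDual.Adj Q F'

/-- A hexagon `F` is branched in the subgraph with set of inner faces `X`: it is adjacent to exactly
three other inner faces. -/
def IsBranchedIn (X : Set P.InnerFace) (F : P.InnerFace) : Prop :=
  F ∈ P.hexagons ∧ {F' ∈ X | P.innerDual.Adj F F'}.ncard = 3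

/-- A hexagon `F` is angular in the subgraph with set of inner faces `X`: it is adjacent to exactly
two other inner faces and its two vertices of degree two are adjacent. Here faces and degrees are
those of the subgraph. -/
def IsAngularIn (X : Set P.InnerFace) (F : P.InnerFace) : Prop :=
  F ∈ P.hexagons ∧ {F' ∈ X | P.innerDual.Adj F F'}.ncard = 2 ∧
    ∃ x ∈ (P.boundary F.1).verts, ∃ y ∈ (P.boundary F.1).verts,
      ((P.union X).neighborSet x).ncard = 2 ∧ ((P.union X).neighborSet y).ncard = 2 ∧
      (P.union X).Adj x y

/-- The number of branched hexagons. -/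
noncomputable def numBranched : ℕ := {F | P.IsBranchedIn Set.univ F}.ncard

/-- The subgraph `S` is a linear chain: a catacondensed benzenoid graph or a phenylene without
angular or branched hexagons. -/
def IsLinearChain (S : P.graph.Subgraph) : Prop :=
  ∃ X : Set P.InnerFace, P.IsSubsystem X ∧ S = P.union X ∧
    ∀ F ∈ X, ¬ P.IsBranchedIn X F ∧ ¬ P.IsAngularIn X F

/-- Segments: maximal linear chains which are subgraphs. -/
def IsSegment (S : P.graph.Subgraph) : Prop := Maximal P.IsLinearChain S

/-- The number of segments. -/
noncomputable def numSegments : ℕ := {S | P.IsSegment S}.ncard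

end PlaneGraph

/-! Both classes of graphs satisfy one set of axioms, `IsCata`: every inner face is a hexagon or a
square, every vertex lies exactly once on the outer face and has degree two or three, and a vertex
on a square has degree three and lies on no second square. With h hexagons, q squares, s segments
and b branched hexagons, `IsCata.wienerPolarity_eq` shows that W_p = 9h + 4q + s + b - 7.
Catacondensed benzenoid graphs have q = 0 and phenylenes have q = h - 1.

Euler's formula is used in two ways. Over the field with two elements it says that the sphere has no
first homology: an even edge set bounds a set of faces (`exists_face_potential`), and an edge set
meeting every face evenly is a cut (`exists_vertex_potential`). As a count, it makes the inner dual
a tree whose edges are exactly the edges shared by two inner faces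
(`isTree_and_sharedDart_bijective`). Consequently every cycle of length at most six bounds a single
inner face (`exists_face_of_cycle`), and the graph is bipartite (`exists_coloring`).

Pairs at distance three are therefore the end pairs of paths with three edges, with two corrections:
three sides of a square have adjacent ends, and two paths have the same ends when they are the two
halves of a hexagon or use the two ways around a square followed by a common edge. `IsRedundant`
discards the bad paths and one path of each double. Counting the others by their middle edge gives
W_p + 6 = 9h + 2q + B (`wienerPolarity_add`), where B counts bays, the outer edges with both ends of
degree three.

A linear chain is a subtree of the inner dual that runs straight through each of its faces. If there
are at least two inner faces, a maximal one has exactly two ends, so 2s counts the shared sides with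
no shared side opposite (`two_mul_numSegments`). Each hexagon then satisfies 2 · bays + 2 = ends +
shared sides + 2 · [branched], while a square has two bays, two shared sides and no end. Summing
over the faces gives B + 1 = 2q + s + b (`card_bays`). -/

section

open scoped Classical
open Finset

/-! ### Linear algebra: exactness from a dimension count. -/

theorem Matrix.card_le_rank_add_one {K E X : Type*} [Field K] [Fintype E] [Fintype X]
    (M : Matrix E X K) (hM : ∀ f, M.mulVec f = 0 → ∃ c, f = fun _ => c) :
    Fintype.card X ≤ M.rank + 1 := by
  have h1 := M.mulVecLin.finrank_range_add_finrank_ker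
  have h2 : Module.finrank K (LinearMap.ker M.mulVecLin) ≤ 1 := by
    have : LinearMap.ker M.mulVecLin ≤ Submodule.span K {fun _ => (1 : K)} := by
      intro f hf
      obtain ⟨c, rfl⟩ := hM f (by simpa using hf)
      exact Submodule.mem_span_singleton.mpr ⟨c, by ext; simp⟩
    exact (Submodule.finrank_mono this).trans (finrank_span_le_card _ |>.trans (by simp))
  rw [Module.finrank_fintype_fun_eq_card] at h1
  unfold Matrix.rank
  omega

/-- The kernel of the transpose of `A` has dimension |E| - rank A ≤ |E| - |X| + 1 ≤ |Y| - 1 ≤ rank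
B, so the range of `B`, which lies inside it, fills it. -/
theorem Matrix.exists_mulVec_eq_of_card_le {K E X Y : Type*} [Field K] [Fintype E] [Fintype X]
    [Fintype Y] (A : Matrix E X K) (B : Matrix E Y K)
    (hA : ∀ f, A.mulVec f = 0 → ∃ c, f = fun _ => c)
    (hB : ∀ f, B.mulVec f = 0 → ∃ c, f = fun _ => c)
    (hAB : A.transpose * B = 0) (hcard : Fintype.card E + 2 ≤ Fintype.card X + Fintype.card Y)
    (z : E → K) (hz : A.transpose.mulVec z = 0) : ∃ g, B.mulVec g = z := by
  have hle : LinearMap.range B.mulVecLin ≤ LinearMap.ker A.transpose.mulVecLin := by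
    rintro _ ⟨g, rfl⟩
    rw [LinearMap.mem_ker, Matrix.mulVecLin_apply, Matrix.mulVecLin_apply, Matrix.mulVec_mulVec,
      hAB, Matrix.zero_mulVec]
  have h1 := A.transpose.mulVecLin.finrank_range_add_finrank_ker
  rw [Module.finrank_fintype_fun_eq_card] at h1
  have h2 : Module.finrank K (LinearMap.range A.transpose.mulVecLin) = A.rank := by
    rw [← Matrix.rank_transpose A]; rfl
  have hk1 := A.card_le_rank_add_one hA
  have hk2 : Fintype.card Y ≤ Module.finrank K (LinearMap.range B.mulVecLin) + 1 :=
    B.card_le_rank_add_one hB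
  have heq := Submodule.eq_of_le_of_finrank_le hle (by omega)
  have : z ∈ LinearMap.range B.mulVecLin := by
    rw [heq, LinearMap.mem_ker, Matrix.mulVecLin_apply, hz]
  obtain ⟨g, hg⟩ := this
  exact ⟨g, hg⟩

/-! ### Darts, faces and the mod 2 homology of the sphere. -/

namespace PlaneGraph

variable {V : Type u} {P : PlaneGraph V}

/-- The next dart on the boundary walk of a face. -/
def next (P : PlaneGraph V) : Equiv.Perm P.graph.Dart := facePerm P.rot

theorem next_apply (d : P.graph.Dart) : P.next d = P.rot d.symm := rfl

theorem next_symm (d : P.graph.Dart) : P.next d.symm = P.rot d := by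
  rw [next_apply, SimpleGraph.Dart.symm_symm]

theorem next_fst (d : P.graph.Dart) : (P.next d).fst = d.snd := P.rot_fst _

theorem faceOf_eq_iff {d d' : P.graph.Dart} :
    P.faceOf d = P.faceOf d' ↔ P.next.SameCycle d d' := Quotient.eq

theorem faceOf_next (d : P.graph.Dart) : P.faceOf (P.next d) = P.faceOf d :=
  faceOf_eq_iff.mpr (Equiv.Perm.SameCycle.refl _ _).apply_left

theorem faceOf_next_symm (d : P.graph.Dart) : P.faceOf (P.next.symm d) = P.faceOf d := by
  conv_rhs => rw [← P.next.apply_symm_apply d]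
  exact (faceOf_next _).symm

theorem faceOf_rot (d : P.graph.Dart) : P.faceOf (P.rot d) = P.faceOf d.symm := by
  rw [← next_symm, faceOf_next]

theorem exists_faceOf (F : P.Face) : ∃ d, P.faceOf d = F := Quotient.exists_rep F

theorem finite_dart (P : PlaneGraph V) : Finite P.graph.Dart :=
  have := P.finite
  Finite.of_injective _ SimpleGraph.Dart.toProd_injective

theorem exists_fst_eq (P : PlaneGraph V) (v : V) : ∃ d : P.graph.Dart, d.fst = v := by
  obtain ⟨d₀, -⟩ := exists_faceOf P.outer
  have : Nontrivial V := ⟨d₀.fst, d₀.snd, d₀.fst_ne_snd⟩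
  obtain ⟨w, hw⟩ := P.connected.preconnected.exists_adj_of_nontrivial v
  exact ⟨⟨(v, w), hw⟩, rfl⟩

/-- A property that is preserved by rotation and reversal holds for all darts or for none. -/
theorem dart_induction {p : P.graph.Dart → Prop} (hrot : ∀ d, p d → p (P.rot d))
    (hsymm : ∀ d, p d → p d.symm) {d₀ : P.graph.Dart} (h₀ : p d₀) (d : P.graph.Dart) : p d := by
  have := P.finite_dart
  have hall : ∀ d d' : P.graph.Dart, d.fst = d'.fst → p d → p d' := by
    intro d d' h hd
    obtain ⟨n, -, hn⟩ := (P.rot_cyclic d d' h).exists_pow_eq'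
    rw [← hn]
    clear hn
    induction n with
    | zero => simpa using hd
    | succ n ih => rw [pow_succ']; exact hrot _ ih
  have hwalk : ∀ {v w : V}, P.graph.Walk v w → (∀ d : P.graph.Dart, d.fst = v → p d) →
      ∀ d : P.graph.Dart, d.fst = w → p d := by
    intro v w q
    induction q with
    | nil => exact id
    | @cons a b c h q ih =>
      intro H
      refine ih fun d hd => ?_
      exact hall ⟨(b, a), h.symm⟩ d hd.symm (hsymm _ (H ⟨(a, b), h⟩ rfl))
  obtain ⟨q⟩ := P.connected.preconnected d₀.fst d.fst
  exact hwalk q (fun d hd => hall d₀ d hd.symm h₀) d rfl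

section Homology

variable [Fintype V]

theorem card_add_card_face :
    Fintype.card V + Fintype.card P.Face = Fintype.card P.graph.edgeSet + 2 := by
  simpa only [Nat.card_eq_fintype_card] using P.euler

/-- An incidence matrix between edges and vertices (`x = fst`) or faces (`x = faceOf`). -/
noncomputable def incidence {X : Type*} (x : P.graph.Dart → X) :
    Matrix P.graph.edgeSet X (ZMod 2) :=
  Matrix.of fun e y => ∑ d : P.graph.Dart, if d.edge = (e : Sym2 V) ∧ x d = y then 1 else 0

theorem sum_incidence {X : Type*} [Fintype X] (x : P.graph.Dart → X) (f : X → ZMod 2)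
    (e : P.graph.edgeSet) :
    (incidence x).mulVec f e = ∑ d : P.graph.Dart with d.edge = (e : Sym2 V), f (x d) := by
  simp only [incidence, Matrix.mulVec, dotProduct, Matrix.of_apply, Finset.sum_mul]
  rw [Finset.sum_comm, Finset.sum_filter]
  refine Finset.sum_congr rfl fun d _ => ?_
  by_cases h : d.edge = (e : Sym2 V) <;> simp [h]

theorem sum_incidence_transpose {X : Type*} (x : P.graph.Dart → X)
    (z : P.graph.edgeSet → ZMod 2) (y : X) :
    (incidence x).transpose.mulVec z y =
    ∑ d : P.graph.Dart with x d = y, z ⟨d.edge, d.edge_mem⟩ := by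
  simp only [incidence, Matrix.mulVec, dotProduct, Matrix.of_apply, Matrix.transpose_apply,
    Finset.sum_mul]
  rw [Finset.sum_comm, Finset.sum_filter]
  refine Finset.sum_congr rfl fun d _ => ?_
  rw [Finset.sum_eq_single ⟨d.edge, d.edge_mem⟩]
  · simp
  · intro e _ he
    rw [if_neg, zero_mul]
    rintro ⟨h, -⟩
    exact he (Subtype.ext h.symm)
  · simp

theorem sum_edge_fiber (d : P.graph.Dart) (f : P.graph.Dart → ZMod 2) :
    ∑ d' : P.graph.Dart with d'.edge = d.edge, f d' = f d + f d.symm := by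
  rw [← Finset.sum_pair d.symm_ne.symm]
  congr 1
  ext d'
  simp [SimpleGraph.dart_edge_eq_iff]

theorem incidence_mulVec {X : Type*} [Fintype X] (x : P.graph.Dart → X) (f : X → ZMod 2)
    (d : P.graph.Dart) :
    (incidence x).mulVec f ⟨d.edge, d.edge_mem⟩ = f (x d) + f (x d.symm) := by
  rw [sum_incidence, sum_edge_fiber d fun d => f (x d)]

theorem incidence_eq {X : Type*} [Fintype X] (x : P.graph.Dart → X) {f : X → ZMod 2}
    (h : (incidence x).mulVec f = 0) (d : P.graph.Dart) : f (x d.symm) = f (x d) := by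
  have h1 := incidence_mulVec x f d
  rw [h, Pi.zero_apply] at h1
  exact (CharTwo.add_eq_zero.mp h1.symm).symm

theorem eq_const_of_incidence_fst [Nonempty P.graph.Dart] (f : V → ZMod 2)
    (h : (incidence (P := P) fun d => d.fst).mulVec f = 0) : ∃ c, f = fun _ => c := by
  obtain ⟨d₀⟩ := ‹Nonempty P.graph.Dart›
  refine ⟨f d₀.fst, funext fun v => ?_⟩
  have key : ∀ d : P.graph.Dart, f d.fst = f d₀.fst := dart_induction (d₀ := d₀)
    (fun d hd => by rw [P.rot_fst, hd]) (fun d hd => by rw [← hd]; exact incidence_eq _ h d) rfl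
  obtain ⟨d, rfl⟩ := P.exists_fst_eq v
  exact key d

theorem eq_const_of_incidence_faceOf (f : P.Face → ZMod 2)
    (h : (incidence P.faceOf).mulVec f = 0) : ∃ c, f = fun _ => c := by
  refine ⟨f P.outer, funext fun F => ?_⟩
  obtain ⟨d₀, h₀⟩ := exists_faceOf P.outer
  have key : ∀ d : P.graph.Dart, f (P.faceOf d) = f P.outer := dart_induction (d₀ := d₀)
    (fun d hd => by rw [faceOf_rot, ← hd]; exact incidence_eq _ h d)
    (fun d hd => by rw [← hd]; exact incidence_eq _ h d) (by rw [h₀])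
  obtain ⟨d, rfl⟩ := exists_faceOf F
  exact key d

/-- The boundary of a boundary vanishes: at a vertex each dart contributes the faces on its two
sides. The face of `d.symm` is that of `rot d`, so rotating the darts turns one half of the sum into
the other. -/
theorem incidence_transpose_mul :
    (incidence (P := P) fun d => d.fst).transpose * incidence P.faceOf = 0 := by
  rw [← Matrix.mulVec_injective.eq_iff]
  funext g v
  rw [← Matrix.mulVec_mulVec, sum_incidence_transpose, Matrix.zero_mulVec,
    Pi.zero_apply]
  simp_rw [incidence_mulVec]
  rw [Finset.sum_add_distrib]
  simp_rw [← faceOf_rot]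
  have : ∑ d : P.graph.Dart with d.fst = v, g (P.faceOf (P.rot d)) =
      ∑ d : P.graph.Dart with d.fst = v, g (P.faceOf d) :=
    Finset.sum_equiv P.rot (by simp [P.rot_fst]) (by simp)
  rw [this, CharTwo.add_self_eq_zero]

/-- An edge set with even degree at every vertex is the boundary of a set of faces. -/
theorem exists_face_potential (z : Sym2 V → ZMod 2)
    (hz : ∀ v, ∑ d : P.graph.Dart with d.fst = v, z d.edge = 0) :
    ∃ g : P.Face → ZMod 2, ∀ d : P.graph.Dart, z d.edge = g (P.faceOf d) + g (P.faceOf d.symm) := by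
  have : Nonempty P.graph.Dart := ⟨(exists_faceOf P.outer).choose⟩
  obtain ⟨g, hg⟩ := Matrix.exists_mulVec_eq_of_card_le (incidence (P := P) fun d => d.fst)
    (incidence P.faceOf) eq_const_of_incidence_fst eq_const_of_incidence_faceOf
    incidence_transpose_mul card_add_card_face.ge (fun e => z e) (by
      funext v
      rw [sum_incidence_transpose]
      exact hz v)
  refine ⟨g, fun d => ?_⟩
  have := congrFun hg ⟨d.edge, d.edge_mem⟩
  rw [incidence_mulVec] at this
  exact this.symm

/-- An edge set meeting the boundary of every face evenly is an edge cut. -/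
theorem exists_vertex_potential (z : Sym2 V → ZMod 2)
    (hz : ∀ F, ∑ d : P.graph.Dart with P.faceOf d = F, z d.edge = 0) :
    ∃ f : V → ZMod 2, ∀ d : P.graph.Dart, z d.edge = f d.fst + f d.snd := by
  have : Nonempty P.graph.Dart := ⟨(exists_faceOf P.outer).choose⟩
  obtain ⟨f, hf⟩ := Matrix.exists_mulVec_eq_of_card_le
    (incidence P.faceOf) (incidence (P := P) fun d => d.fst)
    eq_const_of_incidence_faceOf eq_const_of_incidence_fst
    (by rw [← Matrix.transpose_transpose ((incidence P.faceOf).transpose * _),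
      Matrix.transpose_mul, Matrix.transpose_transpose, incidence_transpose_mul,
      Matrix.transpose_zero])
    (by rw [add_comm (Fintype.card P.Face)]; exact card_add_card_face.ge) (fun e => z e) (by
      funext F
      rw [sum_incidence_transpose]
      convert hz F
      rfl)
  refine ⟨f, fun d => ?_⟩
  have := congrFun hf ⟨d.edge, d.edge_mem⟩
  rw [incidence_mulVec] at this
  exact this.symm

end Homology
end PlaneGraph

/-! ### Cycles indexed by `ZMod k`. -/

theorem ZMod.induction_add_one {k : ℕ} [NeZero k] {p : ZMod k → Prop} {i₀ : ZMod k} (h₀ : p i₀)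
    (h : ∀ i, p i → p (i + 1)) (i : ZMod k) : p i := by
  have key : ∀ n : ℕ, p (i₀ + n) := by
    intro n
    induction n with
    | zero => simpa using h₀
    | succ n ih => rw [Nat.cast_succ, ← add_assoc]; exact h _ ih
  have := key (i - i₀).val
  rwa [ZMod.natCast_zmod_val, add_sub_cancel] at this

theorem IsCycleOfLength.exists_zmod {V : Type u} {G : SimpleGraph V} {C : G.Subgraph} {k : ℕ}
    (h : IsCycleOfLength C k) : 3 ≤ k ∧ ∃ x : ZMod k → V, Function.Injective x ∧
      C.verts = Set.range x ∧ ∀ a b, C.Adj a b ↔ ∃ i, s(a, b) = s(x i, x (i + 1)) := by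
  obtain ⟨v, p, hp, rfl, rfl⟩ := h
  have h3 := hp.three_le_length
  have : NeZero p.length := ⟨by omega⟩
  have hval : ∀ i : ZMod p.length, p.getVert (i + 1).val = p.getVert (i.val + 1) := by
    intro i
    have hi := ZMod.val_lt i
    have h1 : (1 : ZMod p.length).val = 1 := by
      rw [ZMod.val_one'' (by omega)]
    rw [ZMod.val_add, h1]
    -- The successor of the last index wraps around to 0, where the closed walk also ends.
    rcases eq_or_ne (i.val + 1) p.length with h | h
    · rw [h, Nat.mod_self, p.getVert_zero, p.getVert_length]
    · rw [Nat.mod_eq_of_lt (by omega)]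
  refine ⟨h3, fun i => p.getVert i.val, ?_, ?_, ?_⟩
  · intro i j hij
    have hi := ZMod.val_lt i
    have hj := ZMod.val_lt j
    exact ZMod.val_injective _ (hp.getVert_injOn' (by simp; omega) (by simp; omega) hij)
  · ext w
    rw [SimpleGraph.Walk.mem_verts_toSubgraph, SimpleGraph.Walk.mem_support_iff_exists_getVert]
    constructor
    · rintro ⟨n, rfl, hn⟩
      rcases eq_or_ne n p.length with rfl | h
      · exact ⟨0, by simp⟩
      · exact ⟨(n : ZMod p.length), by
          simp only [ZMod.val_natCast]; rw [Nat.mod_eq_of_lt (by omega)]⟩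
    · rintro ⟨i, rfl⟩
      exact ⟨i.val, rfl, (ZMod.val_lt i).le⟩
  · intro a b
    rw [SimpleGraph.Walk.toSubgraph_adj_iff]
    constructor
    · rintro ⟨n, h, hn⟩
      refine ⟨(n : ZMod p.length), ?_⟩
      simp only [hval, ZMod.val_natCast, Nat.mod_eq_of_lt hn, h]
    · rintro ⟨i, h⟩
      exact ⟨i.val, by simp only [h, hval], ZMod.val_lt i⟩

theorem IsCycleOfLength.of_six {V : Type u} {G : SimpleGraph V} {C : G.Subgraph} (x : ZMod 6 → V)
    (hx : Function.Injective x) (hv : C.verts = Set.range x)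
    (ha : ∀ a b, C.Adj a b ↔ ∃ i, s(a, b) = s(x i, x (i + 1))) : IsCycleOfLength C 6 := by
  have adj : ∀ i, G.Adj (x i) (x (i + 1)) := fun i => ((ha _ _).mpr ⟨i, rfl⟩).adj_sub
  let p : G.Walk (x 0) (x 0) := .cons (adj 0) <| .cons (adj 1) <| .cons (adj 2) <| .cons (adj 3) <|
    .cons (adj 4) <| .cons (adj 5) .nil
  refine ⟨x 0, p, ?_, rfl, ?_⟩
  · rw [SimpleGraph.Walk.cons_isCycle_iff, SimpleGraph.Walk.isPath_def]
    constructor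
    · simp only [SimpleGraph.Walk.support_cons, SimpleGraph.Walk.support_nil, List.nodup_cons,
        List.mem_cons, hx.eq_iff, List.not_mem_nil, List.nodup_nil]
      decide
    · simp only [SimpleGraph.Walk.edges_cons, SimpleGraph.Walk.edges_nil,
        List.mem_cons, Sym2.eq_iff, hx.eq_iff, List.not_mem_nil]
      decide
  · apply SimpleGraph.Subgraph.ext
    · ext w
      rw [SimpleGraph.Walk.mem_verts_toSubgraph, hv]
      simp only [p, SimpleGraph.Walk.support_cons, SimpleGraph.Walk.support_nil, List.mem_cons,
        List.not_mem_nil, Set.mem_range]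
      constructor
      · rintro (h | h | h | h | h | h | h | h) <;> first | exact ⟨_, h.symm⟩ | exact h.elim
      · rintro ⟨i, rfl⟩
        simp only [hx.eq_iff]
        revert i; decide
    · ext a b
      rw [SimpleGraph.Walk.adj_toSubgraph_iff_mem_edges, ha]
      simp only [p, SimpleGraph.Walk.edges_cons, SimpleGraph.Walk.edges_nil, List.mem_cons,
        List.not_mem_nil]
      constructor
      · rintro (h | h | h | h | h | h | h) <;> first | exact ⟨_, h⟩ | exact h.elim
      · rintro ⟨i, h⟩
        rw [h]
        simp only [Sym2.eq_iff, hx.eq_iff]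
        clear h
        revert i; decide

theorem IsCycleOfLength.of_four {V : Type u} {G : SimpleGraph V} {C : G.Subgraph} (x : ZMod 4 → V)
    (hx : Function.Injective x) (hv : C.verts = Set.range x)
    (ha : ∀ a b, C.Adj a b ↔ ∃ i, s(a, b) = s(x i, x (i + 1))) : IsCycleOfLength C 4 := by
  have adj : ∀ i, G.Adj (x i) (x (i + 1)) := fun i => ((ha _ _).mpr ⟨i, rfl⟩).adj_sub
  let p : G.Walk (x 0) (x 0) := .cons (adj 0) <| .cons (adj 1) <| .cons (adj 2) <|
    .cons (adj 3) .nil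
  refine ⟨x 0, p, ?_, rfl, ?_⟩
  · rw [SimpleGraph.Walk.cons_isCycle_iff, SimpleGraph.Walk.isPath_def]
    constructor
    · simp only [SimpleGraph.Walk.support_cons, SimpleGraph.Walk.support_nil, List.nodup_cons,
        List.mem_cons, hx.eq_iff, List.not_mem_nil, List.nodup_nil]
      decide
    · simp only [SimpleGraph.Walk.edges_cons, SimpleGraph.Walk.edges_nil,
        List.mem_cons, Sym2.eq_iff, hx.eq_iff, List.not_mem_nil]
      decide
  · apply SimpleGraph.Subgraph.ext
    · ext w
      rw [SimpleGraph.Walk.mem_verts_toSubgraph, hv]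
      simp only [p, SimpleGraph.Walk.support_cons, SimpleGraph.Walk.support_nil, List.mem_cons,
        List.not_mem_nil, Set.mem_range]
      constructor
      · rintro (h | h | h | h | h | h) <;> first | exact ⟨_, h.symm⟩ | exact h.elim
      · rintro ⟨i, rfl⟩
        simp only [hx.eq_iff]
        revert i; decide
    · ext a b
      rw [SimpleGraph.Walk.adj_toSubgraph_iff_mem_edges, ha]
      simp only [p, SimpleGraph.Walk.edges_cons, SimpleGraph.Walk.edges_nil, List.mem_cons,
        List.not_mem_nil]
      constructor
      · rintro (h | h | h | h | h) <;> first | exact ⟨_, h⟩ | exact h.elim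
      · rintro ⟨i, h⟩
        rw [h]
        simp only [Sym2.eq_iff, hx.eq_iff]
        clear h
        revert i; decide

/-! ### Boundary walks of faces. -/

namespace PlaneGraph

variable {V : Type u} {P : PlaneGraph V}

theorem mem_boundary_iff {F : P.Face} {v : V} :
    v ∈ (P.boundary F).verts ↔ ∃ d, P.faceOf d = F ∧ d.fst = v := by
  constructor
  · rintro ⟨d, hd, rfl | rfl⟩
    · exact ⟨d, hd, rfl⟩
    · exact ⟨P.next d, by rw [faceOf_next, hd], next_fst d⟩
  · rintro ⟨d, hd, rfl⟩
    exact ⟨d, hd, Or.inl rfl⟩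

/-- `c` lists the darts of the face `F` in the order of its boundary walk, and this walk passes
through no vertex twice. -/
structure IsFaceCycle (F : P.Face) {k : ℕ} (c : ZMod k → P.graph.Dart) : Prop where
  fst_injective : Function.Injective fun i => (c i).fst
  next_eq : ∀ i, P.next (c i) = c (i + 1)
  faceOf_eq_iff : ∀ d, P.faceOf d = F ↔ ∃ i, c i = d

/-- The boundary subgraph forgets the order of the walk. The dart after `c i` starts at `x (i + 1)`
and runs along the cycle, hence goes onward or straight back; going back would make `(c i).symm` a
fixed point of `rot`. So a single dart of the face fixes the whole walk. -/
theorem isFaceCycle_of_mem {F : P.Face} {k : ℕ} [NeZero k] (hrot : ∀ d, P.rot d ≠ d)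
    {x : ZMod k → V} (hx : Function.Injective x)
    (hadj : ∀ a b, (P.boundary F).Adj a b ↔ ∃ i, s(a, b) = s(x i, x (i + 1)))
    (c : ZMod k → P.graph.Dart) (hc : ∀ i, (c i).toProd = (x i, x (i + 1)))
    {i₀ : ZMod k} (h₀ : P.faceOf (c i₀) = F) : IsFaceCycle F c := by
  have hstep : ∀ i, P.faceOf (c i) = F → P.next (c i) = c (i + 1) := by
    intro i hi
    obtain ⟨j, hj⟩ := (hadj _ _).mp ⟨P.next (c i), by rw [faceOf_next, hi], rfl⟩
    have hfst : (P.next (c i)).fst = x (i + 1) := by rw [next_fst, hc]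
    rcases Sym2.eq_iff.mp hj with ⟨h1, h2⟩ | ⟨h1, h2⟩
    · apply SimpleGraph.Dart.ext
      rw [hfst] at h1
      rw [hc, Prod.ext_iff]
      refine ⟨hfst, ?_⟩
      rw [hx h1]
      exact h2
    · exfalso
      apply hrot (c i).symm
      rw [← next_apply]
      apply SimpleGraph.Dart.ext
      rw [hfst] at h1
      have : i = j := add_right_cancel (hx h1)
      rw [Prod.ext_iff]
      refine ⟨by rw [hfst]; simp [SimpleGraph.Dart.symm, hc], ?_⟩
      rw [h2, ← this]
      simp [SimpleGraph.Dart.symm, hc]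
  have hall : ∀ i, P.faceOf (c i) = F :=
    ZMod.induction_add_one h₀ fun i hi => by rw [← hstep i hi, faceOf_next, hi]
  refine ⟨fun i j h => hx (by simpa [hc] using h), fun i => hstep i (hall i), fun d => ⟨?_, ?_⟩⟩
  · intro hd
    have := P.finite_dart
    rw [← hall i₀, eq_comm, PlaneGraph.faceOf_eq_iff] at hd
    obtain ⟨n, -, hn⟩ := hd.exists_pow_eq'
    rw [← hn]
    clear hn
    induction n with
    | zero => exact ⟨i₀, by simp⟩
    | succ n ih =>
      obtain ⟨i, hi⟩ := ih
      exact ⟨i + 1, by rw [pow_succ', Equiv.Perm.mul_apply, ← hi, hstep i (hall i)]⟩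
  · rintro ⟨i, rfl⟩
    exact hall i

theorem isFaceCycle_or_reverse {F : P.Face} {k : ℕ} [NeZero k] (hrot : ∀ d, P.rot d ≠ d)
    {x : ZMod k → V} (hx : Function.Injective x)
    (hadj : ∀ a b, (P.boundary F).Adj a b ↔ ∃ i, s(a, b) = s(x i, x (i + 1)))
    (c : ZMod k → P.graph.Dart) (hc : ∀ i, (c i).toProd = (x i, x (i + 1))) :
    IsFaceCycle F c ∨ IsFaceCycle F fun i => (c (-(i + 1))).symm := by
  obtain ⟨d, hd⟩ := exists_faceOf F
  obtain ⟨i, hi⟩ := (hadj _ _).mp ⟨d, hd, rfl⟩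
  rcases Sym2.eq_iff.mp hi with ⟨h1, h2⟩ | ⟨h1, h2⟩
  · refine Or.inl (isFaceCycle_of_mem hrot hx hadj c hc (i₀ := i) ?_)
    rw [← hd]
    congr 1
    exact SimpleGraph.Dart.ext _ _ ((hc i).trans (Prod.ext h1.symm h2.symm))
  · refine Or.inr (isFaceCycle_of_mem (x := fun i => x (-i)) hrot (hx.comp neg_injective) ?_ _ ?_
      (i₀ := -(i + 1)) ?_)
    · intro a b
      rw [hadj]
      constructor
      all_goals
        rintro ⟨j, hj⟩
        refine ⟨-(j + 1), ?_⟩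
        rw [hj, Sym2.eq_swap]
        congr 2 <;> ring_nf
    · intro j
      change (c (-(j + 1))).toProd.swap = _
      rw [hc, Prod.swap, neg_add, neg_add_cancel_right]
    · rw [← hd]
      congr 1
      refine SimpleGraph.Dart.ext _ _ ?_
      change (c _).toProd.swap = _
      rw [hc]
      exact Prod.ext (by simp [h1]) (by simp [h2])

theorem exists_isFaceCycle (hrot : ∀ d, P.rot d ≠ d) {F : P.Face} {k : ℕ}
    (hF : IsCycleOfLength (P.boundary F) k) :
    3 ≤ k ∧ ∃ c : ZMod k → P.graph.Dart, IsFaceCycle F c := by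
  obtain ⟨hk, x, hx, -, hadj⟩ := hF.exists_zmod
  have : NeZero k := ⟨by omega⟩
  refine ⟨hk, ?_⟩
  have hG : ∀ i, P.graph.Adj (x i) (x (i + 1)) := fun i => ((hadj _ _).mpr ⟨i, rfl⟩).adj_sub
  rcases isFaceCycle_or_reverse hrot hx hadj (fun i => ⟨(x i, x (i + 1)), hG i⟩) fun _ => rfl
    with h | h
  · exact ⟨_, h⟩
  · exact ⟨_, h⟩

/-- Two distinct inner faces have different boundaries. -/
theorem boundary_injective {F F' : P.Face} (hF : F ≠ P.outer) (hF' : F' ≠ P.outer)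
    (h : P.boundary F = P.boundary F') : F = F' := by
  by_contra hne
  have hsym : ∀ {A B : P.Face}, A ≠ B → P.boundary A = P.boundary B → ∀ d, P.faceOf d = A →
      P.faceOf d.symm = B := by
    intro A B hne h d hd
    have : (P.boundary A).Adj d.fst d.snd := ⟨d, hd, rfl⟩
    rw [h] at this
    obtain ⟨d', hd', he⟩ := this
    rcases (SimpleGraph.dart_edge_eq_iff d' d).mp he with rfl | rfl
    · exact absurd (hd.symm.trans hd') hne
    · exact hd'
  have hs : ∀ d, P.faceOf d = F ∨ P.faceOf d = F' → P.faceOf d.symm = F ∨ P.faceOf d.symm = F' := by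
    rintro d (hd | hd)
    · exact Or.inr (hsym hne h d hd)
    · exact Or.inl (hsym (Ne.symm hne) h.symm d hd)
  obtain ⟨d₀, h₀⟩ := exists_faceOf F
  obtain ⟨d, hd⟩ := exists_faceOf P.outer
  -- Reversal exchanges the two faces, so their darts are closed under rotation and reversal.
  -- Connectedness makes them all the darts, leaving none for the outer face.
  have := dart_induction (p := fun d => P.faceOf d = F ∨ P.faceOf d = F')
    (fun d hd => by rw [faceOf_rot]; exact hs d hd) hs (Or.inl h₀) d
  rw [hd] at this
  rcases this with h | h
  · exact hF h.symm
  · exact hF' h.symm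

end PlaneGraph

/-! ### The common framework and its Euler counts. -/

namespace PlaneGraph

variable {V : Type u} {P : PlaneGraph V}

/-- The dart lies on the boundary walk of an inner face. -/
def Inner (d : P.graph.Dart) : Prop := P.faceOf d ≠ P.outer

/-- The face is an inner face bounded by a 6-cycle. -/
def IsHexagonal (F : P.Face) : Prop := F ≠ P.outer ∧ IsCycleOfLength (P.boundary F) 6

/-- The face is an inner face bounded by a 4-cycle. -/
def IsSquare (F : P.Face) : Prop := F ≠ P.outer ∧ IsCycleOfLength (P.boundary F) 4

/-- The edge of the dart has inner faces on both sides. -/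
def Shared (d : P.graph.Dart) : Prop := Inner d ∧ Inner d.symm

/-- The initial vertex of the dart does not have degree two. -/
def Cubic (d : P.graph.Dart) : Prop := P.rot (P.rot d) ≠ d

/-- A common framework for catacondensed benzenoid graphs and phenylenes. -/
structure IsCata (P : PlaneGraph V) : Prop where
  inner_cycle : ∀ F, F ≠ P.outer → IsHexagonal F ∨ IsSquare F
  outer_unique : ∀ v, ∃! d : P.graph.Dart, d.fst = v ∧ ¬ Inner d
  rot_ne : ∀ d, P.rot d ≠ d
  rot_pow : ∀ d, P.rot (P.rot d) = d ∨ P.rot (P.rot (P.rot d)) = d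
  square_cubic : ∀ d, IsSquare (P.faceOf d) → Cubic d
  square_unique : ∀ d d' : P.graph.Dart, IsSquare (P.faceOf d) → IsSquare (P.faceOf d') →
    d.fst = d'.fst → d = d'

theorem Shared.symm {d : P.graph.Dart} (h : Shared d) : Shared d.symm :=
  ⟨h.2, by rw [SimpleGraph.Dart.symm_symm]; exact h.1⟩

theorem inner_symm_iff {d : P.graph.Dart} : Inner d.symm ↔ Inner (P.rot d) := by
  unfold Inner; rw [faceOf_rot]

theorem inner_next_iff {d : P.graph.Dart} : Inner (P.next d) ↔ Inner d := by
  unfold Inner; rw [faceOf_next]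

theorem inner_next_symm_iff {d : P.graph.Dart} : Inner (P.next.symm d) ↔ Inner d := by
  unfold Inner; rw [faceOf_next_symm]

theorem shared_iff {d : P.graph.Dart} : Shared d ↔ Inner d ∧ Inner (P.rot d) := by
  rw [Shared, inner_symm_iff]

theorem cubic_rot_iff {d : P.graph.Dart} : Cubic (P.rot d) ↔ Cubic d := by
  rw [Cubic, Cubic, P.rot.injective.ne_iff]

theorem cubic_next_iff {d : P.graph.Dart} : Cubic (P.next d) ↔ Cubic d.symm := by
  rw [next_apply, cubic_rot_iff]

theorem rot_symm_next_symm (d : P.graph.Dart) : P.rot (P.next.symm d).symm = d := by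
  rw [← next_apply, Equiv.apply_symm_apply]

theorem next_symm_snd (d : P.graph.Dart) : (P.next.symm d).snd = d.fst := by
  rw [← next_fst, Equiv.apply_symm_apply]

theorem IsFaceCycle.shift {F : P.Face} {k : ℕ} {c : ZMod k → P.graph.Dart} (h : IsFaceCycle F c)
    (i : ZMod k) : IsFaceCycle F fun j => c (i + j) where
  fst_injective _ _ hab := add_left_cancel (h.fst_injective hab)
  next_eq j := by rw [h.next_eq, add_assoc]
  faceOf_eq_iff d := by
    rw [h.faceOf_eq_iff]
    exact ⟨fun ⟨j, hj⟩ => ⟨j - i, by rw [add_sub_cancel, hj]⟩, fun ⟨j, hj⟩ => ⟨i + j, hj⟩⟩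

theorem IsFaceCycle.injective {F : P.Face} {k : ℕ} {c : ZMod k → P.graph.Dart}
    (h : IsFaceCycle F c) : Function.Injective c := fun _ _ hab =>
  h.fst_injective (congrArg (fun d : P.graph.Dart => d.fst) hab)

theorem IsFaceCycle.faceOf {F : P.Face} {k : ℕ} {c : ZMod k → P.graph.Dart}
    (h : IsFaceCycle F c) (i : ZMod k) : P.faceOf (c i) = F := (h.faceOf_eq_iff _).mpr ⟨i, rfl⟩

theorem IsFaceCycle.snd_eq {F : P.Face} {k : ℕ} {c : ZMod k → P.graph.Dart}
    (h : IsFaceCycle F c) (i : ZMod k) : (c i).snd = (c (i + 1)).fst := by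
  rw [← h.next_eq, next_fst]

theorem IsFaceCycle.next_symm_eq {F : P.Face} {k : ℕ} {c : ZMod k → P.graph.Dart}
    (h : IsFaceCycle F c) (i : ZMod k) : P.next.symm (c i) = c (i - 1) := by
  rw [Equiv.symm_apply_eq, h.next_eq, sub_add_cancel]

theorem IsFaceCycle.card_darts [Fintype V] {F : P.Face} {k : ℕ} [NeZero k]
    {c : ZMod k → P.graph.Dart} (h : IsFaceCycle F c) (p : P.graph.Dart → Prop) :
    #{d : P.graph.Dart | P.faceOf d = F ∧ p d} = #{i : ZMod k | p (c i)} := by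
  rw [← Finset.card_image_of_injective _ h.injective]
  congr 1
  ext d
  simp only [Finset.mem_filter, Finset.mem_univ, true_and, Finset.mem_image]
  constructor
  · rintro ⟨hd, hp⟩
    obtain ⟨i, rfl⟩ := (h.faceOf_eq_iff d).mp hd
    exact ⟨i, hp, rfl⟩
  · rintro ⟨i, hp, rfl⟩
    exact ⟨h.faceOf i, hp⟩

namespace IsCata

variable (hP : IsCata P)
include hP

theorem inner_rot {d : P.graph.Dart} (h : ¬ Inner d) : Inner (P.rot d) := by
  by_contra h'
  exact hP.rot_ne d ((hP.outer_unique d.fst).unique ⟨P.rot_fst d, h'⟩ ⟨rfl, h⟩)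

theorem inner_symm {d : P.graph.Dart} (h : ¬ Inner d) : Inner d.symm :=
  inner_symm_iff.mpr (hP.inner_rot h)

theorem eq_of_not_inner {d d' : P.graph.Dart} (h : ¬ Inner d) (h' : ¬ Inner d')
    (hd : d.fst = d'.fst) : d = d' :=
  (hP.outer_unique d'.fst).unique ⟨hd, h⟩ ⟨rfl, h'⟩

theorem eq_or_of_fst_eq {d d' : P.graph.Dart} (h : d'.fst = d.fst) :
    d' = d ∨ d' = P.rot d ∨ d' = P.rot (P.rot d) := by
  have := P.finite_dart
  obtain ⟨n, -, hn⟩ := (P.rot_cyclic d d' h.symm).exists_pow_eq'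
  rw [← hn]
  clear hn
  induction n with
  | zero => simp
  | succ n ih =>
    rw [pow_succ', Equiv.Perm.mul_apply]
    rcases ih with h | h | h <;> rw [h]
    · simp
    · simp
    · rcases hP.rot_pow d with h | h
      · rw [h]; simp
      · rw [h]; simp

theorem rot_rot_rot {d : P.graph.Dart} (h : Cubic d) : P.rot (P.rot (P.rot d)) = d :=
  (hP.rot_pow d).resolve_left h

theorem not_inner_three {d : P.graph.Dart} (h : Inner d) (h1 : Inner (P.rot d)) :
    ¬ Inner (P.rot (P.rot d)) := by
  intro h2
  obtain ⟨o, ⟨ho, ho'⟩, -⟩ := hP.outer_unique d.fst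
  rcases hP.eq_or_of_fst_eq ho with rfl | rfl | rfl <;> contradiction

theorem cubic_of_shared {d : P.graph.Dart} (h : Shared d) : Cubic d := by
  intro h2
  have := hP.not_inner_three h.1 (shared_iff.mp h).2
  rw [h2] at this
  exact this h.1

/-- Two consecutive shared sides of a face would make three consecutive darts at their common vertex
inner, leaving no room for the outer one. -/
theorem not_shared_next {d : P.graph.Dart} (h : Shared d) : ¬ Shared (P.next d) := by
  intro h'
  rw [shared_iff, next_apply] at h'
  exact hP.not_inner_three h.2 h'.1 h'.2

theorem not_shared_next_symm {d : P.graph.Dart} (h : Shared d) : ¬ Shared (P.next.symm d) := by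
  intro h'
  exact hP.not_shared_next h' (by rwa [Equiv.apply_symm_apply])

theorem symm_next_symm {d : P.graph.Dart} (h : Cubic d) :
    (P.next.symm d).symm = P.rot (P.rot d) := by
  apply P.rot.injective
  rw [rot_symm_next_symm, hP.rot_rot_rot h]

/-- At a vertex of degree three exactly one corner is outer, so the given inner corner has an inner
corner next to it across one of the two sides of its face that meet there. -/
theorem cubic_iff {d : P.graph.Dart} (h : Inner d) :
    Cubic d ↔ Shared d ∨ Shared (P.next.symm d) := by
  constructor
  · intro hc
    by_cases h1 : Inner (P.rot d)
    · exact Or.inl (shared_iff.mpr ⟨h, h1⟩)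
    · refine Or.inr ⟨inner_next_symm_iff.mpr h, ?_⟩
      rw [hP.symm_next_symm hc]
      exact hP.inner_rot h1
  · rintro (h1 | h1)
    · exact hP.cubic_of_shared h1
    · rw [← rot_symm_next_symm d, cubic_rot_iff]
      exact hP.cubic_of_shared h1.symm

theorem isHexagonal_or_isSquare {d : P.graph.Dart} (h : Inner d) :
    IsHexagonal (P.faceOf d) ∨ IsSquare (P.faceOf d) := hP.inner_cycle _ h

theorem exists_hexagon_cycle {d : P.graph.Dart} (h : IsHexagonal (P.faceOf d)) :
    ∃ c : ZMod 6 → P.graph.Dart, IsFaceCycle (P.faceOf d) c ∧ c 0 = d := by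
  obtain ⟨-, c, hc⟩ := exists_isFaceCycle hP.rot_ne h.2
  obtain ⟨i, hi⟩ := (hc.faceOf_eq_iff d).mp rfl
  exact ⟨_, hc.shift i, by simpa using hi⟩

theorem exists_square_cycle {d : P.graph.Dart} (h : IsSquare (P.faceOf d)) :
    ∃ c : ZMod 4 → P.graph.Dart, IsFaceCycle (P.faceOf d) c ∧ c 0 = d := by
  obtain ⟨-, c, hc⟩ := exists_isFaceCycle hP.rot_ne h.2
  obtain ⟨i, hi⟩ := (hc.faceOf_eq_iff d).mp rfl
  exact ⟨_, hc.shift i, by simpa using hi⟩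

theorem eq_of_faceOf_eq {d d' : P.graph.Dart} (hd : Inner d) (h : P.faceOf d = P.faceOf d')
    (hf : d.fst = d'.fst) : d = d' := by
  rcases hP.isHexagonal_or_isSquare hd with h6 | h4
  · obtain ⟨c, hc, rfl⟩ := hP.exists_hexagon_cycle h6
    obtain ⟨i, rfl⟩ := (hc.faceOf_eq_iff d').mp h.symm
    rw [hc.fst_injective hf]
  · obtain ⟨c, hc, rfl⟩ := hP.exists_square_cycle h4
    obtain ⟨i, rfl⟩ := (hc.faceOf_eq_iff d').mp h.symm
    rw [hc.fst_injective hf]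

theorem faceOf_symm_ne {d : P.graph.Dart} : P.faceOf d.symm ≠ P.faceOf d := by
  intro h
  rw [← faceOf_rot] at h
  by_cases hd : Inner d
  · exact hP.rot_ne d (hP.eq_of_faceOf_eq hd h.symm (P.rot_fst d).symm).symm
  · have := hP.inner_rot hd
    rw [Inner, h] at this
    exact hd this

theorem not_isSquare {F : P.Face} (h : IsHexagonal F) : ¬ IsSquare F := by
  intro h4
  have := P.finite
  have := Fintype.ofFinite V
  obtain ⟨d, rfl⟩ := exists_faceOf F
  obtain ⟨c, hc, -⟩ := hP.exists_hexagon_cycle h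
  obtain ⟨c', hc', -⟩ := hP.exists_square_cycle h4
  have h1 := hc.card_darts fun _ => True
  have h2 := hc'.card_darts fun _ => True
  rw [h1] at h2
  simp [ZMod.card] at h2

/-- At most one of the two faces at an edge is a square. -/
theorem not_isSquare_symm {d : P.graph.Dart} (h : IsSquare (P.faceOf d)) :
    ¬ IsSquare (P.faceOf d.symm) := by
  intro h'
  rw [← faceOf_rot] at h'
  exact hP.rot_ne d (hP.square_unique _ _ h' h (P.rot_fst d))

section Counting

variable [Fintype V]

theorem card_darts_of_isHexagonal {F : P.Face} (h : IsHexagonal F) :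
    #{d : P.graph.Dart | P.faceOf d = F} = 6 := by
  obtain ⟨d, rfl⟩ := exists_faceOf F
  obtain ⟨c, hc, -⟩ := hP.exists_hexagon_cycle h
  have h1 := hc.card_darts fun _ => True
  simpa [ZMod.card] using h1

theorem card_darts_of_isSquare {F : P.Face} (h : IsSquare F) :
    #{d : P.graph.Dart | P.faceOf d = F} = 4 := by
  obtain ⟨d, rfl⟩ := exists_faceOf F
  obtain ⟨c, hc, -⟩ := hP.exists_square_cycle h
  have h1 := hc.card_darts fun _ => True
  simpa [ZMod.card] using h1

/-- Summing over the inner darts by summing over the hexagons and squares. -/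
theorem sum_inner {M : Type*} [AddCommMonoid M] (f : P.graph.Dart → M) :
    ∑ d with Inner d, f d =
      (∑ F : P.Face with IsHexagonal F, ∑ d with P.faceOf d = F, f d) +
        ∑ F : P.Face with IsSquare F, ∑ d with P.faceOf d = F, f d := by
  rw [← Finset.sum_union (Finset.disjoint_filter.mpr fun F _ h6 h4 => hP.not_isSquare h6 h4),
    ← Finset.filter_or, Finset.sum_fiberwise_eq_sum_filter]
  refine Finset.sum_congr ?_ fun _ _ => rfl
  ext d
  simp only [Finset.mem_filter, Finset.mem_univ, true_and]
  exact ⟨hP.isHexagonal_or_isSquare, fun h => h.elim And.left And.left⟩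

theorem card_inner : #{d : P.graph.Dart | Inner d} =
    6 * #{F : P.Face | IsHexagonal F} + 4 * #{F : P.Face | IsSquare F} := by
  have h := hP.sum_inner fun _ => 1
  rw [← Finset.card_eq_sum_ones] at h
  rw [h]
  congr 1
  · rw [Finset.sum_congr rfl (g := fun _ => 6), Finset.sum_const, smul_eq_mul, mul_comm]
    intro F hF
    rw [← Finset.card_eq_sum_ones]
    convert hP.card_darts_of_isHexagonal (Finset.mem_filter.mp hF).2
  · rw [Finset.sum_congr rfl (g := fun _ => 4), Finset.sum_const, smul_eq_mul, mul_comm]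
    intro F hF
    rw [← Finset.card_eq_sum_ones]
    convert hP.card_darts_of_isSquare (Finset.mem_filter.mp hF).2

theorem card_not_inner : #{d : P.graph.Dart | ¬ Inner d} = Fintype.card V := by
  rw [← Finset.card_univ]
  refine Finset.card_bij (fun d _ => d.fst) (by simp) ?_ ?_
  · intro d hd d' hd' h
    exact hP.eq_of_not_inner (Finset.mem_filter.mp hd).2 (Finset.mem_filter.mp hd').2 h
  · intro v _
    obtain ⟨d, ⟨rfl, hd⟩, -⟩ := hP.outer_unique v
    exact ⟨d, by simpa using hd, rfl⟩

theorem card_face : #{F : P.Face | IsHexagonal F} + #{F : P.Face | IsSquare F} + 1 =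
    Fintype.card P.Face := by
  rw [← Finset.card_union_of_disjoint
    (Finset.disjoint_filter.mpr fun F _ h6 h4 => hP.not_isSquare h6 h4), ← Finset.filter_or]
  have : (Finset.univ.filter fun F : P.Face => IsHexagonal F ∨ IsSquare F) =
      Finset.univ.erase P.outer := by
    ext F
    simp only [Finset.mem_filter, Finset.mem_univ, true_and, Finset.mem_erase, and_true]
    exact ⟨fun h => h.elim And.left And.left, hP.inner_cycle F⟩
  rw [this, Finset.card_erase_add_one (Finset.mem_univ _), Finset.card_univ]

/-- The inner darts that are not shared are the reverses of the outer darts, and there is one outer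
dart per vertex. -/
theorem card_shared_add_card : #{d : P.graph.Dart | Shared d} + Fintype.card V =
    #{d : P.graph.Dart | Inner d} := by
  rw [← hP.card_not_inner]
  have h1 : #{d : P.graph.Dart | ¬ Inner d} = #{d : P.graph.Dart | Inner d ∧ ¬ Inner d.symm} := by
    refine Finset.card_bij (fun d _ => d.symm) ?_ ?_ ?_
    · intro d hd
      simp only [Finset.mem_filter, Finset.mem_univ, true_and,
        SimpleGraph.Dart.symm_symm] at hd ⊢
      exact ⟨hP.inner_symm hd, hd⟩
    · intro d _ d' _ h
      exact SimpleGraph.Dart.symm_involutive.injective h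
    · intro d hd
      exact ⟨d.symm, by simpa using (Finset.mem_filter.mp hd).2.2, d.symm_symm⟩
  rw [h1]
  rw [← Finset.card_filter_add_card_filter_not
    (s := Finset.univ.filter fun d : P.graph.Dart => Inner d)
    (fun d : P.graph.Dart => Inner d.symm), Finset.filter_filter, Finset.filter_filter]
  congr!

omit hP in
theorem card_dart : Fintype.card P.graph.Dart = 2 * Fintype.card P.graph.edgeSet := by
  rw [P.graph.dart_card_eq_twice_card_edges, SimpleGraph.edgeFinset_card]

theorem card_inner_add_card : #{d : P.graph.Dart | Inner d} + Fintype.card V =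
    2 * Fintype.card P.graph.edgeSet := by
  rw [← card_dart, ← hP.card_not_inner, Finset.card_filter_add_card_filter_not,
    Finset.card_univ]

theorem card_shared : #{d : P.graph.Dart | Shared d} + 2 =
    2 * (#{F : P.Face | IsHexagonal F} + #{F : P.Face | IsSquare F}) := by
  have h1 := hP.card_shared_add_card
  have h2 := hP.card_inner_add_card
  have h3 := hP.card_face
  have h4 := P.card_add_card_face
  omega

theorem card_vertices : Fintype.card V =
    4 * #{F : P.Face | IsHexagonal F} + 2 * #{F : P.Face | IsSquare F} + 2 := by
  have h1 := hP.card_shared_add_card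
  have h2 := hP.card_shared
  have h3 := hP.card_inner
  omega

end Counting

end IsCata
end PlaneGraph

/-! ### The inner dual is a tree, and short cycles bound faces. -/

theorem SimpleGraph.IsAcyclic.card_dart_le {W : Type*} [Fintype W] [Nonempty W]
    {G : SimpleGraph W} (h : G.IsAcyclic) : Fintype.card G.Dart + 2 ≤ 2 * Fintype.card W := by
  -- A forest extends to a spanning tree of the complete graph, whose number of edges is known.
  obtain ⟨T, hGT, -, hT⟩ := SimpleGraph.connected_top.exists_isTree_le_of_le_of_isAcyclic
    (le_top : G ≤ ⊤) h
  have h1 := hT.card_edgeFinset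
  have h2 : #G.edgeFinset ≤ #T.edgeFinset :=
    Finset.card_le_card (SimpleGraph.edgeFinset_mono hGT)
  rw [G.dart_card_eq_twice_card_edges]
  omega

namespace PlaneGraph

variable {V : Type u} {P : PlaneGraph V}

namespace IsCata

variable (hP : IsCata P)
include hP

theorem innerDual_adj_iff {F F' : P.InnerFace} :
    P.innerDual.Adj F F' ↔ ∃ d, P.faceOf d = F.1 ∧ P.faceOf d.symm = F'.1 := by
  constructor
  · rintro ⟨hne, e, he, he'⟩
    induction e with | h a b
    obtain ⟨d, hd, hde⟩ := he
    obtain ⟨d', hd', hde'⟩ := he'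
    rcases (SimpleGraph.dart_edge_eq_iff d' d).mp (hde'.trans hde.symm) with rfl | rfl
    · exact absurd (Subtype.ext (hd.symm.trans hd')) hne
    · exact ⟨d, hd, hd'⟩
  · rintro ⟨d, hd, hd'⟩
    refine ⟨?_, d.edge, ⟨d, hd, rfl⟩, ⟨d.symm, hd', d.edge_symm⟩⟩
    rintro rfl
    exact hP.faceOf_symm_ne (hd'.trans hd.symm)

theorem faceOf_eq_or_exists {d d' : P.graph.Dart} (hd : Inner d) (hd' : Inner d')
    (h : d'.fst = d.fst) : d' = d ∨ P.faceOf d.symm = P.faceOf d' ∧ Shared d ∨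
      P.faceOf d'.symm = P.faceOf d ∧ Shared d' := by
  rcases hP.eq_or_of_fst_eq h with rfl | rfl | rfl
  · exact Or.inl rfl
  · exact Or.inr (Or.inl ⟨(faceOf_rot d).symm, hd, inner_symm_iff.mpr hd'⟩)
  · by_cases hc : Cubic d
    · refine Or.inr (Or.inr ⟨?_, hd', ?_⟩)
      · rw [← faceOf_rot, hP.rot_rot_rot hc]
      · rw [inner_symm_iff, hP.rot_rot_rot hc]; exact hd
    · exact Or.inl (not_not.mp hc)

theorem reachable_of_fst_eq {d d' : P.graph.Dart} (hd : Inner d) (hd' : Inner d')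
    (h : d'.fst = d.fst) :
    P.innerDual.Reachable ⟨P.faceOf d, hd⟩ ⟨P.faceOf d', hd'⟩ := by
  rcases hP.faceOf_eq_or_exists hd hd' h with rfl | ⟨h, -⟩ | ⟨h, -⟩
  · rfl
  · exact (hP.innerDual_adj_iff.mpr ⟨d, rfl, h⟩).reachable
  · exact (hP.innerDual_adj_iff.mpr ⟨d', rfl, h⟩).symm.reachable

theorem exists_inner : ∃ d : P.graph.Dart, Inner d := by
  obtain ⟨d, -⟩ := exists_faceOf P.outer
  by_cases h : Inner d
  · exact ⟨d, h⟩
  · exact ⟨_, hP.inner_rot h⟩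

theorem innerDual_connected : P.innerDual.Connected := by
  obtain ⟨d₀, h₀⟩ := hP.exists_inner
  -- Speaking of all inner faces at the initial vertex, and not only of the face of `d`, makes the
  -- property invariant under rotation and lets it pass an outer corner.
  let p : P.graph.Dart → Prop := fun d => ∀ d' : P.graph.Dart, d'.fst = d.fst → ∀ h : Inner d',
    P.innerDual.Reachable ⟨P.faceOf d₀, h₀⟩ ⟨P.faceOf d', h⟩
  have key : ∀ d, p d := by
    refine dart_induction (d₀ := d₀) ?_ ?_ ?_
    · intro d hd d' h
      exact hd d' (h.trans (P.rot_fst d))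
    · intro d hd d' h hd'
      by_cases hi : Inner d
      · have h1 := hd d rfl hi
        have h2 := hP.reachable_of_fst_eq (d := P.next d) (inner_next_iff.mpr hi) hd'
          (by rw [h, next_fst]; rfl)
        simp only [faceOf_next] at h2
        exact h1.trans h2
      · have hi' := hP.inner_symm hi
        have h1 := hd (P.next d.symm) (next_fst _) (inner_next_iff.mpr hi')
        simp only [faceOf_next] at h1
        exact h1.trans (hP.reachable_of_fst_eq hi' hd' h)
    · intro d' h hd'
      exact hP.reachable_of_fst_eq h₀ hd' h
  have : Nonempty P.InnerFace := ⟨⟨P.faceOf d₀, h₀⟩⟩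
  rw [SimpleGraph.connected_iff_exists_forall_reachable]
  refine ⟨⟨P.faceOf d₀, h₀⟩, ?_⟩
  rintro ⟨F, hF⟩
  obtain ⟨d, rfl⟩ := exists_faceOf F
  exact key d d rfl hF

omit hP in
/-- A shared dart as a dart of the inner dual. -/
def sharedDart (hP : IsCata P) (d : {d : P.graph.Dart // Shared d}) : P.innerDual.Dart :=
  ⟨(⟨P.faceOf d.1, d.2.1⟩, ⟨P.faceOf d.1.symm, d.2.2⟩), hP.innerDual_adj_iff.mpr ⟨d.1, rfl, rfl⟩⟩

theorem sharedDart_surjective : Function.Surjective hP.sharedDart := by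
  rintro ⟨⟨F, F'⟩, h⟩
  obtain ⟨d, hd, hd'⟩ := hP.innerDual_adj_iff.mp h
  refine ⟨⟨d, ?_, ?_⟩, ?_⟩
  · unfold Inner; rw [hd]; exact F.2
  · unfold Inner; rw [hd']; exact F'.2
  · exact SimpleGraph.Dart.ext _ _ (Prod.ext (Subtype.ext hd) (Subtype.ext hd'))

theorem card_innerFace [Fintype V] : Fintype.card P.InnerFace =
    #{F : P.Face | IsHexagonal F} + #{F : P.Face | IsSquare F} := by
  have h := hP.card_face
  have : Fintype.card P.InnerFace = Fintype.card P.Face - 1 := by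
    rw [Fintype.card_subtype_compl, Fintype.card_subtype_eq]
  omega

/-- Let n be the number of inner faces. Euler's formula gives 2(n - 1) shared darts, and they map
onto the darts of the dual; connectedness requires at least 2(n - 1) darts there. Equality
throughout gives both claims. -/
theorem isTree_and_sharedDart_bijective :
    P.innerDual.IsTree ∧ Function.Bijective hP.sharedDart := by
  have := P.finite
  have := Fintype.ofFinite V
  have h1 := hP.innerDual_connected.card_vert_le_card_edgeSet_add_one
  have h2 := hP.card_shared
  have h3 := hP.card_innerFace
  have h4 := Fintype.card_le_of_surjective _ hP.sharedDart_surjective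
  have h5 := P.innerDual.dart_card_eq_twice_card_edges
  rw [SimpleGraph.edgeFinset_card] at h5
  rw [Nat.card_eq_fintype_card, Nat.card_eq_fintype_card] at h1
  rw [Fintype.card_subtype] at h4
  refine ⟨SimpleGraph.isTree_iff_connected_and_card.mpr ⟨hP.innerDual_connected, ?_⟩, ?_⟩
  · rw [Nat.card_eq_fintype_card, Nat.card_eq_fintype_card]
    omega
  · rw [Fintype.bijective_iff_surjective_and_card]
    refine ⟨hP.sharedDart_surjective, ?_⟩
    rw [Fintype.card_subtype]
    omega

theorem innerDual_isTree : P.innerDual.IsTree := hP.isTree_and_sharedDart_bijective.1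

theorem eq_of_shared {d d' : P.graph.Dart} (hd : Shared d) (h : P.faceOf d' = P.faceOf d)
    (h' : P.faceOf d'.symm = P.faceOf d.symm) : d' = d := by
  have hd' : Shared d' := by
    unfold Shared Inner; rw [h, h']; exact hd
  have := hP.isTree_and_sharedDart_bijective.2.1 (a₁ := ⟨d', hd'⟩) (a₂ := ⟨d, hd⟩)
    (SimpleGraph.Dart.ext _ _ (Prod.ext (Subtype.ext h) (Subtype.ext h')))
  exact congrArg Subtype.val this

/-- The dual restricted to `A` is a forest, and by `eq_of_shared` two faces share at most one edge,
so these darts inject into its darts. -/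
theorem card_both_le [Fintype V] {A : Finset P.Face} (hA : A.Nonempty) (hA' : P.outer ∉ A) :
    #{d : P.graph.Dart | P.faceOf d ∈ A ∧ P.faceOf d.symm ∈ A} + 2 ≤ 2 * #A := by
  let s : Set P.InnerFace := {F | F.1 ∈ A}
  have hin : ∀ F ∈ A, F ≠ P.outer := fun F hF h => hA' (h ▸ hF)
  have hs : Nonempty s := by
    obtain ⟨F, hF⟩ := hA
    exact ⟨⟨⟨F, hin F hF⟩, hF⟩⟩
  have h1 := (hP.innerDual_isTree.isAcyclic.induce s).card_dart_le
  rw [← Nat.card_eq_fintype_card] at h1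
  have h2 : Fintype.card s = #A := by
    rw [← Fintype.card_coe]
    refine Fintype.card_congr ⟨fun F => ⟨F.1.1, F.2⟩, fun F => ⟨⟨F.1, hin _ F.2⟩, F.2⟩,
      fun F => rfl, fun F => rfl⟩
  have h3 : #{d : P.graph.Dart | P.faceOf d ∈ A ∧ P.faceOf d.symm ∈ A} ≤
      Nat.card (P.innerDual.induce s).Dart := by
    rw [← Fintype.card_subtype, Nat.card_eq_fintype_card]
    refine Fintype.card_le_of_injective (fun d => ⟨(⟨⟨P.faceOf d.1, hin _ d.2.1⟩, d.2.1⟩,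
      ⟨⟨P.faceOf d.1.symm, hin _ d.2.2⟩, d.2.2⟩), hP.innerDual_adj_iff.mpr ⟨d.1, rfl, rfl⟩⟩) ?_
    rintro ⟨d, hd⟩ ⟨d', hd'⟩ h
    exact Subtype.ext (hP.eq_of_shared ⟨hin _ hd'.1, hin _ hd'.2⟩
      (congrArg (fun e : (P.innerDual.induce s).Dart => e.fst.1.1) h)
      (congrArg (fun e : (P.innerDual.induce s).Dart => e.snd.1.1) h))
  omega

/-- A face all of whose edges are exactly those of a short cycle. -/
theorem exists_face_of_cycle {k : ℕ} (hk : 3 ≤ k) (hk' : k ≤ 6) (c : ZMod k → P.graph.Dart)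
    (hc : ∀ i, (c i).snd = (c (i + 1)).fst) (hinj : Function.Injective fun i => (c i).fst) :
    ∃ F : P.Face, F ≠ P.outer ∧ (IsFaceCycle F c ∨ IsFaceCycle F fun i => (c (-(i + 1))).symm) := by
  have := P.finite
  have := Fintype.ofFinite V
  have : NeZero k := ⟨by omega⟩
  have hcc : ∀ i, (c i).toProd = ((c i).fst, (c (i + 1)).fst) := fun i => Prod.ext rfl (hc i)
  let z : Sym2 V → ZMod 2 := fun e => if ∃ i, (c i).edge = e then 1 else 0
  have hz1 : ∀ d : P.graph.Dart, z d.edge = 1 ↔ ∃ i, d = c i ∨ d = (c i).symm := by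
    intro d
    simp only [z, ite_eq_left_iff, zero_ne_one, imp_false, not_not]
    refine exists_congr fun i => ?_
    rw [eq_comm, SimpleGraph.dart_edge_eq_iff]
  have hz0 : ∀ e, z e = 0 ∨ z e = 1 := by
    intro e
    by_cases h : ∃ i, (c i).edge = e <;> simp [z, h]
  obtain ⟨g, hg⟩ := P.exists_face_potential z (by
    intro v
    by_cases hv : ∃ i, (c i).fst = v
    · obtain ⟨i, rfl⟩ := hv
      -- These are the two darts of the cycle at this vertex; they would coincide only if i + 1 = i
      -- - 1, which k ≥ 3 excludes.
      have hne : c i ≠ (c (i - 1)).symm := by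
        intro h
        have h1 := congrArg (fun d : P.graph.Dart => d.snd) h
        change (c i).snd = (c (i - 1)).fst at h1
        rw [hc] at h1
        have h2 : i + 1 = i - 1 := hinj h1
        have h3 : (2 : ZMod k) = 0 := by linear_combination h2
        have h4 := (ZMod.natCast_eq_zero_iff 2 k).mp (by exact_mod_cast h3)
        have := Nat.le_of_dvd (by norm_num) h4
        omega
      have hsum : ∑ d : P.graph.Dart with d.fst = (c i).fst, z d.edge =
          ∑ d ∈ {c i, (c (i - 1)).symm}, z d.edge := by
        symm
        apply Finset.sum_subset_zero_on_sdiff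
        · intro d hd
          rw [Finset.mem_insert, Finset.mem_singleton] at hd
          rw [Finset.mem_filter]
          refine ⟨Finset.mem_univ _, ?_⟩
          rcases hd with rfl | rfl
          · rfl
          · change (c (i - 1)).snd = _
            rw [hc, sub_add_cancel]
        · intro d hd
          rw [Finset.mem_sdiff, Finset.mem_filter] at hd
          obtain ⟨⟨-, hd⟩, hd'⟩ := hd
          refine (hz0 _).resolve_right fun h => hd' ?_
          obtain ⟨j, rfl | rfl⟩ := (hz1 d).mp h
          · rw [hinj hd]; simp
          · have h1 : (c j).snd = (c i).fst := hd
            rw [hc] at h1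
            have h2 : j + 1 = i := hinj h1
            rw [← h2]; simp
        · intros; rfl
      rw [hsum, Finset.sum_pair hne, (hz1 _).mpr ⟨i, Or.inl rfl⟩, (hz1 _).mpr ⟨i - 1, Or.inr rfl⟩]
      decide
    · apply Finset.sum_eq_zero
      intro d hd
      rw [Finset.mem_filter] at hd
      refine (hz0 _).resolve_right fun h => hv ?_
      obtain ⟨j, rfl | rfl⟩ := (hz1 d).mp h
      · exact ⟨j, hd.2⟩
      · exact ⟨j + 1, by rw [← hc]; exact hd.2⟩)
  -- Complementing a set of faces does not change its boundary; comparison with the outer face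
  -- selects the side that avoids it.
  let A : Finset P.Face := Finset.univ.filter fun F => g F ≠ g P.outer
  have hxor : ∀ d : P.graph.Dart, (∃ i, d = c i ∨ d = (c i).symm) ↔
      ¬ (P.faceOf d ∈ A ↔ P.faceOf d.symm ∈ A) := by
    intro d
    rw [← hz1, hg]
    simp only [A, Finset.mem_filter, Finset.mem_univ, true_and]
    generalize g (P.faceOf d) = a
    generalize g (P.faceOf d.symm) = b
    generalize g P.outer = o
    revert a b o
    decide
  have hB : #{d : P.graph.Dart | P.faceOf d ∈ A ∧ P.faceOf d.symm ∉ A} = k := by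
    conv_rhs => rw [← ZMod.card k, ← Finset.card_univ]
    symm
    refine Finset.card_bij (fun i _ => if P.faceOf (c i) ∈ A then c i else (c i).symm) ?_ ?_ ?_
    · intro i _
      have := (hxor (c i)).mp ⟨i, Or.inl rfl⟩
      rw [Finset.mem_filter]
      refine ⟨Finset.mem_univ _, ?_⟩
      split_ifs with h
      · exact ⟨h, by tauto⟩
      · rw [SimpleGraph.Dart.symm_symm]
        exact ⟨by tauto, h⟩
    · intro i _ j _ h
      have he : (c i).edge = (c j).edge := by
        have := congrArg SimpleGraph.Dart.edge h
        split_ifs at this <;> simpa using this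
      rw [SimpleGraph.dart_edge_eq_iff] at he
      rcases he with he | he
      · exact hinj (congrArg (fun d : P.graph.Dart => d.fst) he)
      · exfalso
        have h1 : (c i).fst = (c j).snd := congrArg (fun d : P.graph.Dart => d.fst) he
        have h2 : (c i).snd = (c j).fst := congrArg (fun d : P.graph.Dart => d.snd) he
        rw [hc] at h1 h2
        have h1' : i = j + 1 := hinj h1
        have h2' : i + 1 = j := hinj h2
        have h3 : (2 : ZMod k) = 0 := by linear_combination h2' - h1'
        have h4 := (ZMod.natCast_eq_zero_iff 2 k).mp (by exact_mod_cast h3)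
        have := Nat.le_of_dvd (by norm_num) h4
        omega
    · intro d hd
      rw [Finset.mem_filter] at hd
      obtain ⟨i, hi⟩ := (hxor d).mpr (by tauto)
      refine ⟨i, Finset.mem_univ _, ?_⟩
      rcases hi with rfl | rfl
      · rw [if_pos hd.2.1]
      · rw [SimpleGraph.Dart.symm_symm] at hd
        rw [if_neg hd.2.2]
  have hAo : P.outer ∉ A := by simp [A]
  have hAne : A.Nonempty := by
    have : 0 < #{d : P.graph.Dart | P.faceOf d ∈ A ∧ P.faceOf d.symm ∉ A} := by omega
    obtain ⟨d, hd⟩ := Finset.card_pos.mp this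
    exact ⟨_, (Finset.mem_filter.mp hd).2.1⟩
  have hle := hP.card_both_le hAne hAo
  have hsplit : #{d : P.graph.Dart | P.faceOf d ∈ A ∧ P.faceOf d.symm ∈ A} + k =
      #{d : P.graph.Dart | P.faceOf d ∈ A} := by
    rw [← hB, ← Finset.card_filter_add_card_filter_not
      (s := Finset.univ.filter fun d : P.graph.Dart => P.faceOf d ∈ A)
      (fun d : P.graph.Dart => P.faceOf d.symm ∈ A), Finset.filter_filter, Finset.filter_filter]
  have hlen : #{d : P.graph.Dart | P.faceOf d ∈ A} = ∑ F ∈ A, #{d : P.graph.Dart | P.faceOf d = F} := by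
    rw [Finset.card_eq_sum_card_fiberwise (f := P.faceOf) (t := A) (by
      intro d hd
      simpa using hd)]
    refine Finset.sum_congr rfl fun F hF => ?_
    congr 1
    ext d
    simp only [Finset.mem_filter, Finset.mem_univ, true_and, and_iff_right_iff_imp]
    rintro rfl
    exact hF
  have hAin : ∀ F ∈ A, F ≠ P.outer := fun F hF h => hAo (h ▸ hF)
  have hge : ∀ F ∈ A, 4 ≤ #{d : P.graph.Dart | P.faceOf d = F} := by
    intro F hF
    rcases hP.inner_cycle F (hAin F hF) with h | h
    · rw [hP.card_darts_of_isHexagonal h]; norm_num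
    · rw [hP.card_darts_of_isSquare h]
  -- The cycle length is the total face length minus the darts internal to `A`, so 6 ≥ k ≥ 4#A -
  -- (2#A - 2) and #A ≤ 2. Two faces including a hexagon have k ≥ 10 - 2; two squares never share an
  -- edge, so k = 8. Both exceed 6.
  have hone : #A = 1 := by
    have hpos := hAne.card_pos
    have h4 := Finset.card_nsmul_le_sum A _ 4 hge
    rw [smul_eq_mul] at h4
    by_contra h1
    have h2 : #A = 2 := by omega
    obtain ⟨F, F', hne, hFF⟩ := Finset.card_eq_two.mp h2
    have hlen2 : ∑ F ∈ A, #{d : P.graph.Dart | P.faceOf d = F} =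
        #{d : P.graph.Dart | P.faceOf d = F} + #{d : P.graph.Dart | P.faceOf d = F'} := by
      rw [hFF, Finset.sum_pair hne]
    have hF := hAin F (by simp [hFF])
    have hF' := hAin F' (by simp [hFF])
    have hgeF := hge F (by simp [hFF])
    have hgeF' := hge F' (by simp [hFF])
    rcases hP.inner_cycle F hF with h | h
    · rw [hP.card_darts_of_isHexagonal h] at hlen2
      omega
    · rcases hP.inner_cycle F' hF' with h' | h'
      · rw [hP.card_darts_of_isHexagonal h'] at hlen2
        omega
      · have hzero : #{d : P.graph.Dart | P.faceOf d ∈ A ∧ P.faceOf d.symm ∈ A} = 0 := by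
          rw [Finset.card_eq_zero, Finset.filter_eq_empty_iff]
          rintro d - ⟨hd, hd'⟩
          have hsq : ∀ F'' ∈ A, IsSquare F'' := by
            intro F'' h''
            rw [hFF, Finset.mem_insert, Finset.mem_singleton] at h''
            rcases h'' with rfl | rfl <;> assumption
          exact hP.not_isSquare_symm (hsq _ hd) (hsq _ hd')
        rw [hP.card_darts_of_isSquare h, hP.card_darts_of_isSquare h'] at hlen2
        omega
  obtain ⟨F, hF⟩ := Finset.card_eq_one.mp hone
  have hFA : ∀ F', F' ∈ A ↔ F' = F := by simp [hF]
  refine ⟨F, hAin F ((hFA F).mpr rfl), isFaceCycle_or_reverse hP.rot_ne hinj ?_ c hcc⟩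
  intro a b
  constructor
  · rintro ⟨d, hd, hde⟩
    obtain ⟨i, hi⟩ := (hxor d).mpr (by
      rw [hFA, hFA, hd]
      have := hP.faceOf_symm_ne (d := d)
      rw [hd] at this
      tauto)
    refine ⟨i, ?_⟩
    rw [← hde, ← hc]
    exact (SimpleGraph.dart_edge_eq_iff d (c i)).mpr hi
  · rintro ⟨i, hi⟩
    have := (hxor (c i)).mp ⟨i, Or.inl rfl⟩
    rw [hFA, hFA] at this
    rw [← hc] at hi
    by_cases h : P.faceOf (c i) = F
    · exact ⟨c i, h, hi.symm⟩
    · exact ⟨(c i).symm, by tauto, hi.symm ▸ (c i).edge_symm⟩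

end IsCata
end PlaneGraph

/-! ### Bipartiteness, and short cycles as boundary walks. -/

theorem SimpleGraph.dist_parity {V : Type*} {G : SimpleGraph V} (hG : G.Connected) {f : V → ZMod 2}
    (hf : ∀ d : G.Dart, f d.fst + f d.snd = 1) (x y : V) :
    ((G.dist x y : ℕ) : ZMod 2) = f x + f y := by
  have key : ∀ {x y : V} (p : G.Walk x y), ((p.length : ℕ) : ZMod 2) = f x + f y := by
    intro x y p
    induction p with
    | nil => simp [CharTwo.add_self_eq_zero]
    | @cons a b c h p ih =>
      have h1 : f a + f b = 1 := hf ⟨(a, b), h⟩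
      rw [SimpleGraph.Walk.length_cons, Nat.cast_succ, ih]
      linear_combination -h1 + CharTwo.add_self_eq_zero (f b)
  obtain ⟨p, hp⟩ := hG.exists_walk_length_eq_dist x y
  rw [← hp, key]

/-- Twice the Wiener polarity index is the number of ordered pairs at distance three. -/
theorem two_mul_wienerPolarity {V : Type u} [Fintype V] (G : SimpleGraph V) :
    2 * wienerPolarity G = #{p : V × V | G.dist p.1 p.2 = 3} := by
  let H : SimpleGraph V :=
    { Adj := fun x y => G.dist x y = 3
      symm := ⟨fun x y h => by rw [G.dist_comm]; exact h⟩
      loopless := ⟨fun x h => by simp at h⟩ }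
  have h1 : {e : Sym2 V | ∃ x y : V, e = s(x, y) ∧ G.dist x y = 3} = H.edgeSet := by
    ext e
    induction e with | h a b
    rw [SimpleGraph.mem_edgeSet]
    constructor
    · rintro ⟨x, y, h, hd⟩
      rcases Sym2.eq_iff.mp h with ⟨rfl, rfl⟩ | ⟨rfl, rfl⟩
      · exact hd
      · exact (show H.Adj b a from hd).symm
    · intro h
      exact ⟨a, b, rfl, h⟩
  rw [wienerPolarity, h1, Set.ncard_eq_toFinset_card', ← SimpleGraph.edgeFinset,
    H.two_mul_card_edgeFinset]

namespace PlaneGraph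

variable {V : Type u} {P : PlaneGraph V}

theorem dart_eq_of_fst_snd {d d' : P.graph.Dart} (h : d.fst = d'.fst) (h' : d.snd = d'.snd) :
    d = d' := SimpleGraph.Dart.ext _ _ (Prod.ext h h')

namespace IsCata

variable (hP : IsCata P)
include hP

/-- Every face has even length, so the constant cochain 1 is a coboundary. For the outer face this
uses that its length is the number of vertices, 4h + 2q + 2. -/
theorem exists_coloring : ∃ f : V → ZMod 2, ∀ d : P.graph.Dart, f d.fst + f d.snd = 1 := by
  have := P.finite
  have := Fintype.ofFinite V
  obtain ⟨f, hf⟩ := P.exists_vertex_potential (fun _ => 1) (by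
    intro F
    rw [Finset.sum_const, nsmul_eq_mul, mul_one]
    by_cases hF : F = P.outer
    · subst hF
      have h1 := hP.card_not_inner
      simp only [Inner, not_not] at h1
      rw [hP.card_vertices] at h1
      rw [h1]
      push_cast
      rw [show (4 : ZMod 2) = 0 from rfl, show (2 : ZMod 2) = 0 from rfl]
      ring
    · rcases hP.inner_cycle F hF with h | h
      · rw [hP.card_darts_of_isHexagonal h]; rfl
      · rw [hP.card_darts_of_isSquare h]; rfl)
  exact ⟨f, fun d => (hf d).symm⟩

theorem isSquare_of_isFaceCycle {F : P.Face} (hF : F ≠ P.outer) {c : ZMod 4 → P.graph.Dart}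
    (hc : IsFaceCycle F c) : IsSquare F := by
  have := P.finite
  have := Fintype.ofFinite V
  refine (hP.inner_cycle F hF).resolve_left fun h => ?_
  have h1 := hc.card_darts fun _ => True
  simp only [and_true, hP.card_darts_of_isHexagonal h] at h1
  simp [ZMod.card] at h1

/-- The two alternatives are the two orientations: the square lies on the face side of the given
darts or on the side of their reverses. -/
theorem square_of_cycle {c₀ c₁ c₂ c₃ : P.graph.Dart} (h₀ : c₀.snd = c₁.fst) (h₁ : c₁.snd = c₂.fst)
    (h₂ : c₂.snd = c₃.fst) (h₃ : c₃.snd = c₀.fst) (h02 : c₀.fst ≠ c₂.fst) (h13 : c₁.fst ≠ c₃.fst) :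
    (IsSquare (P.faceOf c₀) ∧ P.next c₀ = c₁ ∧ P.next c₁ = c₂ ∧ P.next c₂ = c₃ ∧ P.next c₃ = c₀) ∨
    (IsSquare (P.faceOf c₀.symm) ∧ P.next c₁.symm = c₀.symm ∧ P.next c₂.symm = c₁.symm ∧
      P.next c₃.symm = c₂.symm ∧ P.next c₀.symm = c₃.symm) := by
  have e01 : c₀.fst ≠ c₁.fst := h₀ ▸ c₀.fst_ne_snd
  have e12 : c₁.fst ≠ c₂.fst := h₁ ▸ c₁.fst_ne_snd
  have e23 : c₂.fst ≠ c₃.fst := h₂ ▸ c₂.fst_ne_snd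
  have e30 : c₃.fst ≠ c₀.fst := h₃ ▸ c₃.fst_ne_snd
  obtain ⟨F, hF, hc | hc⟩ := hP.exists_face_of_cycle (k := 4) (by norm_num) (by norm_num)
    (![c₀, c₁, c₂, c₃] : Fin 4 → P.graph.Dart)
    (fun i : Fin 4 => by fin_cases i; exacts [h₀, h₁, h₂, h₃]) (by
      change ∀ i j : Fin 4, _
      simp only [Fin.forall_fin_succ, Matrix.cons_val_zero, Matrix.cons_val_succ]
      simp [*, Ne.symm]
      exact ⟨rfl, rfl, rfl, rfl⟩)
  · have h0 : P.faceOf c₀ = F := hc.faceOf 0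
    exact Or.inl ⟨h0 ▸ hP.isSquare_of_isFaceCycle hF hc, hc.next_eq 0, hc.next_eq 1, hc.next_eq 2,
      hc.next_eq 3⟩
  · have h0 : P.faceOf c₀.symm = F := hc.faceOf 3
    exact Or.inr ⟨h0 ▸ hP.isSquare_of_isFaceCycle hF hc, hc.next_eq 2, hc.next_eq 1, hc.next_eq 0,
      hc.next_eq 3⟩

theorem isHexagonal_of_isFaceCycle {F : P.Face} (hF : F ≠ P.outer) {c : ZMod 6 → P.graph.Dart}
    (hc : IsFaceCycle F c) : IsHexagonal F := by
  have := P.finite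
  have := Fintype.ofFinite V
  refine (hP.inner_cycle F hF).resolve_right fun h => ?_
  have h1 := hc.card_darts fun _ => True
  simp only [and_true, hP.card_darts_of_isSquare h] at h1
  simp [ZMod.card] at h1

/-- Distinctness is only required within each colour class, since the 2-colouring separates the
other pairs. The steps kept for each orientation are the ones that make one of two competing paths
redundant. -/
theorem hexagon_of_cycle {c₀ c₁ c₂ c₃ c₄ c₅ : P.graph.Dart} (h₀ : c₀.snd = c₁.fst)
    (h₁ : c₁.snd = c₂.fst) (h₂ : c₂.snd = c₃.fst) (h₃ : c₃.snd = c₄.fst) (h₄ : c₄.snd = c₅.fst)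
    (h₅ : c₅.snd = c₀.fst) (h02 : c₀.fst ≠ c₂.fst) (h24 : c₂.fst ≠ c₄.fst) (h40 : c₄.fst ≠ c₀.fst)
    (h13 : c₁.fst ≠ c₃.fst) (h35 : c₃.fst ≠ c₅.fst) (h51 : c₅.fst ≠ c₁.fst) :
    (IsHexagonal (P.faceOf c₀) ∧ P.next c₀ = c₁ ∧ P.next c₁ = c₂) ∨
    (IsHexagonal (P.faceOf c₅.symm) ∧ P.next c₅.symm = c₄.symm ∧ P.next c₄.symm = c₃.symm) := by
  obtain ⟨f, hf⟩ := hP.exists_coloring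
  have e0 := hf c₀
  have e1 := hf c₁
  have e2 := hf c₂
  have e3 := hf c₃
  have e4 := hf c₄
  have e5 := hf c₅
  rw [h₀] at e0
  rw [h₁] at e1
  rw [h₂] at e2
  rw [h₃] at e3
  rw [h₄] at e4
  rw [h₅] at e5
  have ne_of : ∀ {v w : V}, f v + f w = 1 → v ≠ w := by
    rintro v _ h rfl
    rw [CharTwo.add_self_eq_zero] at h
    exact zero_ne_one h
  have e01 := ne_of e0
  have e12 := ne_of e1
  have e23 := ne_of e2
  have e34 := ne_of e3
  have e45 := ne_of e4
  have e50 := ne_of e5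
  have two : (2 : ZMod 2) = 0 := rfl
  have e03 : c₀.fst ≠ c₃.fst := ne_of (by linear_combination e0 + e1 + e2 - (f c₁.fst + f c₂.fst - 1) * two)
  have e14 : c₁.fst ≠ c₄.fst := ne_of (by linear_combination e1 + e2 + e3 - (f c₂.fst + f c₃.fst - 1) * two)
  have e25 : c₂.fst ≠ c₅.fst := ne_of (by linear_combination e2 + e3 + e4 - (f c₃.fst + f c₄.fst - 1) * two)
  clear e0 e1 e2 e3 e4 e5 hf two ne_of
  obtain ⟨F, hF, hc | hc⟩ := hP.exists_face_of_cycle (k := 6) (by norm_num) (by norm_num)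
    (![c₀, c₁, c₂, c₃, c₄, c₅] : Fin 6 → P.graph.Dart)
    (fun i : Fin 6 => by fin_cases i; exacts [h₀, h₁, h₂, h₃, h₄, h₅]) (by
      change ∀ i j : Fin 6, _
      simp only [Fin.forall_fin_succ, Matrix.cons_val_zero, Matrix.cons_val_succ]
      simp [*, Ne.symm]
      exact ⟨rfl, rfl, rfl, rfl, rfl, rfl⟩)
  · have h0 : P.faceOf c₀ = F := hc.faceOf 0
    exact Or.inl ⟨h0 ▸ hP.isHexagonal_of_isFaceCycle hF hc, hc.next_eq 0, hc.next_eq 1⟩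
  · have h0 : P.faceOf c₅.symm = F := hc.faceOf 0
    exact Or.inr ⟨h0 ▸ hP.isHexagonal_of_isFaceCycle hF hc, hc.next_eq 0, hc.next_eq 1⟩

end IsCata
end PlaneGraph

/-! ### Pairs at distance three and their representing paths. -/

namespace PlaneGraph

variable {V : Type u} {P : PlaneGraph V}

/-- The path `a.snd, m.fst, m.snd, b.snd` with three edges, given by its middle dart `m` and the
darts `a`, `b` leading from the middle edge to the ends. -/
structure IsThreePath (a m b : P.graph.Dart) : Prop where
  fst_left : a.fst = m.fst
  left_ne : a ≠ m
  fst_right : b.fst = m.snd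
  right_ne : b ≠ m.symm

/-- Three-paths that run along three edges of a square, or that run along half a hexagon or
along two edges of a square in a non-preferred direction. -/
def IsRedundant (a m b : P.graph.Dart) : Prop :=
  (Inner m ∧ P.rot a = m ∧ P.rot m.symm = b) ∨
  (IsSquare (P.faceOf m.symm) ∧ P.rot m = a ∧ P.rot b = m.symm) ∨
  (IsSquare (P.faceOf m) ∧
    ((P.rot a = m ∧ P.rot b = m.symm) ∨ (P.rot m = a ∧ P.rot m.symm = b)))

namespace IsThreePath

variable {a m b : P.graph.Dart} (h : IsThreePath a m b)
include h

theorem left_snd_ne : a.snd ≠ m.snd := fun h' => h.left_ne (dart_eq_of_fst_snd h.fst_left h')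

theorem right_snd_ne : b.snd ≠ m.fst := fun h' => h.right_ne (dart_eq_of_fst_snd h.fst_right h')

end IsThreePath

theorem IsSquare.inner {d : P.graph.Dart} (h : IsSquare (P.faceOf d)) : Inner d := h.1

theorem IsHexagonal.inner {d : P.graph.Dart} (h : IsHexagonal (P.faceOf d)) : Inner d := h.1

namespace IsCata

variable (hP : IsCata P)
include hP

theorem rot_eq_or {a m : P.graph.Dart} (h : a.fst = m.fst) (hne : a ≠ m) :
    P.rot a = m ∨ P.rot m = a := by
  rcases hP.eq_or_of_fst_eq h with rfl | rfl | rfl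
  · exact absurd rfl hne
  · exact Or.inr rfl
  · exact Or.inl (hP.rot_rot_rot hne)

theorem rot_eq_of_ne {a a' m : P.graph.Dart} (h : a.fst = m.fst) (hne : a ≠ m) (haa' : a ≠ a')
    (h' : P.rot a' = m) : P.rot m = a := by
  refine (hP.rot_eq_or h hne).resolve_left fun h1 => haa' ?_
  exact P.rot.injective (h1.trans h'.symm)

theorem rot_eq_of_ne' {a a' m : P.graph.Dart} (h : a.fst = m.fst) (hne : a ≠ m) (haa' : a ≠ a')
    (h' : P.rot m = a') : P.rot a = m := by
  refine (hP.rot_eq_or h hne).resolve_right fun h1 => haa' ?_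
  rw [← h1, h']

/-- The colouring makes the distance odd, and it is at most three. Distance one would close the path
to a 4-cycle, hence a square with three sides on the path, and such paths are redundant. -/
theorem dist_eq_three {a m b : P.graph.Dart} (h : IsThreePath a m b)
    (hr : ¬ IsRedundant a m b) : P.graph.dist a.snd b.snd = 3 := by
  have hadj1 : P.graph.Adj a.snd m.fst := h.fst_left ▸ a.adj.symm
  have hadj2 : P.graph.Adj m.snd b.snd := h.fst_right ▸ b.adj
  have hle : P.graph.dist a.snd b.snd ≤ 3 :=
    SimpleGraph.dist_le (.cons hadj1 (.cons m.adj (.cons hadj2 .nil)))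
  obtain ⟨f, hf⟩ := hP.exists_coloring
  have hpar := SimpleGraph.dist_parity P.connected hf a.snd b.snd
  have two : (2 : ZMod 2) = 0 := rfl
  have hone : f a.snd + f b.snd = 1 := by
    have h1 := hf a
    have h2 := hf m
    have h3 := hf b
    rw [h.fst_left] at h1
    rw [h.fst_right] at h3
    linear_combination h1 + h2 + h3 - (f m.fst + f m.snd - 1) * two
  rw [hone] at hpar
  have hne1 : P.graph.dist a.snd b.snd ≠ 1 := by
    intro h1
    have hadj : P.graph.Adj a.snd b.snd := SimpleGraph.dist_eq_one_iff_adj.mp h1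
    apply hr
    rcases hP.square_of_cycle (c₀ := a.symm) (c₁ := m) (c₂ := b) (c₃ := ⟨(b.snd, a.snd), hadj.symm⟩)
      h.fst_left h.fst_right.symm rfl rfl (by rw [h.fst_right]; exact h.left_snd_ne)
      h.right_snd_ne.symm with ⟨h0, h1, h2, -⟩ | ⟨h0, h1, h2, -⟩
    · refine Or.inl ⟨?_, by rw [← h1, next_symm], h2⟩
      rw [← inner_next_symm_iff, ← h1, Equiv.symm_apply_apply]
      exact h0.inner
    · rw [next_symm] at h1
      rw [SimpleGraph.Dart.symm_symm] at h0 h1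
      refine Or.inr (Or.inl ⟨?_, h1, by rw [← h2, next_symm]⟩)
      rw [← faceOf_rot, h1]
      exact h0
  have : P.graph.dist a.snd b.snd = 0 ∨ P.graph.dist a.snd b.snd = 1 ∨
    P.graph.dist a.snd b.snd = 2 ∨ P.graph.dist a.snd b.snd = 3 := by omega
  rcases this with h0 | h1 | h2 | h3
  · rw [h0] at hpar; exact absurd hpar (by decide)
  · exact absurd h1 hne1
  · rw [h2] at hpar; exact absurd hpar (by decide)
  · exact h3

theorem isRedundant_of_left {a m b m' b' : P.graph.Dart} (h : IsThreePath a m b)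
    (h' : IsThreePath a m' b') (h0 : IsSquare (P.faceOf m)) (h1 : P.next m = b)
    (h2 : P.rot m' = m) : IsRedundant a m b :=
  Or.inr (Or.inr ⟨h0, Or.inr ⟨hP.rot_eq_of_ne h.fst_left h.left_ne h'.left_ne h2, h1⟩⟩)

theorem isRedundant_of_right {a m b m' a' : P.graph.Dart} (h : IsThreePath a m b)
    (h' : IsThreePath a' m' b) (h0 : IsSquare (P.faceOf m)) (h1 : P.rot a = m)
    (h2 : P.rot m.symm = m'.symm) : IsRedundant a m b :=
  Or.inr (Or.inr ⟨h0, Or.inl ⟨h1, hP.rot_eq_of_ne' h.fst_right h.right_ne h'.right_ne h2⟩⟩)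

/-- If the paths differ in one inner vertex they form a 4-cycle together with a common edge; if they
differ in both they form a 6-cycle. The cycle bounds a face, and its orientation decides which of
the two paths is redundant. -/
theorem threePath_unique {a m b a' m' b' : P.graph.Dart} (h : IsThreePath a m b)
    (hr : ¬ IsRedundant a m b) (h' : IsThreePath a' m' b') (hr' : ¬ IsRedundant a' m' b')
    (ha : a.snd = a'.snd) (hb : b.snd = b'.snd) : a = a' ∧ m = m' ∧ b = b' := by
  by_cases hp : m.fst = m'.fst
  · obtain rfl : a = a' := dart_eq_of_fst_snd (by rw [h.fst_left, h'.fst_left, hp]) ha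
    by_cases hq : m.snd = m'.snd
    · obtain rfl : m = m' := dart_eq_of_fst_snd hp hq
      exact ⟨rfl, rfl, dart_eq_of_fst_snd (by rw [h.fst_right, h'.fst_right]) hb⟩
    · exfalso
      rcases hP.square_of_cycle (c₀ := m) (c₁ := b) (c₂ := b'.symm) (c₃ := m'.symm)
        h.fst_right.symm hb h'.fst_right hp.symm
        (by change m.fst ≠ b'.snd; rw [← hb]; exact h.right_snd_ne.symm)
        (by change b.fst ≠ m'.snd; rw [h.fst_right]; exact hq)
        with ⟨h0, h1, -, -, h4⟩ | ⟨h0, -, -, h3, h4⟩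
      · exact hr (hP.isRedundant_of_left h h' h0 h1 (by rw [← h4, next_symm]))
      · simp only [SimpleGraph.Dart.symm_symm] at h3 h4
        refine hr' (hP.isRedundant_of_left h' h ?_ h3 (by rw [← h4, next_symm]))
        rw [← h4, faceOf_next]
        exact h0
  · by_cases hq : m.snd = m'.snd
    · obtain rfl : b = b' := dart_eq_of_fst_snd (by rw [h.fst_right, h'.fst_right, hq]) hb
      exfalso
      rcases hP.square_of_cycle (c₀ := a.symm) (c₁ := m) (c₂ := m'.symm) (c₃ := a')
        h.fst_left hq h'.fst_left.symm ha.symm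
        (by change a.snd ≠ m'.snd; rw [← hq]; exact h.left_snd_ne)
        (by rw [h'.fst_left]; exact hp)
        with ⟨h0, h1, h2, -⟩ | ⟨h0, -, h2, h3, h4⟩
      · refine hr (hP.isRedundant_of_right h h' ?_ (by rw [← h1, next_symm]) h2)
        rw [← h1, faceOf_next]
        exact h0
      · simp only [SimpleGraph.Dart.symm_symm] at h0 h2 h3 h4
        refine hr' (hP.isRedundant_of_right h' h ?_ (by rw [← h3, next_symm]) h2)
        rw [← h3, faceOf_next, ← h4, faceOf_next]
        exact h0
    · exfalso
      rcases hP.hexagon_of_cycle (c₀ := a.symm) (c₁ := m) (c₂ := b) (c₃ := b'.symm) (c₄ := m'.symm)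
        (c₅ := a') h.fst_left h.fst_right.symm hb h'.fst_right h'.fst_left.symm ha.symm
        (by rw [h.fst_right]; exact h.left_snd_ne)
        (by rw [h.fst_right]; exact hq)
        (by change m'.snd ≠ a.snd; rw [ha]; exact h'.left_snd_ne.symm)
        (by change m.fst ≠ b'.snd; rw [← hb]; exact h.right_snd_ne.symm)
        (by change b'.snd ≠ a'.fst; rw [h'.fst_left]; exact h'.right_snd_ne)
        (by rw [h'.fst_left]; exact fun e => hp e.symm)
        with ⟨h0, h1, h2⟩ | ⟨h0, h1, h2⟩
      · refine hr (Or.inl ⟨?_, by rw [← h1, next_symm], h2⟩)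
        rw [← inner_next_symm_iff, ← h1, Equiv.symm_apply_apply]
        exact h0.inner
      · simp only [SimpleGraph.Dart.symm_symm] at h1 h2
        refine hr' (Or.inl ⟨?_, by rw [← h1, next_symm], h2⟩)
        rw [← inner_next_symm_iff, ← h1, Equiv.symm_apply_apply]
        exact h0.inner

omit hP in
theorem not_rot_both {a m : P.graph.Dart} (hm : Cubic m) (h : P.rot a = m) : P.rot m ≠ a := by
  rintro rfl
  exact hm h

/-- A redundant geodesic is rerouted around the other side of the hexagon or square that makes it
redundant. Three sides of a square cannot occur, because the ends are not adjacent. -/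
theorem exists_threePath {x y : V} (hd : P.graph.dist x y = 3) :
    ∃ a m b : P.graph.Dart, IsThreePath a m b ∧ ¬ IsRedundant a m b ∧ a.snd = x ∧ b.snd = y := by
  have hnadj : ¬ P.graph.Adj x y := by
    intro h
    rw [SimpleGraph.dist_eq_one_iff_adj.mpr h] at hd
    norm_num at hd
  obtain ⟨p, hp⟩ := P.connected.exists_walk_length_eq_dist x y
  rw [hd] at hp
  match p, hp with
  | .cons (v := v) h1 (.cons (v := w) h2 (.cons h3 .nil)), _ =>
  let a : P.graph.Dart := ⟨(v, x), h1.symm⟩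
  let m : P.graph.Dart := ⟨(v, w), h2⟩
  let b : P.graph.Dart := ⟨(w, y), h3⟩
  have hpath : IsThreePath a m b := by
    refine ⟨rfl, ?_, rfl, ?_⟩
    · intro h
      have : x = w := congrArg (fun d : P.graph.Dart => d.snd) h
      subst this
      exact hnadj h3
    · intro h
      have : y = v := congrArg (fun d : P.graph.Dart => d.snd) h
      subst this
      exact hnadj h1
  by_cases hr : IsRedundant a m b
  swap
  · exact ⟨a, m, b, hpath, hr, rfl, rfl⟩
  have hx : a.snd = x := rfl
  have hy : b.snd = y := rfl
  have hfst : a.fst = m.fst := rfl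
  clear_value a m b
  rcases hr with ⟨h0, h1, h2⟩ | ⟨h0, h1, h2⟩ | ⟨h0, ⟨h1, h2⟩ | ⟨h1, h2⟩⟩
  · rcases hP.isHexagonal_or_isSquare h0 with h6 | h4
    · obtain ⟨c, hc, rfl⟩ := hP.exists_hexagon_cycle h6
      have e1 : c 1 = b := by rw [← h2, ← next_apply, hc.next_eq]; rfl
      have e5 : c 5 = a.symm := by
        rw [← next_symm] at h1
        exact P.next.injective ((hc.next_eq 5).trans h1.symm)
      have r4 : P.rot (c 3).symm = c 4 := hc.next_eq 3
      have r2 : P.rot (c 2).symm = (c 3).symm.symm := hc.next_eq 2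
      have hcub : Inner (c 3).symm → Cubic (c 3).symm := fun hi =>
        hP.cubic_of_shared (d := (c 3).symm)
          ⟨hi, by rw [SimpleGraph.Dart.symm_symm, Inner, hc.faceOf]; exact h6.inner⟩
      -- The opposite half of the hexagon: its middle dart has the hexagon on its reverse side, so
      -- the preference for directions accepts it.
      refine ⟨c 4, (c 3).symm, (c 2).symm, ⟨(hc.snd_eq 3).symm, ?_, hc.snd_eq 2, ?_⟩, ?_, ?_, ?_⟩
      · rw [← r4]; exact hP.rot_ne _
      · rw [SimpleGraph.Dart.symm_symm]
        intro h
        rw [h] at r2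
        exact hP.rot_ne _ r2
      · rintro (⟨i0, i1, -⟩ | ⟨i0, -⟩ | ⟨i0, ⟨i1, -⟩ | ⟨-, i2⟩⟩)
        · exact not_rot_both (hcub i0) i1 r4
        · rw [SimpleGraph.Dart.symm_symm, hc.faceOf] at i0
          exact hP.not_isSquare h6 i0
        · exact not_rot_both (hcub i0.inner) i1 r4
        · have := hP.cubic_of_shared (d := (c 3).symm.symm)
            (by rw [SimpleGraph.Dart.symm_symm]
                exact ⟨by rw [Inner, hc.faceOf]; exact h6.inner, i0.inner⟩)
          exact not_rot_both this r2 i2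
      · rw [hc.snd_eq, ← hx]
        change (c 5).fst = _
        rw [e5]; rfl
      · change (c 2).fst = _
        rw [← hy, ← e1, hc.snd_eq]; rfl
    · exfalso
      obtain ⟨c, hc, rfl⟩ := hP.exists_square_cycle h4
      have e1 : c 1 = b := by rw [← h2, ← next_apply, hc.next_eq]; rfl
      have e3 : c 3 = a.symm := by
        rw [← next_symm] at h1
        exact P.next.injective ((hc.next_eq 3).trans h1.symm)
      apply hnadj
      rw [← hx, ← hy, ← e1, hc.snd_eq]
      have : a.snd = (c 2).snd := by
        rw [hc.snd_eq]
        change _ = (c 3).fst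
        rw [e3]; rfl
      rw [this]
      exact (c 2).adj.symm
  · exfalso
    obtain ⟨c, hc, hc0⟩ := hP.exists_square_cycle h0
    have e1 : c 1 = a := by
      rw [← h1, ← next_symm, ← hc0, hc.next_eq]; rfl
    have e3 : c 3 = b.symm := by
      rw [← next_symm] at h2
      refine P.next.injective ((hc.next_eq 3).trans ?_)
      rw [h2, ← hc0]; rfl
    apply hnadj
    rw [← hx, ← hy, ← e1, hc.snd_eq]
    have : b.snd = (c 2).snd := by
      rw [hc.snd_eq]
      change _ = (c 3).fst
      rw [e3]; rfl
    rw [this]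
    exact (c 2).adj
  · obtain ⟨c, hc, rfl⟩ := hP.exists_square_cycle h0
    have e3 : c 3 = a.symm := by
      rw [← next_symm] at h1
      exact P.next.injective ((hc.next_eq 3).trans h1.symm)
    have r2 : P.rot (c 1).symm = c 2 := hc.next_eq 1
    have r1 : P.rot (c 0).symm = (c 1).symm.symm := hc.next_eq 0
    have hq : IsSquare (P.faceOf (c 1)) := by rw [hc.faceOf]; exact h0
    have hcub : Cubic (c 1) := hP.square_cubic _ hq
    have hnq := hP.not_isSquare_symm hq
    have hbf : b.fst = (c 1).fst := by rw [hpath.fst_right, hc.snd_eq]; rfl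
    have r3 : P.rot (c 1) = b := by
      rw [SimpleGraph.Dart.symm_symm] at r1
      apply P.rot.injective
      rw [h2, ← r1, hP.rot_rot_rot]
      rw [← cubic_rot_iff, r1]
      exact hcub
    -- The first two edges run along the square, so the path takes the other two sides to the same
    -- corner and keeps its last edge.
    refine ⟨c 2, (c 1).symm, b, ⟨(hc.snd_eq 1).symm, ?_, hbf, ?_⟩, ?_, ?_, ?_⟩
    · rw [← r2]; exact hP.rot_ne _
    · rw [SimpleGraph.Dart.symm_symm, ← r3]; exact hP.rot_ne _
    · rintro (⟨i0, i1, -⟩ | ⟨-, -, i2⟩ | ⟨i0, -⟩)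
      · exact not_rot_both (hP.cubic_of_shared (d := (c 1).symm) ⟨i0, hq.inner⟩) i1 r2
      · rw [SimpleGraph.Dart.symm_symm] at i2
        exact not_rot_both hcub i2 r3
      · exact hnq i0
    · rw [hc.snd_eq]
      change (c 3).fst = _
      rw [e3]; exact hx
    · exact hy
  · obtain ⟨c, hc, rfl⟩ := hP.exists_square_cycle h0
    have e1 : c 1 = b := by rw [← h2, ← next_apply, hc.next_eq]; rfl
    have r0 : P.rot (c 3).symm = c 0 := hc.next_eq 3
    have r2 : P.rot (c 2).symm = (c 3).symm.symm := hc.next_eq 2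
    have hq : IsSquare (P.faceOf (c 3)) := by rw [hc.faceOf]; exact h0
    have hcub : Cubic (c 3) := hP.square_cubic _ hq
    have hcub' : Cubic (c 3).symm := by rw [← cubic_rot_iff, r0]; exact hP.square_cubic _ h0
    have hnq := hP.not_isSquare_symm hq
    have r1 : P.rot a = (c 3).symm := by
      rw [← h1, ← r0, hP.rot_rot_rot hcub']
    -- Here the last two edges run along the square, so those are exchanged and the first edge is
    -- kept.
    refine ⟨a, (c 3).symm, (c 2).symm, ⟨?_, ?_, hc.snd_eq 2, ?_⟩, ?_, hx, ?_⟩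
    · rw [hfst]; exact (hc.snd_eq 3).symm
    · rw [← r1]; exact (hP.rot_ne _).symm
    · rw [SimpleGraph.Dart.symm_symm]
      intro h
      rw [h] at r2
      exact hP.rot_ne _ r2
    · rintro (⟨-, -, i2⟩ | ⟨-, i1, -⟩ | ⟨i0, -⟩)
      · exact not_rot_both hcub r2 i2
      · exact not_rot_both hcub' r1 i1
      · exact hnq i0
    · change (c 2).fst = _
      rw [← hy, ← e1, hc.snd_eq]; rfl

end IsCata
end PlaneGraph

/-- Inclusion and exclusion for the continuations of a middle edge to the left or right at both
ends. The hypotheses ensure that the excluded pairs are distinct whenever several exclusions apply;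
a coincidence such as `aL = aR` encodes an end of degree two. -/
theorem Finset.card_pairs_filter {D : Type*} (aL aR bL bR : D) (i s s' : Prop)
    (his : i → s' → aL ≠ aR ∧ bL ≠ bR) (hs : s → i ∧ ¬ s' ∧ aL ≠ aR ∧ bL ≠ bR) :
    #{p ∈ ({aL, aR} : Finset D) ×ˢ ({bL, bR} : Finset D) | ¬ ((i ∧ p.1 = aL ∧ p.2 = bL) ∨
      (s' ∧ p.1 = aR ∧ p.2 = bR) ∨
      (s ∧ ((p.1 = aL ∧ p.2 = bR) ∨ (p.1 = aR ∧ p.2 = bL))))} +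
      ((if i then 1 else 0) + (if s' then 1 else 0) + 2 * (if s then 1 else 0)) =
    (1 + if aL ≠ aR then 1 else 0) * (1 + if bR ≠ bL then 1 else 0) := by
  rw [Finset.card_filter, Finset.sum_product]
  by_cases ha : aL = aR <;> by_cases hb : bL = bR
  · subst ha hb
    by_cases hi : i <;> by_cases hs' : s' <;> by_cases hss : s <;> simp_all
  · subst ha
    rw [Finset.pair_eq_singleton, Finset.sum_singleton, Finset.sum_pair hb]
    by_cases hi : i <;> by_cases hs' : s' <;> by_cases hss : s <;> simp_all [Ne.symm hb]
  · subst hb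
    rw [Finset.pair_eq_singleton, Finset.sum_pair ha]
    by_cases hi : i <;> by_cases hs' : s' <;> by_cases hss : s <;> simp_all [Ne.symm ha]
  · rw [Finset.sum_pair ha, Finset.sum_pair hb, Finset.sum_pair hb]
    by_cases hi : i <;> by_cases hs' : s' <;> by_cases hss : s <;>
      simp_all [Ne.symm ha, Ne.symm hb]

/-! ### Counting paths by their middle edge. -/

namespace PlaneGraph

variable {V : Type u} {P : PlaneGraph V}

/-- The dart belongs to an outer edge whose two ends have degree three. -/
def IsBay (d : P.graph.Dart) : Prop := (Inner d ∧ ¬ Shared d) ∧ Cubic d ∧ Cubic d.symm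

namespace IsCata

variable (hP : IsCata P)
include hP

theorem mem_pair_iff {a m : P.graph.Dart} :
    a.fst = m.fst ∧ a ≠ m ↔ a = P.rot.symm m ∨ a = P.rot m := by
  constructor
  · rintro ⟨h, hne⟩
    rcases hP.rot_eq_or h hne with h | h
    · exact Or.inl ((Equiv.eq_symm_apply _).mpr h)
    · exact Or.inr h.symm
  · rintro (rfl | rfl)
    · refine ⟨by rw [← P.rot_fst, Equiv.apply_symm_apply], fun h => hP.rot_ne m ?_⟩
      conv_lhs => rw [← h]
      exact P.rot.apply_symm_apply m
    · exact ⟨P.rot_fst m, hP.rot_ne m⟩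

omit hP in
theorem rot_symm_ne_iff {m : P.graph.Dart} : P.rot.symm m ≠ P.rot m ↔ Cubic m := by
  rw [Cubic, Ne, Ne, Equiv.symm_apply_eq, eq_comm]

/-- Each end of `m` offers one continuation, or two if its degree is three. An inner face on the
side of `m` removes one pair, a square on the reverse side one more, and a square on the side of `m`
two more, namely the two pairs that leave it after two sides. -/
theorem card_threePaths_middle [Fintype V] (m : P.graph.Dart) :
    #{p : P.graph.Dart × P.graph.Dart | IsThreePath p.1 m p.2 ∧ ¬ IsRedundant p.1 m p.2} +
      ((if Inner m then 1 else 0) + (if IsSquare (P.faceOf m.symm) then 1 else 0) +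
        2 * (if IsSquare (P.faceOf m) then 1 else 0)) =
    (1 + if Cubic m then 1 else 0) * (1 + if Cubic m.symm then 1 else 0) := by
  have h := Finset.card_pairs_filter (P.rot.symm m) (P.rot m) (P.rot m.symm) (P.rot.symm m.symm)
    (Inner m) (IsSquare (P.faceOf m)) (IsSquare (P.faceOf m.symm))
    (fun h h' => by
      have hs : Shared m := ⟨h, h'.inner⟩
      exact ⟨rot_symm_ne_iff.mpr (hP.cubic_of_shared hs),
        (rot_symm_ne_iff.mpr (hP.cubic_of_shared hs.symm)).symm⟩)
    (fun h => ⟨h.inner, hP.not_isSquare_symm h, rot_symm_ne_iff.mpr (hP.square_cubic _ h),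
      (rot_symm_ne_iff.mpr (by
        rw [← cubic_next_iff]
        exact hP.square_cubic _ (by rwa [faceOf_next]))).symm⟩)
  simp only [rot_symm_ne_iff] at h
  rw [← h]
  congr 2
  ext ⟨a, b⟩
  simp only [Finset.mem_filter, Finset.mem_univ, true_and, Finset.mem_product, Finset.mem_insert,
    Finset.mem_singleton]
  have h1 : IsThreePath a m b ↔ (a = P.rot.symm m ∨ a = P.rot m) ∧
      (b = P.rot m.symm ∨ b = P.rot.symm m.symm) := by
    rw [← hP.mem_pair_iff, or_comm (a := b = _), ← hP.mem_pair_iff]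
    exact ⟨fun h => ⟨⟨h.1, h.2⟩, h.3, h.4⟩, fun h => ⟨h.1.1, h.1.2, h.2.1, h.2.2⟩⟩
  rw [h1]
  simp only [IsRedundant, Equiv.eq_symm_apply, eq_comm (a := a) (b := P.rot m),
    eq_comm (a := b) (b := P.rot m.symm)]

theorem card_dist_eq_three [Fintype V] : #{p : V × V | P.graph.dist p.1 p.2 = 3} =
    ∑ m, #{p : P.graph.Dart × P.graph.Dart | IsThreePath p.1 m p.2 ∧ ¬ IsRedundant p.1 m p.2} := by
  have h1 : ∑ m, #{p : P.graph.Dart × P.graph.Dart |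
      IsThreePath p.1 m p.2 ∧ ¬ IsRedundant p.1 m p.2} =
      #{t : P.graph.Dart × P.graph.Dart × P.graph.Dart |
        IsThreePath t.2.1 t.1 t.2.2 ∧ ¬ IsRedundant t.2.1 t.1 t.2.2} := by
    simp only [Finset.card_filter]
    rw [Fintype.sum_prod_type]
  rw [h1]
  symm
  refine Finset.card_bij (fun t _ => (t.2.1.snd, t.2.2.snd)) ?_ ?_ ?_
  · rintro ⟨m, a, b⟩ h
    simp only [Finset.mem_filter, Finset.mem_univ, true_and] at h ⊢
    exact hP.dist_eq_three h.1 h.2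
  · rintro ⟨m, a, b⟩ h ⟨m', a', b'⟩ h' he
    simp only [Finset.mem_filter, Finset.mem_univ, true_and, Prod.mk.injEq] at h h' he
    obtain ⟨rfl, rfl, rfl⟩ := hP.threePath_unique h.1 h.2 h'.1 h'.2 he.1 he.2
    rfl
  · rintro ⟨x, y⟩ h
    simp only [Finset.mem_filter, Finset.mem_univ, true_and] at h
    obtain ⟨a, m, b, h1, h2, rfl, rfl⟩ := hP.exists_threePath h
    exact ⟨(m, a, b), by simpa using ⟨h1, h2⟩, rfl⟩

omit hP in
theorem card_symm [Fintype V] (p : P.graph.Dart → Prop) :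
    #{d : P.graph.Dart | p d.symm} = #{d : P.graph.Dart | p d} := by
  refine Finset.card_bij (fun d _ => d.symm) (by simp) ?_ ?_
  · intro d _ d' _ h
    exact SimpleGraph.Dart.symm_involutive.injective h
  · intro d hd
    exact ⟨d.symm, by simpa using hd, d.symm_symm⟩

omit hP in
theorem card_rot [Fintype V] (p : P.graph.Dart → Prop) :
    #{d : P.graph.Dart | p (P.rot d)} = #{d : P.graph.Dart | p d} := by
  refine Finset.card_bij (fun d _ => P.rot d) (by simp) ?_ ?_
  · intro d _ d' _ h
    exact P.rot.injective h
  · intro d hd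
    exact ⟨P.rot.symm d, by simpa using hd, P.rot.apply_symm_apply d⟩

theorem card_square [Fintype V] :
    #{d : P.graph.Dart | IsSquare (P.faceOf d)} = 4 * #{F : P.Face | IsSquare F} := by
  rw [Finset.card_eq_sum_card_fiberwise (f := P.faceOf)
    (t := Finset.univ.filter fun F : P.Face => IsSquare F) (by
      intro d hd
      simpa using hd), Finset.sum_congr rfl (g := fun _ => 4), Finset.sum_const, smul_eq_mul,
      mul_comm]
  intro F hF
  rw [Finset.filter_filter, ← hP.card_darts_of_isSquare (Finset.mem_filter.mp hF).2]
  congr 1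
  ext d
  simp only [Finset.mem_filter, Finset.mem_univ, true_and, and_iff_right_iff_imp]
  rintro rfl
  exact (Finset.mem_filter.mp hF).2

/-- Among the three darts at a vertex of degree three one is outer, so exactly one of the three
cyclically consecutive pairs is inner, that is, exactly one dart is shared. -/
theorem card_cubic [Fintype V] : #{d : P.graph.Dart | Cubic d} =
    3 * #{d : P.graph.Dart | Shared d} := by
  have h1 : ∀ d : P.graph.Dart, (if Cubic d then 1 else 0) = (if Shared d then 1 else 0) +
      (if Shared (P.rot d) then 1 else 0) + if Shared (P.rot (P.rot d)) then 1 else 0 := by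
    intro d
    by_cases hc : Cubic d
    · have hs := hP.rot_rot_rot hc
      rw [if_pos hc]
      simp only [shared_iff, hs]
      obtain ⟨o, ⟨ho, ho'⟩, -⟩ := hP.outer_unique d.fst
      rcases hP.eq_or_of_fst_eq ho with rfl | rfl | rfl
      · have := hP.inner_rot ho'
        have h2 : Inner (P.rot (P.rot o)) := by
          by_contra h
          exact hc (hP.eq_of_not_inner h ho' (by rw [P.rot_fst, P.rot_fst]))
        simp [*]
      · have := hP.inner_rot ho'
        have h2 : Inner d := by
          by_contra h
          exact hP.rot_ne d (hP.eq_of_not_inner ho' h (P.rot_fst d))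
        simp [*]
      · have h3 := hP.inner_rot ho'
        rw [hs] at h3
        have h2 : Inner (P.rot d) := by
          by_contra h
          exact hP.rot_ne (P.rot d) (hP.eq_of_not_inner ho' h (P.rot_fst _))
        simp [*]
    · rw [if_neg hc, if_neg (fun h => hc (hP.cubic_of_shared h)),
        if_neg (fun h => hc (cubic_rot_iff.mp (hP.cubic_of_shared h))),
        if_neg (fun h => hc (cubic_rot_iff.mp (cubic_rot_iff.mp (hP.cubic_of_shared h))))]
  rw [Finset.card_filter, Finset.sum_congr rfl fun d _ => h1 d, Finset.sum_add_distrib,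
    Finset.sum_add_distrib, ← Finset.card_filter, ← Finset.card_filter, ← Finset.card_filter,
    card_rot fun d => Shared (P.rot d), card_rot]
  ring

/-- An edge with both ends of degree three is shared, and then both its darts are, or it is an outer
edge and only its inner dart is the bay. -/
theorem card_cubic_cubic [Fintype V] : #{d : P.graph.Dart | Cubic d ∧ Cubic d.symm} =
    2 * #{d : P.graph.Dart | IsBay d} +
      #{d : P.graph.Dart | Shared d} := by
  have h1 : ∀ d : P.graph.Dart, (if Cubic d ∧ Cubic d.symm then 1 else 0) =
      (if IsBay d then 1 else 0) + (if IsBay d.symm then 1 else 0) +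
      (if Shared d then 1 else 0) := by
    intro d
    unfold IsBay
    rw [SimpleGraph.Dart.symm_symm]
    by_cases hs : Shared d
    · simp [hs, hs.symm, hP.cubic_of_shared hs, hP.cubic_of_shared hs.symm]
    · have hs' : ¬ Shared d.symm := fun h => hs (by simpa using h.symm)
      by_cases hi : Inner d
      · have : ¬ Inner d.symm := fun h => hs ⟨hi, h⟩
        simp [hs, hi, this]
      · have := hP.inner_symm hi
        simp [hs, hs', hi, this, and_comm]
  rw [Finset.card_filter, Finset.sum_congr rfl fun d _ => h1 d, Finset.sum_add_distrib,
    Finset.sum_add_distrib, ← Finset.card_filter, ← Finset.card_filter, ← Finset.card_filter,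
    card_symm IsBay]
  ring

/-- With S = 2(h + q) - 2 shared darts and B bays, summing over the middle darts gives 2W + (6h +
4q) + 4q + 8q = 2E + 7S + 2B, and 2E = 10h + 6q + 2. -/
theorem wienerPolarity_add [Fintype V] : wienerPolarity P.graph + 6 =
    9 * #{F : P.Face | IsHexagonal F} + 2 * #{F : P.Face | IsSquare F} +
      #{d : P.graph.Dart | IsBay d} := by
  have h0 := two_mul_wienerPolarity P.graph
  have h1 := Finset.sum_congr rfl fun m (_ : m ∈ Finset.univ) => hP.card_threePaths_middle m
  rw [Finset.sum_add_distrib, ← hP.card_dist_eq_three, ← h0, Finset.sum_add_distrib,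
    Finset.sum_add_distrib, ← Finset.mul_sum, ← Finset.card_filter, ← Finset.card_filter,
    ← Finset.card_filter, card_symm fun d => IsSquare (P.faceOf d), hP.card_square,
    hP.card_inner] at h1
  have h2 : ∀ m : P.graph.Dart, (1 + if Cubic m then 1 else 0) * (1 + if Cubic m.symm then 1 else 0)
      = 1 + (if Cubic m then 1 else 0) + (if Cubic m.symm then 1 else 0) +
        (if Cubic m ∧ Cubic m.symm then 1 else 0) := by
    intro m
    by_cases h : Cubic m <;> by_cases h' : Cubic m.symm <;> simp [h, h']
  rw [Finset.sum_congr rfl fun m _ => h2 m, Finset.sum_add_distrib, Finset.sum_add_distrib,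
    Finset.sum_add_distrib, ← Finset.card_eq_sum_ones, ← Finset.card_filter, ← Finset.card_filter,
    ← Finset.card_filter, card_symm fun d => Cubic d, hP.card_cubic, hP.card_cubic_cubic,
    Finset.card_univ, card_dart, ← hP.card_inner_add_card, hP.card_inner] at h1
  have h3 := hP.card_shared
  have h4 := hP.card_vertices
  omega

end IsCata
end PlaneGraph

/-- `opp F K K'` says that the neighbours `K` and `K'` of `F` are opposite to each other. Every
neighbour has at most one opposite. -/
structure IsOpposition {N : Type*} (T : SimpleGraph N) (opp : N → N → N → Prop) : Prop where
  adj : ∀ {F K K'}, opp F K K' → T.Adj F K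
  ne : ∀ {F K K'}, opp F K K' → K ≠ K'
  symm : ∀ {F K K'}, opp F K K' → opp F K' K
  unique : ∀ {F K K' K''}, opp F K K' → opp F K K'' → K' = K''

/-- Connected sets of vertices in which any two neighbours of a vertex are opposite. -/
def IsStraight {N : Type*} (T : SimpleGraph N) (opp : N → N → N → Prop) (X : Set N) : Prop :=
  (T.induce X).Connected ∧ ∀ F ∈ X, ∀ K ∈ X, ∀ K' ∈ X, T.Adj F K → T.Adj F K' → K ≠ K' → opp F K K'

/-! ### Straight subtrees of a tree with an opposition relation. -/

namespace SimpleGraph.IsTree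

variable {N : Type*} {T : SimpleGraph N}

theorem support_subset (hT : T.IsTree) {X : Set N} (hX : (T.induce X).Connected) {u v : N}
    (hu : u ∈ X) (hv : v ∈ X)
    {p : T.Walk u v} (hp : p.IsPath) : ∀ w ∈ p.support, w ∈ X := by
  obtain ⟨q, hq⟩ := hX.exists_isPath ⟨u, hu⟩ ⟨v, hv⟩
  have hq' : (q.map (SimpleGraph.Embedding.induce X).toHom).IsPath :=
    hq.map (SimpleGraph.Embedding.induce (G := T) X).injective
  have hsub : ∀ w ∈ (q.map (SimpleGraph.Embedding.induce X).toHom).support, w ∈ X := by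
    intro w hw
    rw [SimpleGraph.Walk.support_map, List.mem_map] at hw
    obtain ⟨w', -, rfl⟩ := hw
    exact w'.2
  have heq : p = q.map (SimpleGraph.Embedding.induce X).toHom :=
    (hT.existsUnique_path u v).unique hp hq'
  intro w hw
  exact hsub w (heq ▸ hw)

/-- An edge within the union of two intersecting subtrees lies in one of them. -/
theorem adj_mem_or (hT : T.IsTree) {X Y : Set N} (hX : (T.induce X).Connected)
    (hY : (T.induce Y).Connected)
    {z G K : N} (hzX : z ∈ X) (hzY : z ∈ Y) (hG : G ∈ X ∪ Y) (hK : K ∈ X ∪ Y) (h : T.Adj G K) :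
    (G ∈ X ∧ K ∈ X) ∨ (G ∈ Y ∧ K ∈ Y) := by
  have key : ∀ {X Y : Set N} {G K : N}, (T.induce X).Connected → (T.induce Y).Connected → z ∈ X →
      z ∈ Y → G ∈ X → K ∈ Y → T.Adj G K → (G ∈ X ∧ K ∈ X) ∨ (G ∈ Y ∧ K ∈ Y) := by
    intro X Y G K hX hY hzX hzY hG hK h
    obtain ⟨p, hp⟩ := hT.connected.exists_isPath z G
    obtain ⟨q, hq⟩ := hT.connected.exists_isPath z K
    by_cases hGq : G ∈ q.support
    · exact Or.inr ⟨hT.support_subset hY hzY hK hq G hGq, hK⟩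
    · exact Or.inl ⟨hG, hT.support_subset hX hzX hG hp K
        (hT.isAcyclic.mem_support_of_ne_mem_support_of_adj_of_isPath hp hq h hGq)⟩
  rcases hG with hG | hG <;> rcases hK with hK | hK
  · exact Or.inl ⟨hG, hK⟩
  · exact key hX hY hzX hzY hG hK h
  · exact (key hY hX hzY hzX hG hK h).symm
  · exact Or.inr ⟨hG, hK⟩

/-- Both subtrees contain the whole tree path from `G` to `z`; its first step is the required
neighbour. -/
theorem exists_adj_mem_inter (hT : T.IsTree) {X Y : Set N} (hX : (T.induce X).Connected)
    (hY : (T.induce Y).Connected) {z G : N} (hzX : z ∈ X) (hzY : z ∈ Y) (hGX : G ∈ X) (hGY : G ∈ Y)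
    (hne : G ≠ z) : ∃ J, J ∈ X ∧ J ∈ Y ∧ T.Adj G J := by
  obtain ⟨p, hp⟩ := hT.connected.exists_isPath G z
  have hnil : ¬ p.Nil := SimpleGraph.Walk.not_nil_of_ne hne
  have hmem : p.snd ∈ p.support := p.getVert_mem_support 1
  exact ⟨p.snd, hT.support_subset hX hGX hzX hp _ hmem, hT.support_subset hY hGY hzY hp _ hmem,
    p.adj_snd hnil⟩

variable {opp : N → N → N → Prop}

/-- At a common vertex `G` the overlap supplies a neighbour `J` in both sets. A neighbour in `X` and
one in `Y`, both different from `J`, are each opposite to `J` and hence equal. Two common vertices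
are needed: subtrees meeting in one vertex may turn there. -/
theorem isStraight_union (hT : T.IsTree) (ho : IsOpposition T opp) {X Y : Set N}
    (hX : IsStraight T opp X) (hY : IsStraight T opp Y) {F F' : N} (hF : F ∈ X ∩ Y)
    (hF' : F' ∈ X ∩ Y) (hne : F ≠ F') : IsStraight T opp (X ∪ Y) := by
  refine ⟨SimpleGraph.induce_union_connected hX.1.preconnected hY.1.preconnected ⟨F, hF⟩, ?_⟩
  have key : ∀ {X Y : Set N}, IsStraight T opp X → IsStraight T opp Y → F ∈ X ∩ Y → F' ∈ X ∩ Y →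
      ∀ G K K', G ∈ X → G ∈ Y → K ∈ X → K' ∈ Y → T.Adj G K → T.Adj G K' → K ≠ K' →
      opp G K K' := by
    intro X Y hX hY hF hF' G K K' hGX hGY hK hK' h h' hKK
    have : ∃ J, J ∈ X ∧ J ∈ Y ∧ T.Adj G J := by
      by_cases hGF : G = F
      · exact hT.exists_adj_mem_inter hX.1 hY.1 hF'.1 hF'.2 hGX hGY (by rw [hGF]; exact hne)
      · exact hT.exists_adj_mem_inter hX.1 hY.1 hF.1 hF.2 hGX hGY hGF
    obtain ⟨J, hJX, hJY, hJ⟩ := this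
    by_cases h1 : K = J
    · subst h1
      exact hY.2 G hGY K hJY K' hK' h h' hKK
    · have o1 := hX.2 G hGX K hK J hJX h hJ h1
      by_cases h2 : K' = J
      · subst h2; exact o1
      · exact absurd (ho.unique (ho.symm o1) (hY.2 G hGY J hJY K' hK' hJ h' (Ne.symm h2))) hKK
  intro G hG K hK K' hK' h h' hKK
  rcases hT.adj_mem_or hX.1 hY.1 hF.1 hF.2 hG hK h with ⟨hG1, hK1⟩ | ⟨hG1, hK1⟩ <;>
    rcases hT.adj_mem_or hX.1 hY.1 hF.1 hF.2 hG hK' h' with ⟨hG2, hK2⟩ | ⟨hG2, hK2⟩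
  · exact hX.2 G hG1 K hK1 K' hK2 h h' hKK
  · exact key hX hY hF hF' G K K' hG1 hG2 hK1 hK2 h h' hKK
  · exact key hY hX hF.symm hF'.symm G K K' hG1 hG2 hK1 hK2 h h' hKK
  · exact hY.2 G hG1 K hK1 K' hK2 h h' hKK

theorem isStraight_pair {F K : N} (h : T.Adj F K) : IsStraight T opp {F, K} := by
  refine ⟨SimpleGraph.induce_pair_connected_of_adj h, ?_⟩
  intro A hA B hB C hC hAB hAC hBC
  simp only [Set.mem_insert_iff, Set.mem_singleton_iff] at hA hB hC
  rcases hA with rfl | rfl <;> rcases hB with rfl | rfl <;> rcases hC with rfl | rfl <;>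
    first | exact absurd rfl hBC | exact absurd hAB (T.irrefl) | exact absurd hAC (T.irrefl)

theorem isStraight_triple (hT : T.IsTree) (ho : IsOpposition T opp) {F K K' : N}
    (h : opp F K K') : IsStraight T opp ({F, K} ∪ {F, K'}) := by
  have h1 := ho.adj h
  have h2 := ho.adj (ho.symm h)
  have hK : ¬ T.Adj K K' := by
    intro hadj
    apply hT.dist_ne_of_adj F hadj
    rw [SimpleGraph.dist_eq_one_iff_adj.mpr h1, SimpleGraph.dist_eq_one_iff_adj.mpr h2]
  refine ⟨SimpleGraph.induce_union_connected
    (SimpleGraph.induce_pair_connected_of_adj h1).preconnected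
    (SimpleGraph.induce_pair_connected_of_adj h2).preconnected ⟨F, by simp, by simp⟩, ?_⟩
  intro A hA B hB C hC hAB hAC hBC
  simp only [Set.mem_union, Set.mem_insert_iff, Set.mem_singleton_iff] at hA hB hC
  have hs := ho.symm h
  have hK' : ¬ T.Adj K' K := fun h => hK h.symm
  have irr : ∀ A, ¬ T.Adj A A := fun A => T.irrefl
  rcases hA with (rfl | rfl) | (rfl | rfl) <;> rcases hB with (rfl | rfl) | (rfl | rfl) <;>
    rcases hC with (rfl | rfl) | (rfl | rfl) <;> simp_all

/-- The triple formed by `F` and its two opposite neighbours is straight and overlaps `X` in two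
vertices, so its union with `X` is straight and maximality absorbs it. -/
theorem opposite_mem (hT : T.IsTree) (ho : IsOpposition T opp) {X : Set N}
    (hX : Maximal (IsStraight T opp) X) {F K K' : N} (hF : F ∈ X) (hK : K ∈ X) (h : opp F K K') :
    K' ∈ X := by
  have := hT.isStraight_union ho hX.1 (hT.isStraight_triple ho h) (F := F) (F' := K)
    ⟨hF, by simp⟩ ⟨hK, by simp⟩ (ho.adj h).ne
  exact hX.2 this Set.subset_union_left (Or.inr (by simp))

theorem exists_adj_mem (hT : T.IsTree) [Nontrivial N] {X : Set N}
    (hX : Maximal (IsStraight T opp) X) {F : N} (hF : F ∈ X) : ∃ K ∈ X, T.Adj F K := by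
  by_cases h : ∃ K ∈ X, K ≠ F
  · obtain ⟨K, hK, hne⟩ := h
    obtain ⟨J, hJ, -, hadj⟩ := hT.exists_adj_mem_inter hX.1.1 hX.1.1 hK hK hF hF hne.symm
    exact ⟨J, hJ, hadj⟩
  · push Not at h
    obtain ⟨K, hK⟩ := hT.connected.preconnected.exists_adj_of_nontrivial F
    have hle : X ⊆ {F, K} := fun A hA => Or.inl (h A hA)
    exact ⟨K, hX.2 (isStraight_pair hK) hle (Or.inr rfl), hK⟩

theorem exists_maximal_isStraight [Finite N] {F K : N} (h : T.Adj F K) :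
    ∃ X, Maximal (IsStraight T opp) X ∧ F ∈ X ∧ K ∈ X := by
  obtain ⟨X, hle, hX⟩ := Finite.exists_le_maximal (isStraight_pair (opp := opp) h)
  exact ⟨X, hX, hle (Or.inl rfl), hle (Or.inr rfl)⟩

theorem maximal_isStraight_unique (hT : T.IsTree) (ho : IsOpposition T opp) {X Y : Set N}
    (hX : Maximal (IsStraight T opp) X) (hY : Maximal (IsStraight T opp) Y) {F F' : N}
    (hF : F ∈ X ∩ Y) (hF' : F' ∈ X ∩ Y) (hne : F ≠ F') : X = Y := by
  have := hT.isStraight_union ho hX.1 hY.1 hF hF' hne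
  exact (hX.eq_of_subset this Set.subset_union_left).trans
    (hY.eq_of_subset this Set.subset_union_right).symm

theorem card_adj_within [Fintype N] (hT : T.IsTree) {X : Set N} (hX : (T.induce X).Connected) :
    #{p : N × N | p.1 ∈ X ∧ p.2 ∈ X ∧ T.Adj p.1 p.2} + 2 = 2 * Fintype.card X := by
  have h1 : (T.induce X).IsTree := ⟨hX, hT.isAcyclic.induce X⟩
  have h2 := h1.card_edgeFinset
  have h3 := (T.induce X).two_mul_card_edgeFinset
  have h4 : #{p : N × N | p.1 ∈ X ∧ p.2 ∈ X ∧ T.Adj p.1 p.2} =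
      #(Finset.univ.filter fun ((x, y) : X × X) => (T.induce X).Adj x y) := by
    symm
    refine Finset.card_bij (fun p _ => (p.1.1, p.2.1)) ?_ ?_ ?_
    · rintro ⟨⟨x, hx⟩, ⟨y, hy⟩⟩ h
      simp only [Finset.mem_filter, Finset.mem_univ, true_and] at h ⊢
      exact ⟨hx, hy, h⟩
    · rintro ⟨⟨x, hx⟩, ⟨y, hy⟩⟩ - ⟨⟨x', hx'⟩, ⟨y', hy'⟩⟩ - h
      simpa using h
    · rintro ⟨x, y⟩ h
      simp only [Finset.mem_filter, Finset.mem_univ, true_and] at h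
      exact ⟨(⟨x, h.1⟩, ⟨y, h.2.1⟩), by simpa using h.2.2, rfl⟩
  rw [h4, ← h3, ← h2]
  ring

/-- A maximal straight set has exactly two ends. -/
theorem card_ends_within [Fintype N] [Nontrivial N] (hT : T.IsTree) (ho : IsOpposition T opp)
    {X : Set N} (hX : Maximal (IsStraight T opp) X) :
    #{p : N × N | (T.Adj p.1 p.2 ∧ ¬ ∃ K', opp p.1 p.2 K') ∧ p.1 ∈ X ∧ p.2 ∈ X} = 2 := by
  have h1 := hT.card_adj_within hX.1.1
  -- A vertex of `X` has two neighbours in `X`, which are opposite and not ends, or just one, which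
  -- is an end because maximality would have absorbed its opposite. Hence the ends number 2|X| -
  -- 2(|X| - 1) = 2.
  have key : ∀ v, (if v ∈ X then 2 else 0) = #{K | v ∈ X ∧ K ∈ X ∧ T.Adj v K} +
      #{K | (T.Adj v K ∧ ¬ ∃ K', opp v K K') ∧ v ∈ X ∧ K ∈ X} := by
    intro v
    by_cases hv : v ∈ X
    swap
    · simp [hv]
    rw [if_pos hv]
    obtain ⟨K, hK, hadj⟩ := hT.exists_adj_mem hX hv
    by_cases h2 : ∃ K' ∈ X, T.Adj v K' ∧ K ≠ K'
    · obtain ⟨K', hK', hadj', hne⟩ := h2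
      have ho1 := hX.1.2 v hv K hK K' hK' hadj hadj' hne
      have hall : ∀ K'' ∈ X, T.Adj v K'' → K'' = K ∨ K'' = K' := by
        intro K'' h'' ha''
        by_contra hcon
        push Not at hcon
        have := hX.1.2 v hv K hK K'' h'' hadj ha'' hcon.1.symm
        exact hcon.2 (ho.unique this ho1)
      have e1 : (Finset.univ.filter fun K => v ∈ X ∧ K ∈ X ∧ T.Adj v K) = {K, K'} := by
        ext K''
        simp only [Finset.mem_filter, Finset.mem_univ, true_and, Finset.mem_insert,
          Finset.mem_singleton]
        constructor
        · rintro ⟨-, h1, h2⟩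
          exact hall _ h1 h2
        · rintro (rfl | rfl)
          · exact ⟨hv, hK, hadj⟩
          · exact ⟨hv, hK', hadj'⟩
      have e2 : (Finset.univ.filter fun K =>
          (T.Adj v K ∧ ¬ ∃ K', opp v K K') ∧ v ∈ X ∧ K ∈ X) = ∅ := by
        rw [Finset.filter_eq_empty_iff]
        rintro K'' - ⟨⟨ha, hn⟩, -, hm⟩
        rcases hall _ hm ha with rfl | rfl
        · exact hn ⟨_, ho1⟩
        · exact hn ⟨_, ho.symm ho1⟩
      rw [e1, e2, Finset.card_pair hne, Finset.card_empty]
    · push Not at h2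
      have e1 : (Finset.univ.filter fun K => v ∈ X ∧ K ∈ X ∧ T.Adj v K) = {K} := by
        ext K''
        simp only [Finset.mem_filter, Finset.mem_univ, true_and, Finset.mem_singleton]
        exact ⟨fun h => (h2 _ h.2.1 h.2.2).symm, by rintro rfl; exact ⟨hv, hK, hadj⟩⟩
      have e2 : (Finset.univ.filter fun K =>
          (T.Adj v K ∧ ¬ ∃ K', opp v K K') ∧ v ∈ X ∧ K ∈ X) = {K} := by
        ext K''
        simp only [Finset.mem_filter, Finset.mem_univ, true_and, Finset.mem_singleton]
        constructor
        · exact fun h => (h2 _ h.2.2 h.1.1).symm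
        · rintro rfl
          refine ⟨⟨hadj, ?_⟩, hv, hK⟩
          rintro ⟨K', hK'⟩
          exact ho.ne hK' (h2 K' (hT.opposite_mem ho hX hv hK hK') (ho.adj (ho.symm hK')))
      rw [e1, e2, Finset.card_singleton]
  have h2 : ∑ v, (if v ∈ X then 2 else 0) = 2 * Fintype.card X := by
    rw [← Finset.sum_filter, Finset.sum_const, smul_eq_mul, mul_comm, Fintype.card_subtype]
  have h3 : ∑ v, #{K | v ∈ X ∧ K ∈ X ∧ T.Adj v K} =
      #{p : N × N | p.1 ∈ X ∧ p.2 ∈ X ∧ T.Adj p.1 p.2} := by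
    simp only [Finset.card_filter]
    rw [Fintype.sum_prod_type]
  have h4 : ∑ v, #{K | (T.Adj v K ∧ ¬ ∃ K', opp v K K') ∧ v ∈ X ∧ K ∈ X} =
      #{p : N × N | (T.Adj p.1 p.2 ∧ ¬ ∃ K', opp p.1 p.2 K') ∧ p.1 ∈ X ∧ p.2 ∈ X} := by
    simp only [Finset.card_filter]
    rw [Fintype.sum_prod_type]
  rw [Finset.sum_congr rfl fun v _ => key v, Finset.sum_add_distrib] at h2
  omega

/-- Every maximal straight set has two ends. -/
theorem two_mul_card_maximal_isStraight [Fintype N] [Nontrivial N] (hT : T.IsTree)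
    (ho : IsOpposition T opp) : 2 * {X | Maximal (IsStraight T opp) X}.ncard =
      #{p : N × N | T.Adj p.1 p.2 ∧ ¬ ∃ K', opp p.1 p.2 K'} := by
  -- Every edge lies in a unique maximal straight set, so the ends are fibred over these sets.
  -- Nonadjacent pairs receive an irrelevant default.
  have hex : ∀ p : N × N, ∃ X, T.Adj p.1 p.2 → Maximal (IsStraight T opp) X ∧ p.1 ∈ X ∧ p.2 ∈ X := by
    intro p
    by_cases h : T.Adj p.1 p.2
    · obtain ⟨X, hX⟩ := exists_maximal_isStraight (opp := opp) h
      exact ⟨X, fun _ => hX⟩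
    · exact ⟨∅, fun h' => absurd h' h⟩
  choose f hf using hex
  rw [Set.ncard_eq_toFinset_card',
    Finset.card_eq_sum_card_fiberwise (f := f) (t := {X | Maximal (IsStraight T opp) X}.toFinset) (by
      intro p hp
      simp only [Finset.coe_filter, Finset.mem_univ, true_and, Set.mem_ofPred_eq] at hp
      simpa using (hf p hp.1).1), Finset.sum_congr rfl (g := fun _ => 2), Finset.sum_const,
    smul_eq_mul, mul_comm]
  intro X hX
  rw [Set.mem_toFinset, Set.mem_ofPred_eq] at hX
  rw [← hT.card_ends_within ho hX, Finset.filter_filter]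
  congr 1
  ext p
  simp only [Finset.mem_filter, Finset.mem_univ, true_and, and_congr_right_iff]
  intro hp
  obtain ⟨h1, h2, h3⟩ := hf p hp.1
  constructor
  · rintro rfl; exact ⟨h2, h3⟩
  · rintro ⟨h4, h5⟩
    exact hT.maximal_isStraight_unique ho h1 hX ⟨h2, h4⟩ ⟨h3, h5⟩ hp.1.ne

end SimpleGraph.IsTree

/-- The pattern of an angular hexagon: exactly two marked sides, and three consecutive unmarked
sides. -/
def AngularPattern (s : ZMod 6 → Prop) : Prop :=
  #{i | s i} = 2 ∧ ∃ i, ¬ s i ∧ ¬ s (i + 1) ∧ ¬ s (i + 2)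

/-! ### Patterns of shared sides around a hexagon. -/

namespace AngularPattern

/-- With no two consecutive sides marked, the marked sets are, up to symmetry, empty, one side, two
sides at distance two (angular), two opposite sides, or three alternating sides (branched). -/
theorem straight_bool : ∀ t : ZMod 6 → Bool, (∀ i, ¬ (t i ∧ t (i + 1))) →
    ((¬ (#{i | t i} = 3) ∧ ¬ (#{i | t i} = 2 ∧ ∃ i, ¬ t i ∧ ¬ t (i + 1) ∧ ¬ t (i + 2))) ↔
      ∀ i j, t i → t j → i ≠ j → j = i + 3) := by
  set_option maxRecDepth 100000 in decide

/-- The doubled number of bays plus two is 2 = 1 + 1 for one marked side, 2 = 0 + 2 for an opposite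
pair, 4 = 2 + 2 for an angular pair, and 8 = 3 + 3 + 2 for three alternating sides. -/
theorem bays_bool : ∀ t : ZMod 6 → Bool, (∀ i, ¬ (t i ∧ t (i + 1))) → (∃ i, t i) →
    2 * #{i | t (i - 1) ∧ t (i + 1)} + 2 =
      #{i | t i ∧ ¬ t (i + 3)} + #{i | t i} + 2 * if #{i | t i} = 3 then 1 else 0 := by
  set_option maxRecDepth 100000 in decide

variable (s : ZMod 6 → Prop) (hs : ∀ i, ¬ (s i ∧ s (i + 1)))
include hs

theorem straight : (¬ (#{i | s i} = 3) ∧ ¬ AngularPattern s) ↔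
    ∀ i j, s i → s j → i ≠ j → j = i + 3 := by
  have h := straight_bool (fun i => decide (s i)) (by simpa using hs)
  simp only [decide_eq_true_eq] at h
  unfold AngularPattern
  convert h

theorem bays (hex : ∃ i, s i) : 2 * #{i | s (i - 1) ∧ s (i + 1)} + 2 =
    #{i | s i ∧ ¬ s (i + 3)} + #{i | s i} + 2 * if #{i | s i} = 3 then 1 else 0 := by
  have h := bays_bool (fun i => decide (s i)) (by simpa using hs) (by simpa using hex)
  simp only [decide_eq_true_eq] at h
  convert h

end AngularPattern

/-! ### Subsystems of faces, their local patterns and opposite sides. -/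

namespace PlaneGraph

variable {V : Type u} {P : PlaneGraph V}

/-- The dart lies on the boundary walk of a face in `X`. -/
def Within (X : Set P.InnerFace) (d : P.graph.Dart) : Prop := ∃ F ∈ X, P.faceOf d = F.1

theorem Within.inner {X : Set P.InnerFace} {d : P.graph.Dart} (h : Within X d) : Inner d := by
  obtain ⟨F, -, hF⟩ := h
  rw [Inner, hF]
  exact F.2

theorem within_univ {d : P.graph.Dart} : Within Set.univ d ↔ Inner d :=
  ⟨Within.inner, fun h => ⟨⟨_, h⟩, trivial, rfl⟩⟩

theorem within_rot {X : Set P.InnerFace} {d : P.graph.Dart} :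
    Within X (P.rot d) ↔ Within X d.symm := by
  unfold Within; rw [faceOf_rot]

theorem within_iff {X : Set P.InnerFace} {F : P.InnerFace} {d : P.graph.Dart}
    (h : P.faceOf d = F.1) : Within X d ↔ F ∈ X := by
  constructor
  · rintro ⟨F', hF', h'⟩
    rwa [Subtype.ext (h.symm.trans h')]
  · exact fun hF => ⟨F, hF, h⟩

theorem union_adj {X : Set P.InnerFace} {d : P.graph.Dart} :
    (P.union X).Adj d.fst d.snd ↔ Within X d ∨ Within X d.symm := by
  unfold union
  simp only [SimpleGraph.Subgraph.iSup_adj]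
  constructor
  · rintro ⟨F, hF, d', hd', he⟩
    rcases SimpleGraph.dart_edge_eq_iff d' d |>.mp he with rfl | rfl
    · exact Or.inl ⟨F, hF, hd'⟩
    · exact Or.inr ⟨F, hF, hd'⟩
  · rintro (⟨F, hF, h⟩ | ⟨F, hF, h⟩)
    · exact ⟨F, hF, d, h, rfl⟩
    · exact ⟨F, hF, d.symm, h, d.edge_symm⟩

theorem mem_neighborSet_union {X : Set P.InnerFace} {v w : V} :
    w ∈ (P.union X).neighborSet v ↔
      ∃ d : P.graph.Dart, d.fst = v ∧ d.snd = w ∧ (Within X d ∨ Within X d.symm) := by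
  rw [SimpleGraph.Subgraph.mem_neighborSet]
  constructor
  · intro h
    exact ⟨⟨(v, w), h.adj_sub⟩, rfl, rfl, union_adj.mp h⟩
  · rintro ⟨d, rfl, rfl, h⟩
    exact union_adj.mpr h

/-- The darts point in opposite directions across a face. -/
def IsOpposite (d d' : P.graph.Dart) : Prop :=
  (IsHexagonal (P.faceOf d) ∧ d' = P.next (P.next (P.next d))) ∨
    (IsSquare (P.faceOf d) ∧ d' = P.next (P.next d))

/-- The faces `K` and `K'` are adjacent to `F` along opposite sides. -/
def Opposition (F K K' : P.InnerFace) : Prop :=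
  ∃ d d' : P.graph.Dart, IsOpposite d d' ∧ P.faceOf d = F.1 ∧ P.faceOf d.symm = K.1 ∧
    P.faceOf d'.symm = K'.1

theorem IsOpposite.faceOf {d d' : P.graph.Dart} (h : IsOpposite d d') :
    P.faceOf d' = P.faceOf d := by
  rcases h with ⟨-, rfl⟩ | ⟨-, rfl⟩ <;> simp only [faceOf_next]

theorem IsOpposite.unique_of_ne {d d' d'' : P.graph.Dart} (h : ¬ IsSquare (P.faceOf d) ∨
    ¬ IsHexagonal (P.faceOf d)) (h1 : IsOpposite d d') (h2 : IsOpposite d d'') : d' = d'' := by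
  rcases h1 with ⟨h1, rfl⟩ | ⟨h1, rfl⟩ <;> rcases h2 with ⟨h2, rfl⟩ | ⟨h2, rfl⟩ <;> tauto

namespace IsCata

variable (hP : IsCata P)
include hP

omit hP in
theorem mem_hexagons {F : P.InnerFace} : F ∈ P.hexagons ↔ IsHexagonal F.1 :=
  ⟨fun h => ⟨F.2, h⟩, fun h => h.2⟩

theorem not_mem_hexagons {F : P.InnerFace} : F ∉ P.hexagons ↔ IsSquare F.1 := by
  rw [mem_hexagons]
  exact ⟨(hP.inner_cycle _ F.2).resolve_left, fun h h' => hP.not_isSquare h' h⟩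

theorem neighborSet_union {X : Set P.InnerFace} {d : P.graph.Dart} (hd : Within X d)
    (h1 : ¬ Within X d.symm) (h2 : ¬ Within X (P.next.symm d).symm) :
    (P.union X).neighborSet d.fst = {d.snd, (P.next.symm d).fst} := by
  have he : P.rot (P.next.symm d).symm = d := rot_symm_next_symm d
  ext w
  rw [mem_neighborSet_union]
  constructor
  · rintro ⟨d', hf, rfl, hw⟩
    rcases hP.eq_or_of_fst_eq (d := d) hf with rfl | rfl | rfl
    · exact Or.inl rfl
    · rw [← within_rot, within_rot, or_iff_right h1] at hw
      by_cases hc : Cubic d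
      · rw [hP.symm_next_symm hc] at h2
        exact absurd hw h2
      · rw [Cubic, not_not] at hc
        rw [P.rot.injective (hc.trans he.symm)]
        exact Or.inr rfl
    · by_cases hc : Cubic d
      · rw [← hP.symm_next_symm hc]
        exact Or.inr rfl
      · rw [Cubic, not_not] at hc
        rw [hc]
        exact Or.inl rfl
  · rintro (rfl | rfl)
    · exact ⟨d, rfl, rfl, Or.inl hd⟩
    · exact ⟨(P.next.symm d).symm, next_symm_snd d, rfl, Or.inr (by
        rw [← within_rot, he]; exact hd)⟩

/-- A face of `X` contributes its two sides at the vertex. A third edge of the union appears only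
when another face of `X` lies across one of these sides. -/
theorem ncard_neighborSet_union {X : Set P.InnerFace} {d : P.graph.Dart} (hd : Within X d) :
    ((P.union X).neighborSet d.fst).ncard = 2 ↔
      ¬ Within X d.symm ∧ ¬ Within X (P.next.symm d).symm := by
  have := P.finite
  have he : P.rot (P.next.symm d).symm = d := rot_symm_next_symm d
  constructor
  · intro h2
    by_contra hw
    have hw : Within X (P.rot d) ∨ Within X (P.next.symm d).symm := by
      rw [within_rot]; tauto
    have hc : Cubic d := by
      rw [hP.cubic_iff hd.inner]
      exact hw.imp (fun h => shared_iff.mpr ⟨hd.inner, h.inner⟩)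
        fun h => ⟨inner_next_symm_iff.mpr hd.inner, h.inner⟩
    rw [hP.symm_next_symm hc] at hw
    have hle : ({d.snd, (P.rot d).snd, (P.rot (P.rot d)).snd} : Set V) ⊆
        (P.union X).neighborSet d.fst := by
      rintro w (rfl | rfl | rfl)
      · exact mem_neighborSet_union.mpr ⟨d, rfl, rfl, Or.inl hd⟩
      · refine mem_neighborSet_union.mpr ⟨P.rot d, P.rot_fst d, rfl, ?_⟩
        rwa [← within_rot (d := P.rot d)]
      · refine mem_neighborSet_union.mpr ⟨P.rot (P.rot d), ?_, rfl, Or.inr ?_⟩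
        · rw [P.rot_fst, P.rot_fst]
        · rwa [← within_rot, hP.rot_rot_rot hc]
    have h3 := Set.ncard_le_ncard hle (Set.toFinite _)
    have hn : ∀ e : P.graph.Dart, e.snd ≠ (P.rot e).snd := fun e h =>
      hP.rot_ne e (dart_eq_of_fst_snd (P.rot_fst e) h.symm)
    have hn' : d.snd ≠ (P.rot (P.rot d)).snd := fun h =>
      hc (dart_eq_of_fst_snd (by rw [P.rot_fst, P.rot_fst]) h.symm)
    rw [Set.ncard_eq_three.mpr ⟨_, _, _, hn d, hn', hn _, rfl⟩] at h3
    omega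
  · rintro ⟨h1, h2⟩
    rw [hP.neighborSet_union hd h1 h2, Set.ncard_pair]
    intro h
    have : d = (P.next.symm d).symm :=
      dart_eq_of_fst_snd (next_symm_snd d).symm h
    exact hP.rot_ne d (by conv_lhs => rw [this]; exact he)

theorem ncard_innerDual {F : P.InnerFace} {k : ℕ} [NeZero k] {c : ZMod k → P.graph.Dart}
    (hc : IsFaceCycle F.1 c) (X : Set P.InnerFace) :
    {F' ∈ X | P.innerDual.Adj F F'}.ncard = #{i | Within X (c i).symm} := by
  rw [← Set.ncard_coe_finset]
  symm
  refine Set.ncard_congr (fun i hi => ⟨P.faceOf (c i).symm, ?_⟩) ?_ ?_ ?_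
  · simp only [Finset.coe_filter, Finset.mem_univ, true_and, Set.mem_ofPred_eq] at hi
    exact hi.inner
  · intro i hi
    simp only [Finset.coe_filter, Finset.mem_univ, true_and, Set.mem_ofPred_eq] at hi
    exact ⟨(within_iff rfl).mp hi, hP.innerDual_adj_iff.mpr ⟨c i, hc.faceOf i, rfl⟩⟩
  · intro i j hi hj h
    simp only [Finset.coe_filter, Finset.mem_univ, true_and, Set.mem_ofPred_eq] at hi
    refine hc.injective (hP.eq_of_shared (d := c j) (d' := c i) ⟨?_, ?_⟩ ?_ (Subtype.ext_iff.mp h))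
    · rw [Inner, hc.faceOf]; exact F.2
    · rw [Inner, show P.faceOf (c j).symm = P.faceOf (c i).symm from (Subtype.ext_iff.mp h).symm]
      exact hi.inner
    · rw [hc.faceOf, hc.faceOf]
  · rintro F' ⟨hF', hadj⟩
    obtain ⟨d, hd, hd'⟩ := hP.innerDual_adj_iff.mp hadj
    obtain ⟨i, rfl⟩ := (hc.faceOf_eq_iff d).mp hd
    refine ⟨i, ?_, Subtype.ext hd'⟩
    simpa using ⟨F', hF', hd'⟩

theorem within_symm_next {F : P.InnerFace} {k : ℕ} {c : ZMod k → P.graph.Dart}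
    (hc : IsFaceCycle F.1 c) (X : Set P.InnerFace) (i : ZMod k) :
    ¬ (Within X (c i).symm ∧ Within X (c (i + 1)).symm) := by
  rintro ⟨h1, h2⟩
  have hin : ∀ i, Inner (c i) := fun i => by rw [Inner, hc.faceOf]; exact F.2
  refine hP.not_shared_next ⟨hin i, h1.inner⟩ ?_
  rw [hc.next_eq]
  exact ⟨hin _, h2.inner⟩

theorem isBranchedIn_iff {F : P.InnerFace} {c : ZMod 6 → P.graph.Dart}
    (hF : IsHexagonal F.1) (hc : IsFaceCycle F.1 c) (X : Set P.InnerFace) :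
    P.IsBranchedIn X F ↔ #{i | Within X (c i).symm} = 3 := by
  rw [IsBranchedIn, hP.ncard_innerDual hc, mem_hexagons, and_iff_right hF]

/-- A corner has degree two in the union when both sides at it are unmarked, so two adjacent such
corners amount to three consecutive unmarked sides. Neighbour sets are compared to ensure that
adjacent corners are consecutive on the hexagon. -/
theorem isAngularIn_iff {F : P.InnerFace} {c : ZMod 6 → P.graph.Dart}
    (hF : IsHexagonal F.1) (hc : IsFaceCycle F.1 c) {X : Set P.InnerFace} (hX : F ∈ X) :
    P.IsAngularIn X F ↔ AngularPattern fun i => Within X (c i).symm := by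
  have hin : ∀ i, Within X (c i) := fun i => ⟨F, hX, hc.faceOf i⟩
  have hdeg : ∀ i, ((P.union X).neighborSet (c i).fst).ncard = 2 ↔
      ¬ Within X (c i).symm ∧ ¬ Within X (c (i - 1)).symm := fun i => by
    rw [hP.ncard_neighborSet_union (hin i), hc.next_symm_eq]
  rw [IsAngularIn, hP.ncard_innerDual hc, mem_hexagons, and_iff_right hF, AngularPattern]
  refine and_congr_right fun _ => ?_
  constructor
  · rintro ⟨x, hx, y, hy, hx2, hy2, hadj⟩
    obtain ⟨d, hd, rfl⟩ := mem_boundary_iff.mp hx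
    obtain ⟨i, rfl⟩ := (hc.faceOf_eq_iff d).mp hd
    obtain ⟨d, hd, rfl⟩ := mem_boundary_iff.mp hy
    obtain ⟨j, rfl⟩ := (hc.faceOf_eq_iff d).mp hd
    rw [hdeg] at hx2 hy2
    have hmem : (c j).fst ∈ (P.union X).neighborSet (c i).fst := hadj
    rw [hP.neighborSet_union (hin i) hx2.1 (by rw [hc.next_symm_eq]; exact hx2.2),
      hc.next_symm_eq, hc.snd_eq] at hmem
    rcases hmem with h | h <;> obtain rfl := hc.fst_injective h
    · refine ⟨i - 1, hx2.2, ?_, ?_⟩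
      · rw [sub_add_cancel]; exact hx2.1
      · rw [show i - 1 + 2 = i + 1 by ring]; exact hy2.1
    · refine ⟨i - 2, ?_, ?_, ?_⟩
      · rw [show i - 2 = i - 1 - 1 by ring]; exact hy2.2
      · rw [show i - 2 + 1 = i - 1 by ring]; exact hx2.2
      · rw [sub_add_cancel]; exact hx2.1
  · rintro ⟨i, h0, h1, h2⟩
    refine ⟨(c (i + 1)).fst, mem_boundary_iff.mpr ⟨_, hc.faceOf _, rfl⟩, (c (i + 2)).fst,
      mem_boundary_iff.mpr ⟨_, hc.faceOf _, rfl⟩, ?_, ?_, ?_⟩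
    · rw [hdeg, add_sub_cancel_right]; exact ⟨h1, h0⟩
    · rw [hdeg, show i + 2 - 1 = i + 1 by ring]; exact ⟨h2, h1⟩
    · rw [show i + 2 = i + 1 + 1 by ring, ← hc.snd_eq (i + 1)]
      exact union_adj.mpr (Or.inl (hin _))

/-- Consecutive sides are never both shared, so every face has a side on no other inner face. The
subgraph thus determines its set of faces, and maximality may be tested on either. -/
theorem union_le_iff {X Y : Set P.InnerFace} : P.union X ≤ P.union Y ↔ X ⊆ Y := by
  constructor
  · intro h F hF
    obtain ⟨d, hd⟩ := exists_faceOf F.1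
    have hin : Inner d := by rw [Inner, hd]; exact F.2
    obtain ⟨d', hd', hs⟩ : ∃ d', P.faceOf d' = F.1 ∧ ¬ Shared d' := by
      by_cases hs : Shared d
      · exact ⟨P.next d, by rw [faceOf_next, hd], hP.not_shared_next hs⟩
      · exact ⟨d, hd, hs⟩
    have hin' : Inner d' := by rw [Inner, hd']; exact F.2
    have h1 := h.2 (union_adj.mpr (Or.inl ⟨F, hF, hd'⟩))
    rcases union_adj.mp h1 with h1 | h1
    · exact (within_iff hd').mp h1
    · exact absurd ⟨hin', h1.inner⟩ hs
  · intro h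
    exact biSup_mono h

theorem isOpposite_hexagon {F : P.Face} {c : ZMod 6 → P.graph.Dart} (hF : IsHexagonal F)
    (hc : IsFaceCycle F c) {i : ZMod 6} {d : P.graph.Dart} :
    IsOpposite (c i) d ↔ d = c (i + 3) := by
  rw [IsOpposite, hc.faceOf, and_iff_right hF, or_iff_left fun h => hP.not_isSquare hF h.1,
    hc.next_eq, hc.next_eq, hc.next_eq, show i + 1 + 1 + 1 = i + 3 by ring]

theorem isOpposite_square {F : P.Face} {c : ZMod 4 → P.graph.Dart} (hF : IsSquare F)
    (hc : IsFaceCycle F c) {i : ZMod 4} {d : P.graph.Dart} :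
    IsOpposite (c i) d ↔ d = c (i + 2) := by
  rw [IsOpposite, hc.faceOf, and_iff_right hF, or_iff_right fun h => hP.not_isSquare h.1 hF,
    hc.next_eq, hc.next_eq, show i + 1 + 1 = i + 2 by ring]

theorem isOpposite_symm {d d' : P.graph.Dart} (h : IsOpposite d d') : IsOpposite d' d := by
  have h' := h
  rcases h with ⟨hF, -⟩ | ⟨hF, -⟩
  · obtain ⟨c, hc, rfl⟩ := hP.exists_hexagon_cycle hF
    rw [hP.isOpposite_hexagon hF hc] at h'
    rw [h', hP.isOpposite_hexagon hF hc]
    rfl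
  · obtain ⟨c, hc, rfl⟩ := hP.exists_square_cycle hF
    rw [hP.isOpposite_square hF hc] at h'
    rw [h', hP.isOpposite_square hF hc]
    rfl

theorem isOpposite_ne {d d' : P.graph.Dart} (h : IsOpposite d d') : d ≠ d' := by
  have h' := h
  rcases h with ⟨hF, -⟩ | ⟨hF, -⟩
  · obtain ⟨c, hc, rfl⟩ := hP.exists_hexagon_cycle hF
    rw [(hP.isOpposite_hexagon hF hc).mp h']
    exact hc.injective.ne (by decide)
  · obtain ⟨c, hc, rfl⟩ := hP.exists_square_cycle hF
    rw [(hP.isOpposite_square hF hc).mp h']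
    exact hc.injective.ne (by decide)

theorem isOpposite_unique {d d' d'' : P.graph.Dart} (h1 : IsOpposite d d')
    (h2 : IsOpposite d d'') : d' = d'' := by
  refine h1.unique_of_ne ?_ h2
  by_contra! h
  exact hP.not_isSquare h.2 h.1

theorem isOpposition : IsOpposition P.innerDual Opposition where
  adj := by
    rintro F K K' ⟨d, d', -, h1, h2, -⟩
    exact hP.innerDual_adj_iff.mpr ⟨d, h1, h2⟩
  ne := by
    rintro F K K' ⟨d, d', ho, h1, h2, h3⟩ rfl
    refine hP.isOpposite_ne ho (hP.eq_of_shared (d := d') ⟨?_, ?_⟩ ho.faceOf.symm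
      (h2.trans h3.symm))
    · rw [Inner, ho.faceOf, h1]; exact F.2
    · rw [Inner, h3]; exact K.2
  symm := by
    rintro F K K' ⟨d, d', ho, h1, h2, h3⟩
    exact ⟨d', d, hP.isOpposite_symm ho, ho.faceOf.trans h1, h3, h2⟩
  unique := by
    rintro F K K' K'' ⟨d, d', ho, h1, h2, h3⟩ ⟨e, e', ho', h1', h2', h3'⟩
    obtain rfl : e = d := by
      refine hP.eq_of_shared (d := d) ⟨?_, ?_⟩ (h1'.trans h1.symm) (h2'.trans h2.symm)
      · rw [Inner, h1]; exact F.2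
      · rw [Inner, h2]; exact K.2
    rw [hP.isOpposite_unique ho ho', h3'] at h3
    exact Subtype.ext h3.symm

end IsCata
end PlaneGraph

/-! ### Segments as maximal straight sets of faces. -/

namespace PlaneGraph

variable {V : Type u} {P : PlaneGraph V}

/-- The set of inner faces of a linear chain. -/
def IsLinear (X : Set P.InnerFace) : Prop :=
  P.IsSubsystem X ∧ ∀ F ∈ X, ¬ P.IsBranchedIn X F ∧ ¬ P.IsAngularIn X F

/-- The dart leaves a face through a shared edge, but there is no shared edge opposite to it. -/
def IsEnd (d : P.graph.Dart) : Prop := Shared d ∧ ¬ ∃ d', IsOpposite d d' ∧ Shared d'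

namespace IsCata

variable (hP : IsCata P)
include hP

theorem exists_dart_of_adj {F : P.InnerFace} {k : ℕ} {c : ZMod k → P.graph.Dart}
    (hc : IsFaceCycle F.1 c) {K : P.InnerFace} (h : P.innerDual.Adj F K) :
    ∃ i, P.faceOf (c i).symm = K.1 := by
  obtain ⟨d, hd, hd'⟩ := hP.innerDual_adj_iff.mp h
  obtain ⟨i, rfl⟩ := (hc.faceOf_eq_iff d).mp hd
  exact ⟨i, hd'⟩

omit hP in
theorem shared_of_faceOf {F K : P.InnerFace} {d : P.graph.Dart} (hF : P.faceOf d = F.1)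
    (hK : P.faceOf d.symm = K.1) : Shared d :=
  ⟨by rw [Inner, hF]; exact F.2, by rw [Inner, hK]; exact K.2⟩

/-- Of the other three sides of a square, the two next to a shared side are not shared, so a second
neighbour must lie across the opposite one. -/
theorem opposition_of_isSquare {F K K' : P.InnerFace} (hF : IsSquare F.1)
    (h : P.innerDual.Adj F K) (h' : P.innerDual.Adj F K') (hne : K ≠ K') : Opposition F K K' := by
  obtain ⟨d, hd, hdK⟩ := hP.innerDual_adj_iff.mp h
  obtain ⟨c, hc, rfl⟩ := hP.exists_square_cycle (d := d) (hd.symm ▸ hF)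
  rw [hd] at hc
  obtain ⟨i, hi⟩ := hP.exists_dart_of_adj hc h'
  have h0 := shared_of_faceOf hd hdK
  have hs := shared_of_faceOf (hc.faceOf i) hi
  refine ⟨c 0, c i, (hP.isOpposite_square hF hc).mpr ?_, hd, hdK, hi⟩
  have h1 := hP.not_shared_next h0
  have h3 := hP.not_shared_next_symm h0
  rw [hc.next_eq] at h1
  rw [hc.next_symm_eq] at h3
  revert i
  intro i
  fin_cases i
  · intro hi _
    exact absurd (Subtype.ext (hdK.symm.trans hi)) hne
  · intro _ hs
    exact absurd hs h1
  · intros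
    rfl
  · intro _ hs
    exact absurd hs h3

theorem not_branched_angular_iff {F : P.InnerFace} (hF : IsHexagonal F.1) {X : Set P.InnerFace}
    (hX : F ∈ X) : ¬ P.IsBranchedIn X F ∧ ¬ P.IsAngularIn X F ↔
      ∀ K ∈ X, ∀ K' ∈ X, P.innerDual.Adj F K → P.innerDual.Adj F K' → K ≠ K' →
        Opposition F K K' := by
  obtain ⟨d, hd⟩ := exists_faceOf F.1
  obtain ⟨c, hc, -⟩ := hP.exists_hexagon_cycle (d := d) (hd.symm ▸ hF)
  rw [hd] at hc
  rw [hP.isBranchedIn_iff hF hc, hP.isAngularIn_iff hF hc hX,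
    AngularPattern.straight _ (hP.within_symm_next hc X)]
  constructor
  · intro h K hK K' hK' hadj hadj' hne
    obtain ⟨i, hi⟩ := hP.exists_dart_of_adj hc hadj
    obtain ⟨j, hj⟩ := hP.exists_dart_of_adj hc hadj'
    refine ⟨c i, c j, (hP.isOpposite_hexagon hF hc).mpr ?_, hc.faceOf i, hi, hj⟩
    rw [h i j ⟨K, hK, hi⟩ ⟨K', hK', hj⟩]
    rintro rfl
    exact hne (Subtype.ext (hi.symm.trans hj))
  · rintro h i j ⟨K, hK, hi⟩ ⟨K', hK', hj⟩ hij
    have hne : K ≠ K' := by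
      rintro rfl
      exact hij (hc.injective (hP.eq_of_shared (shared_of_faceOf (hc.faceOf j) hj)
        ((hc.faceOf i).trans (hc.faceOf j).symm) (hi.trans hj.symm)))
    obtain ⟨e, e', ho, h1, h2, h3⟩ := h K hK K' hK'
      (hP.innerDual_adj_iff.mpr ⟨_, hc.faceOf i, hi⟩)
      (hP.innerDual_adj_iff.mpr ⟨_, hc.faceOf j, hj⟩) hne
    obtain rfl := hP.eq_of_shared (d' := e) (shared_of_faceOf (hc.faceOf i) hi)
        (h1.trans (hc.faceOf i).symm) (h2.trans hi.symm)
    obtain rfl := hP.eq_of_shared (d' := e') (shared_of_faceOf (hc.faceOf j) hj)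
        ((ho.faceOf.trans h1).trans (hc.faceOf j).symm) (h3.trans hj.symm)
    exact hc.injective ((hP.isOpposite_hexagon hF hc).mp ho)

theorem isLinear_iff {X : Set P.InnerFace} : IsLinear X ↔
    IsStraight P.innerDual Opposition X ∧ ∀ Q ∈ X, Q ∉ P.hexagons →
      ∃ F ∈ X ∩ P.hexagons, ∃ F' ∈ X ∩ P.hexagons,
        F ≠ F' ∧ P.innerDual.Adj Q F ∧ P.innerDual.Adj Q F' := by
  unfold IsLinear IsSubsystem IsStraight
  constructor
  · rintro ⟨⟨h1, h2⟩, h3⟩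
    refine ⟨⟨h1, fun F hF K hK K' hK' hadj hadj' hne => ?_⟩, h2⟩
    rcases hP.inner_cycle F.1 F.2 with h6 | h4
    · exact (hP.not_branched_angular_iff h6 hF).mp (h3 F hF) K hK K' hK' hadj hadj' hne
    · exact hP.opposition_of_isSquare h4 hadj hadj' hne
  · rintro ⟨⟨h1, h3⟩, h2⟩
    refine ⟨⟨h1, h2⟩, fun F hF => ?_⟩
    rcases hP.inner_cycle F.1 F.2 with h6 | h4
    · exact (hP.not_branched_angular_iff h6 hF).mpr (h3 F hF)
    · have := hP.not_mem_hexagons.mpr h4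
      exact ⟨fun h => this h.1, fun h => this h.1⟩

/-- All corners of a square have degree three, so each corner meets a shared side; no two
consecutive sides are shared, so shared and outer sides alternate. -/
theorem exists_opposition {Q K : P.InnerFace} (hQ : IsSquare Q.1) (h : P.innerDual.Adj Q K) :
    ∃ K', Opposition Q K K' := by
  obtain ⟨d, hd, hdK⟩ := hP.innerDual_adj_iff.mp h
  obtain ⟨c, hc, rfl⟩ := hP.exists_square_cycle (d := d) (hd.symm ▸ hQ)
  rw [hd] at hc
  have h0 := shared_of_faceOf hd hdK
  have hin : Inner (c 2) := by rw [Inner, hc.faceOf]; exact Q.2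
  have h1 := hP.not_shared_next h0
  rw [hc.next_eq] at h1
  have h2 := hP.square_cubic (c 2) (by rw [hc.faceOf]; exact hQ)
  rw [hP.cubic_iff hin, hc.next_symm_eq] at h2
  have h2 : Shared (c 2) := h2.resolve_right h1
  exact ⟨⟨_, h2.2⟩, c 0, c 2, (hP.isOpposite_square hQ hc).mpr rfl, hc.faceOf 0, hdK, rfl⟩

theorem mem_hexagons_of_adj {Q K : P.InnerFace} (hQ : IsSquare Q.1) (h : P.innerDual.Adj Q K) :
    K ∈ P.hexagons := by
  obtain ⟨d, hd, hdK⟩ := hP.innerDual_adj_iff.mp h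
  by_contra hK
  rw [hP.not_mem_hexagons, ← hdK] at hK
  rw [← hd] at hQ
  exact hP.not_isSquare_symm hQ hK

/-- The condition that quadrilaterals lie between two hexagons is automatic here: a maximal straight
set with a square contains a neighbour of it, hence also the opposite neighbour, and neighbours of
squares are hexagons. -/
theorem isLinear_of_maximal [Nontrivial P.InnerFace] {X : Set P.InnerFace}
    (h : Maximal (IsStraight P.innerDual Opposition) X) : IsLinear X := by
  refine hP.isLinear_iff.mpr ⟨h.1, fun Q hQ hQ4 => ?_⟩
  rw [hP.not_mem_hexagons] at hQ4
  obtain ⟨K, hK, hadj⟩ := hP.innerDual_isTree.exists_adj_mem h hQ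
  obtain ⟨K', ho⟩ := hP.exists_opposition hQ4 hadj
  have hK' := hP.innerDual_isTree.opposite_mem hP.isOpposition h hQ hK ho
  have hadj' := hP.isOpposition.adj (hP.isOpposition.symm ho)
  exact ⟨K, ⟨hK, hP.mem_hexagons_of_adj hQ4 hadj⟩, K', ⟨hK', hP.mem_hexagons_of_adj hQ4 hadj'⟩,
    hP.isOpposition.ne ho, hadj, hadj'⟩

theorem maximal_isLinear_iff [Nontrivial P.InnerFace] {X : Set P.InnerFace} :
    Maximal IsLinear X ↔ Maximal (IsStraight P.innerDual Opposition) X := by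
  have := P.finite
  have := P.finite_dart
  have : Finite P.Face := Quotient.finite _
  constructor
  · intro h
    obtain ⟨Y, hXY, hY⟩ := Finite.exists_le_maximal (hP.isLinear_iff.mp h.1).1
    rwa [h.eq_of_subset (hP.isLinear_of_maximal hY) hXY]
  · intro h
    exact ⟨hP.isLinear_of_maximal h, fun Y hY hXY => h.2 (hP.isLinear_iff.mp hY).1 hXY⟩

theorem numSegments_eq : P.numSegments = {X : Set P.InnerFace | Maximal IsLinear X}.ncard := by
  have hinj : Function.Injective P.union := fun X Y h =>
    (hP.union_le_iff.mp h.le).antisymm (hP.union_le_iff.mp h.ge)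
  rw [numSegments, ← Set.ncard_image_of_injective _ hinj]
  congr 1
  ext S
  constructor
  · rintro ⟨⟨X, h1, rfl, h2⟩, hmax⟩
    refine ⟨X, ⟨⟨h1, h2⟩, fun Y hY hXY => ?_⟩, rfl⟩
    exact hP.union_le_iff.mp (hmax ⟨Y, hY.1, rfl, hY.2⟩ (hP.union_le_iff.mpr hXY))
  · rintro ⟨X, hX, rfl⟩
    refine ⟨⟨X, hX.1.1, rfl, hX.1.2⟩, ?_⟩
    rintro S ⟨Y, h1, rfl, h2⟩ hXY
    exact hP.union_le_iff.mpr (hX.2 ⟨h1, h2⟩ (hP.union_le_iff.mp hXY))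

theorem card_ends [Fintype V] :
    #{p : P.InnerFace × P.InnerFace | P.innerDual.Adj p.1 p.2 ∧ ¬ ∃ K', Opposition p.1 p.2 K'} =
      #{d : P.graph.Dart | IsEnd d} := by
  symm
  have key : ∀ {d : P.graph.Dart} (h : Shared d),
      (∃ K', Opposition ⟨_, h.1⟩ ⟨_, h.2⟩ K') ↔ ∃ d', IsOpposite d d' ∧ Shared d' := by
    intro d h
    constructor
    · rintro ⟨K', e, e', ho, h1, h2, h3⟩
      obtain rfl := hP.eq_of_shared h h1 h2
      exact ⟨e', ho, shared_of_faceOf (F := ⟨_, h.1⟩) ho.faceOf h3⟩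
    · rintro ⟨d', ho, hs⟩
      exact ⟨⟨_, hs.2⟩, d, d', ho, rfl, rfl, rfl⟩
  refine Finset.card_bij (fun d hd =>
    (⟨P.faceOf d, (Finset.mem_filter.mp hd).2.1.1⟩,
      ⟨P.faceOf d.symm, (Finset.mem_filter.mp hd).2.1.2⟩)) ?_ ?_ ?_
  · intro d hd
    simp only [Finset.mem_filter, Finset.mem_univ, true_and] at hd ⊢
    exact ⟨hP.innerDual_adj_iff.mpr ⟨d, rfl, rfl⟩, fun h => hd.2 ((key hd.1).mp h)⟩
  · intro d hd d' hd' h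
    have h' := Prod.mk.inj h
    exact hP.eq_of_shared (Finset.mem_filter.mp hd').2.1 (Subtype.ext_iff.mp h'.1)
      (Subtype.ext_iff.mp h'.2)
  · rintro ⟨F, K⟩ h
    simp only [Finset.mem_filter, Finset.mem_univ, true_and] at h
    obtain ⟨d, hd, hd'⟩ := hP.innerDual_adj_iff.mp h.1
    have hs := shared_of_faceOf hd hd'
    have hF : F = ⟨_, hs.1⟩ := Subtype.ext hd.symm
    have hK : K = ⟨_, hs.2⟩ := Subtype.ext hd'.symm
    subst hF hK
    refine ⟨d, ?_, rfl⟩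
    simp only [Finset.mem_filter, Finset.mem_univ, true_and]
    exact ⟨hs, fun h' => h.2 ((key hs).mpr h')⟩

theorem two_mul_numSegments [Fintype V] [Nontrivial P.InnerFace] : 2 * P.numSegments =
    #{d : P.graph.Dart | IsEnd d} := by
  rw [← hP.card_ends, hP.numSegments_eq,
    ← hP.innerDual_isTree.two_mul_card_maximal_isStraight hP.isOpposition]
  simp only [hP.maximal_isLinear_iff]

end IsCata
end PlaneGraph

/-! ### Bays, segments and the unified formula. -/

namespace PlaneGraph

variable {V : Type u} {P : PlaneGraph V}

namespace IsCata

variable (hP : IsCata P)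
include hP

theorem card_filter_inner [Fintype V] (p : P.graph.Dart → Prop) (hp : ∀ d, p d → Inner d) :
    #{d | p d} = (∑ F : P.Face with IsHexagonal F, #{d | P.faceOf d = F ∧ p d}) +
      ∑ F : P.Face with IsSquare F, #{d | P.faceOf d = F ∧ p d} := by
  have h := hP.sum_inner fun d => if p d then 1 else 0
  simp only [← Finset.card_filter, Finset.filter_filter] at h
  rw [← h]
  congr 1
  ext d
  simp only [Finset.mem_filter, Finset.mem_univ, true_and]
  exact ⟨fun h => ⟨hp d h, h⟩, fun h => h.2⟩

theorem isBay_iff {d : P.graph.Dart} (hd : Inner d) : IsBay d ↔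
    ¬ Shared d ∧ Shared (P.next.symm d) ∧ Shared (P.next d) := by
  unfold IsBay
  rw [hP.cubic_iff hd, ← cubic_next_iff, hP.cubic_iff (inner_next_iff.mpr hd),
    Equiv.symm_apply_apply]
  tauto

theorem not_shared_cycle {F : P.Face} {k : ℕ} {c : ZMod k → P.graph.Dart} (hc : IsFaceCycle F c)
    (i : ZMod k) : ¬ (Shared (c i) ∧ Shared (c (i + 1))) := by
  rintro ⟨h1, h2⟩
  rw [← hc.next_eq] at h2
  exact hP.not_shared_next h1 h2

omit hP in
theorem _root_.PlaneGraph.IsFaceCycle.inner {F : P.Face} (hF : F ≠ P.outer) {k : ℕ}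
    {c : ZMod k → P.graph.Dart} (hc : IsFaceCycle F c) (i : ZMod k) : Inner (c i) := by
  rw [Inner, hc.faceOf]; exact hF

omit hP in
theorem _root_.PlaneGraph.IsFaceCycle.within_univ_iff {F : P.Face} (hF : F ≠ P.outer) {k : ℕ}
    {c : ZMod k → P.graph.Dart} (hc : IsFaceCycle F c) (i : ZMod k) :
    Within Set.univ (c i).symm ↔ Shared (c i) := by
  rw [within_univ, Shared, and_iff_right (hc.inner hF i)]

theorem exists_shared [Nontrivial P.InnerFace] {F : P.Face} (hF : F ≠ P.outer) :
    ∃ d, P.faceOf d = F ∧ Shared d := by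
  obtain ⟨K, hK⟩ := hP.innerDual_connected.preconnected.exists_adj_of_nontrivial ⟨F, hF⟩
  obtain ⟨d, hd, hd'⟩ := hP.innerDual_adj_iff.mp hK
  exact ⟨d, hd, shared_of_faceOf hd hd'⟩

variable [Fintype V]

theorem card_bays_hexagon [Nontrivial P.InnerFace] {F : P.Face} (hF : IsHexagonal F) :
    2 * #{d | P.faceOf d = F ∧ IsBay d} + 2 =
      #{d : P.graph.Dart | P.faceOf d = F ∧ IsEnd d} +
      #{d | P.faceOf d = F ∧ Shared d} +
      2 * if ∃ h : F ≠ P.outer, P.IsBranchedIn Set.univ ⟨F, h⟩ then 1 else 0 := by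
  obtain ⟨d, hd, hs⟩ := hP.exists_shared hF.1
  subst hd
  obtain ⟨c, hc, h0⟩ := hP.exists_hexagon_cycle hF
  have h := AngularPattern.bays (fun i => Shared (c i)) (hP.not_shared_cycle hc)
    ⟨0, by rw [h0]; exact hs⟩
  have hb : (∃ h : P.faceOf d ≠ P.outer, P.IsBranchedIn Set.univ ⟨P.faceOf d, h⟩) ↔
      #{i | Shared (c i)} = 3 := by
    rw [exists_prop_of_true hF.1, hP.isBranchedIn_iff (F := ⟨_, hF.1⟩) hF hc]
    simp only [hc.within_univ_iff hF.1]
  rw [hc.card_darts fun d => IsBay d, hc.card_darts fun d => Shared d,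
    hc.card_darts fun d => IsEnd d]
  simp only [hb]
  convert h using 3
  · congr 2
    ext i
    rw [hP.isBay_iff (hc.inner hF.1 i), hc.next_eq, hc.next_symm_eq]
    have := hP.not_shared_cycle hc i
    tauto
  · simp only [IsEnd, hP.isOpposite_hexagon hF hc, exists_eq_left]

theorem card_square_ends {F : P.Face} (hF : IsSquare F) :
    #{d : P.graph.Dart | P.faceOf d = F ∧ IsEnd d} = 0 := by
  rw [Finset.card_eq_zero, Finset.filter_eq_empty_iff]
  rintro d - ⟨rfl, hs, h⟩
  obtain ⟨K, e, e', ho, h1, h2, h3⟩ := hP.exists_opposition (Q := ⟨_, hs.1⟩) (K := ⟨_, hs.2⟩) hF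
    (hP.innerDual_adj_iff.mpr ⟨d, rfl, rfl⟩)
  obtain rfl := hP.eq_of_shared hs h1 h2
  exact h ⟨e', ho, shared_of_faceOf (F := ⟨_, hs.1⟩) ho.faceOf h3⟩

theorem card_square_shared {F : P.Face} (hF : IsSquare F) :
    #{d : P.graph.Dart | P.faceOf d = F ∧ Shared d} = 2 ∧
    #{d : P.graph.Dart | P.faceOf d = F ∧ IsBay d} = 2 := by
  obtain ⟨d, rfl⟩ := exists_faceOf F
  obtain ⟨c, hc, -⟩ := hP.exists_square_cycle hF
  have hcub : ∀ i, Shared (c i) ∨ Shared (c (i - 1)) := fun i => by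
    rw [← hc.next_symm_eq, ← hP.cubic_iff (hc.inner hF.1 i)]
    exact hP.square_cubic _ (by rw [hc.faceOf]; exact hF)
  have hns := hP.not_shared_cycle hc
  have hbay : ∀ i, IsBay (c i) ↔ ¬ Shared (c i) := fun i => by
    rw [hP.isBay_iff (hc.inner hF.1 i), hc.next_eq, hc.next_symm_eq, and_iff_left_iff_imp]
    intro h
    refine ⟨(hcub i).resolve_left h, ?_⟩
    have := hcub (i + 1)
    rw [add_sub_cancel_right] at this
    exact this.resolve_right h
  rw [hc.card_darts fun d => Shared d, hc.card_darts fun d => IsBay d]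
  simp only [hbay]
  have key : ∀ t : ZMod 4 → Bool, (∀ i, t i ∨ t (i - 1)) → (∀ i, ¬ (t i ∧ t (i + 1))) →
      #{i | t i} = 2 ∧ #{i | ¬ t i} = 2 := by decide
  have := key (fun i => decide (Shared (c i))) (by simpa using hcub) (by simpa using hns)
  simp only [decide_eq_true_eq] at this
  convert this

omit hP in
theorem numBranched_eq : P.numBranched = ∑ F : P.Face with IsHexagonal F,
    if ∃ h : F ≠ P.outer, P.IsBranchedIn Set.univ ⟨F, h⟩ then 1 else 0 := by
  rw [numBranched, ← Set.ncard_image_of_injective _ Subtype.val_injective, ← Finset.card_filter,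
    Finset.filter_filter, ← Set.ncard_coe_finset]
  congr 1
  ext F
  simp only [Set.mem_image, Set.mem_ofPred_eq, Subtype.exists, exists_and_right, exists_eq_right,
    Finset.coe_filter, Finset.mem_univ, true_and]
  exact ⟨fun ⟨h, h'⟩ => ⟨mem_hexagons.mp h'.1, h, h'⟩, fun h => h.2⟩

omit hP in
theorem numHexagons_eq : P.numHexagons = #{F : P.Face | IsHexagonal F} := by
  rw [numHexagons, ← Set.ncard_coe_finset, ← Set.ncard_image_of_injective _ Subtype.val_injective]
  congr 1
  ext F
  simp only [Set.mem_image, mem_hexagons, Subtype.exists, exists_and_left, exists_prop,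
    exists_eq_right_right, Finset.coe_filter, Finset.mem_univ, true_and, Set.mem_ofPred_eq]
  exact ⟨fun h => h.1, fun h => ⟨h, h.1⟩⟩

/-- Summing the local identities over the faces, with 2(h + q) - 2 shared darts in total, gives the
relation. A single inner face is treated apart: it has one segment but no ends, and the local
identity needs a shared side. -/
theorem card_bays : #{d : P.graph.Dart | IsBay d} + 1 =
    2 * #{F : P.Face | IsSquare F} + P.numSegments + P.numBranched := by
  rcases subsingleton_or_nontrivial P.InnerFace with hsub | hnon
  · obtain ⟨d₀, hd₀⟩ := hP.exists_inner
    have hns : ∀ d : P.graph.Dart, ¬ Shared d := fun d hd =>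
      (hP.innerDual_adj_iff.mpr ⟨d, rfl, rfl⟩ : P.innerDual.Adj ⟨_, hd.1⟩ ⟨_, hd.2⟩).ne
        (Subsingleton.elim _ _)
    have h4 : ∀ F : P.Face, ¬ IsSquare F := by
      intro F hF
      obtain ⟨d, rfl⟩ := exists_faceOf F
      rcases (hP.cubic_iff hF.inner).mp (hP.square_cubic d hF) with h | h <;> exact hns _ h
    have hbay : ∀ d : P.graph.Dart, ¬ IsBay d := by
      intro d h
      rcases (hP.cubic_iff h.1.1).mp h.2.1 with h | h <;> exact hns _ h
    have hbr : P.numBranched = 0 := by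
      rw [numBranched, Set.ncard_eq_zero]
      rw [Set.eq_empty_iff_forall_notMem]
      rintro F ⟨-, h⟩
      have := Set.ncard_le_one_of_subsingleton {F' ∈ Set.univ | P.innerDual.Adj F F'}
      omega
    have hlin : IsLinear (Set.univ : Set P.InnerFace) := by
      rw [hP.isLinear_iff]
      refine ⟨⟨?_, fun F _ K _ K' _ _ _ h => absurd (Subsingleton.elim _ _) h⟩, ?_⟩
      · have := hP.innerDual_connected
        exact (SimpleGraph.induceUnivIso P.innerDual).connected_iff.mpr this
      · exact fun Q _ hQ => absurd (hP.not_mem_hexagons.mp hQ) (h4 _)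
    have hseg : P.numSegments = 1 := by
      rw [hP.numSegments_eq, Set.ncard_eq_one]
      refine ⟨Set.univ, Set.eq_singleton_iff_unique_mem.mpr ⟨⟨hlin, fun _ _ _ => Set.subset_univ _⟩,
        fun X hX => hX.eq_of_subset hlin (Set.subset_univ _)⟩⟩
    rw [hbr, hseg]
    simp [h4, hbay]
  · have h1 := Finset.sum_congr rfl fun F (hF : F ∈ ({F : P.Face | IsHexagonal F} : Finset _)) =>
      hP.card_bays_hexagon (Finset.mem_filter.mp hF).2
    have h3 := hP.card_filter_inner (fun d => IsBay d) fun d h => h.1.1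
    have h4 := hP.card_filter_inner (fun d => Shared d) fun d h => h.1
    have h5 := hP.card_filter_inner
      (fun d => IsEnd d) fun d h => h.1.1
    rw [Finset.sum_congr rfl fun F hF => (hP.card_square_shared (Finset.mem_filter.mp hF).2).2,
      Finset.sum_const, smul_eq_mul] at h3
    rw [Finset.sum_congr rfl fun F hF => (hP.card_square_shared (Finset.mem_filter.mp hF).2).1,
      Finset.sum_const, smul_eq_mul] at h4
    rw [Finset.sum_congr rfl fun F hF => hP.card_square_ends (Finset.mem_filter.mp hF).2,
      Finset.sum_const_zero, ← hP.two_mul_numSegments] at h5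
    have h6 := numBranched_eq (P := P)
    rw [Finset.sum_add_distrib, Finset.sum_add_distrib, Finset.sum_add_distrib, Finset.sum_const,
      smul_eq_mul, ← Finset.mul_sum, ← Finset.mul_sum, ← h6] at h1
    have h7 := hP.card_shared
    omega

theorem wienerPolarity_eq : (wienerPolarity P.graph : ℤ) =
    9 * P.numHexagons + 4 * #{F : P.Face | IsSquare F} + P.numSegments + P.numBranched - 7 := by
  have h1 := hP.wienerPolarity_add
  have h2 := hP.card_bays
  rw [numHexagons_eq]
  omega

end IsCata
end PlaneGraph

/-! ### Catacondensed benzenoid graphs satisfy the axioms. -/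

namespace PlaneGraph

variable {V : Type u} {P : PlaneGraph V}

theorem eq_of_isCycleOfLength (hrot : ∀ d, P.rot d ≠ d) {d d' : P.graph.Dart} {k : ℕ}
    (hk : IsCycleOfLength (P.boundary (P.faceOf d)) k) (h : P.faceOf d = P.faceOf d')
    (hf : d.fst = d'.fst) : d = d' := by
  obtain ⟨-, c, hc⟩ := exists_isFaceCycle hrot hk
  obtain ⟨i, hi⟩ := (hc.faceOf_eq_iff d).mp rfl
  obtain ⟨j, hj⟩ := (hc.faceOf_eq_iff d').mp h.symm
  subst hj
  rw [← hi] at hf ⊢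
  rw [hc.fst_injective hf]

theorem not_isSquare_of_isHexagonal (hrot : ∀ d, P.rot d ≠ d) {F : P.Face} (h6 : IsHexagonal F) :
    ¬ IsSquare F := by
  intro h4
  have := P.finite
  have := Fintype.ofFinite V
  obtain ⟨-, c, hc⟩ := exists_isFaceCycle hrot h6.2
  obtain ⟨-, c', hc'⟩ := exists_isFaceCycle hrot h4.2
  have h1 := hc.card_darts fun _ => True
  have h2 := hc'.card_darts fun _ => True
  rw [h1] at h2
  simp [ZMod.card] at h2

theorem exists_pow_rot {d d' : P.graph.Dart} (h : d'.fst = d.fst) :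
    ∃ n, (P.rot ^ n) d = d' := by
  have := P.finite_dart
  obtain ⟨n, -, hn⟩ := (P.rot_cyclic d d' h.symm).exists_pow_eq'
  exact ⟨n, hn⟩

theorem rot_pow_fst (d : P.graph.Dart) (n : ℕ) : ((P.rot ^ n) d).fst = d.fst := by
  induction n with
  | zero => rfl
  | succ n ih => rw [pow_succ', Equiv.Perm.mul_apply, P.rot_fst, ih]

theorem eq_or_of_rot_rot {d d' : P.graph.Dart} (h2 : P.rot (P.rot d) = d) (h : d'.fst = d.fst) :
    d' = d ∨ d' = P.rot d := by
  obtain ⟨n, rfl⟩ := exists_pow_rot h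
  clear h
  induction n with
  | zero => exact Or.inl rfl
  | succ n ih =>
    rw [pow_succ', Equiv.Perm.mul_apply]
    rcases ih with h | h <;> rw [h]
    · exact Or.inr rfl
    · exact Or.inl h2

/-- A fixed dart starts at a vertex of degree one, which becomes isolated when its only neighbour is
deleted although another vertex remains. -/
theorem rot_ne_of_isTwoConnected (h : IsTwoConnected P.graph) (d : P.graph.Dart) :
    P.rot d ≠ d := by
  intro hd
  have := P.finite
  have hall : ∀ d' : P.graph.Dart, d'.fst = d.fst → d' = d := by
    intro d' h'
    rcases eq_or_of_rot_rot (d := d) (by rw [hd, hd]) h' with h | h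
    · exact h
    · rw [h, hd]
  have hmem : d.fst ∈ ({d.snd}ᶜ : Set V) := d.fst_ne_snd
  have hnt : Nontrivial ({d.snd}ᶜ : Set V) := by
    by_contra hnt
    rw [not_nontrivial_iff_subsingleton, Set.subsingleton_coe] at hnt
    have h1 : ({d.snd}ᶜ : Set V).ncard ≤ 1 := Set.ncard_le_one_iff_subsingleton.mpr hnt
    have h2 := Set.ncard_add_ncard_compl ({d.snd} : Set V)
    rw [Set.ncard_singleton] at h2
    have := h.1
    omega
  obtain ⟨⟨w, hw⟩, hadj⟩ := (h.2 d.snd).preconnected.exists_adj_of_nontrivial ⟨d.fst, hmem⟩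
  have := hall ⟨(d.fst, w), hadj⟩ rfl
  exact hw (congrArg (fun d : P.graph.Dart => d.snd) this)

theorem sum_rot_pow (d : P.graph.Dart) (F : P.Face) (m : ℕ) :
    ∑ k ∈ Finset.range m, ((if P.faceOf ((P.rot ^ k) d) = F then 1 else 0) +
      (if P.faceOf ((P.rot ^ k) d).symm = F then 1 else 0) : ZMod 2) =
      (if P.faceOf d = F then 1 else 0) + if P.faceOf ((P.rot ^ m) d) = F then 1 else 0 := by
  induction m with
  | zero => rw [Finset.sum_range_zero, pow_zero, Equiv.Perm.one_apply, CharTwo.add_self_eq_zero]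
  | succ m ih =>
    rw [Finset.sum_range_succ, ih, pow_succ', Equiv.Perm.mul_apply, faceOf_rot]
    generalize (if P.faceOf d = F then 1 else 0 : ZMod 2) = a
    generalize (if P.faceOf ((P.rot ^ m) d) = F then 1 else 0 : ZMod 2) = b
    rw [add_assoc, ← add_assoc b, CharTwo.add_self_eq_zero, zero_add]

/-- A vertex of a 2-connected plane graph occurs at most once on the outer face. -/
theorem eq_of_outer (h : IsTwoConnected P.graph) {d d' : P.graph.Dart} (hd : ¬ Inner d)
    (hd' : ¬ Inner d') (hf : d'.fst = d.fst) : d' = d := by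
  by_contra hne
  have := P.finite
  have := Fintype.ofFinite V
  have hex := exists_pow_rot hf
  -- Minimality keeps `d'` out of the sector of darts from `d` up to `d'`, and makes `d` occur in it
  -- only once.
  obtain ⟨m, hm, hmin⟩ : ∃ m, (P.rot ^ m) d = d' ∧ ∀ k < m, (P.rot ^ k) d ≠ d' :=
    ⟨Nat.find hex, Nat.find_spec hex, fun k hk => Nat.find_min hex hk⟩
  have hm0 : 0 < m := by
    rcases Nat.eq_zero_or_pos m with rfl | h
    · exact absurd hm.symm hne
    · exact h
  rw [Inner, not_not] at hd hd'
  have hedge : ∀ x y : P.graph.Dart, x.edge = y.edge ↔ x = y ∨ x = y.symm := fun x y =>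
    SimpleGraph.dart_edge_eq_iff x y
  -- The edges of the sector meet every face evenly: the sum telescopes by `sum_rot_pow` and both
  -- its limits are outer corners. They therefore form a cut.
  let z : Sym2 V → ZMod 2 := fun e => ∑ k ∈ Finset.range m,
    if ((P.rot ^ k) d).edge = e then 1 else 0
  obtain ⟨f, hz⟩ := P.exists_vertex_potential z (by
    intro F
    simp only [z]
    rw [Finset.sum_comm, Finset.sum_congr rfl (g := fun k =>
      ((if P.faceOf ((P.rot ^ k) d) = F then 1 else 0) +
      (if P.faceOf ((P.rot ^ k) d).symm = F then 1 else 0) : ZMod 2)), sum_rot_pow, hm, hd, hd',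
      CharTwo.add_self_eq_zero]
    intro k _
    generalize (P.rot ^ k) d = y
    have hsplit : ∀ x : P.graph.Dart, (if y.edge = x.edge then 1 else 0 : ZMod 2) =
        (if x = y then 1 else 0) + if x = y.symm then 1 else 0 := by
      intro x
      have hy : y ≠ y.symm := y.symm_ne.symm
      have hye : y.edge = x.edge ↔ x = y ∨ x = y.symm := eq_comm.trans (hedge x y)
      simp only [hye]
      by_cases h1 : x = y
      · subst h1; simp [hy]
      · by_cases h2 : x = y.symm
        · subst h2; simp [hy.symm]
        · simp [h1, h2]
    rw [Finset.sum_congr rfl fun x _ => hsplit x, Finset.sum_add_distrib, Finset.sum_ite_eq',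
      Finset.sum_ite_eq']
    simp only [Finset.mem_filter, Finset.mem_univ, true_and])
  -- The cut has no edge away from `d.fst`, and deleting that vertex leaves a connected graph, so
  -- all other vertices are on one side. The edges of `d` and `d'` would then agree, but only the
  -- first is in the cut.
  have hconst : ∀ a b : ({d.fst}ᶜ : Set V), f a = f b := by
    intro a b
    obtain ⟨w⟩ := (h.2 d.fst).preconnected a b
    induction w with
    | nil => rfl
    | cons hadj _ ih =>
      rename_i x y _ _
      rw [← ih]
      have h1 := hz ⟨(x.1, y.1), hadj⟩
      have h0 : z (SimpleGraph.Dart.edge ⟨(x.1, y.1), hadj⟩) = 0 := by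
        refine Finset.sum_eq_zero fun k _ => if_neg fun he => ?_
        rcases (hedge _ _).mp he with he | he
        · exact x.2 ((congrArg (fun e : P.graph.Dart => e.fst) he).symm.trans (rot_pow_fst d k))
        · exact y.2 ((congrArg (fun e : P.graph.Dart => e.fst) he).symm.trans (rot_pow_fst d k))
      rw [h0] at h1
      exact (CharTwo.add_eq_zero.mp h1.symm)
  have h1 : z d.edge = 1 := by
    simp only [z]
    rw [Finset.sum_eq_single_of_mem 0 (Finset.mem_range.mpr hm0), if_pos (by rw [pow_zero]; rfl)]
    intro k hk hk0
    rw [Finset.mem_range] at hk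
    refine if_neg fun he => ?_
    have he' : (P.rot ^ k) d = d := by
      rcases (hedge _ _).mp he with he | he
      · exact he
      · have := congrArg (fun x : P.graph.Dart => x.fst) he
        exact absurd ((rot_pow_fst d k).symm.trans this) d.fst_ne_snd
    refine hmin (m - k) (by omega) ?_
    conv_lhs => rw [← he', ← Equiv.Perm.mul_apply, ← pow_add, Nat.sub_add_cancel hk.le]
    exact hm
  have h2 : z d'.edge = 0 := by
    refine Finset.sum_eq_zero fun k hk => if_neg fun he => ?_
    rcases (hedge _ _).mp he with he | he
    · exact hmin k (Finset.mem_range.mp hk) he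
    · have := congrArg (fun x : P.graph.Dart => x.fst) he
      exact d'.fst_ne_snd (hf.trans ((rot_pow_fst d k).symm.trans this))
  rw [hz] at h1 h2
  have h3 := hconst ⟨d.snd, d.fst_ne_snd.symm⟩ ⟨d'.snd, by
    rw [Set.mem_compl_iff, Set.mem_singleton_iff, ← hf]
    exact d'.fst_ne_snd.symm⟩
  simp only at h3
  rw [hf, ← h3, h1] at h2
  exact one_ne_zero h2

section Benzenoid

variable (hP : P.IsCatacondensed)
include hP

theorem IsCatacondensed.rot_ne (d : P.graph.Dart) : P.rot d ≠ d :=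
  rot_ne_of_isTwoConnected hP.1.twoConnected d

theorem IsCatacondensed.isHexagonal {F : P.Face} (hF : F ≠ P.outer) : IsHexagonal F :=
  ⟨hF, hP.1.inner_cycle ⟨F, hF⟩⟩

theorem IsCatacondensed.eq_of_faceOf_eq {d d' : P.graph.Dart} (hd : Inner d)
    (h : P.faceOf d = P.faceOf d') (hf : d.fst = d'.fst) : d = d' :=
  eq_of_isCycleOfLength hP.rot_ne (hP.isHexagonal hd).2 h hf

theorem IsCatacondensed.not_three_inner {d d' d'' : P.graph.Dart} (h : Inner d) (h' : Inner d')
    (h'' : Inner d'') (hf' : d'.fst = d.fst) (hf'' : d''.fst = d.fst) (h1 : d ≠ d') (h2 : d ≠ d'')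
    (h3 : d' ≠ d'') : False := by
  refine hP.2 d.fst ⟨⟨_, h⟩, (hP.isHexagonal h).2, ⟨_, h'⟩, (hP.isHexagonal h').2, ⟨_, h''⟩,
    (hP.isHexagonal h'').2, ?_, ?_, ?_, mem_boundary_iff.mpr ⟨d, rfl, rfl⟩,
    mem_boundary_iff.mpr ⟨d', rfl, hf'⟩, mem_boundary_iff.mpr ⟨d'', rfl, hf''⟩⟩
  · exact fun e => h1 (hP.eq_of_faceOf_eq h (Subtype.ext_iff.mp e) hf'.symm)
  · exact fun e => h2 (hP.eq_of_faceOf_eq h (Subtype.ext_iff.mp e) hf''.symm)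
  · exact fun e => h3 (hP.eq_of_faceOf_eq h' (Subtype.ext_iff.mp e) (hf'.trans hf''.symm))

/-- If all corners at a vertex were inner, degree two would give two hexagons with both edges at the
vertex in common, and larger degree would give three hexagons at one vertex. -/
theorem IsCatacondensed.exists_outer (v : V) : ∃ d : P.graph.Dart, d.fst = v ∧ ¬ Inner d := by
  by_contra! hall
  obtain ⟨d, rfl⟩ := P.exists_fst_eq v
  have h0 := hall d rfl
  have h1 := hall _ (P.rot_fst d)
  have h2 := hall (P.rot (P.rot d)) (by rw [P.rot_fst, P.rot_fst])
  by_cases hc : P.rot (P.rot d) = d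
  · have hF : P.faceOf d ≠ P.faceOf (P.rot d) := fun h =>
      hP.rot_ne d (hP.eq_of_faceOf_eq h0 h (P.rot_fst d).symm).symm
    rcases hP.1.two_cycles _ _ (hP.isHexagonal h0).2 (hP.isHexagonal h1).2
      (fun h => hF (boundary_injective h0 h1 h)) with h | h
    · exact Set.disjoint_left.mp h (mem_boundary_iff.mpr ⟨d, rfl, rfl⟩)
        (mem_boundary_iff.mpr ⟨_, rfl, P.rot_fst d⟩)
    · obtain ⟨e, he⟩ := Set.ncard_eq_one.mp h
      have m1 : d.edge ∈ (P.boundary (P.faceOf d)).edgeSet ∩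
          (P.boundary (P.faceOf (P.rot d))).edgeSet :=
        ⟨⟨d, rfl, rfl⟩, ⟨d.symm, (faceOf_rot d).symm, d.edge_symm⟩⟩
      have m2 : (P.rot d).edge ∈ (P.boundary (P.faceOf d)).edgeSet ∩
          (P.boundary (P.faceOf (P.rot d))).edgeSet :=
        ⟨⟨(P.rot d).symm, by rw [← faceOf_rot, hc], (P.rot d).edge_symm⟩, ⟨_, rfl, rfl⟩⟩
      rw [he] at m1 m2
      rcases (SimpleGraph.dart_edge_eq_iff _ _).mp (m1.trans m2.symm) with h | h
      · exact hP.rot_ne d h.symm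
      · have := congrArg (fun x : P.graph.Dart => x.snd) h
        exact d.fst_ne_snd ((P.rot_fst d).symm.trans this.symm)
  · exact hP.not_three_inner h0 h1 h2 (P.rot_fst d) (by rw [P.rot_fst, P.rot_fst])
      (hP.rot_ne d).symm (Ne.symm hc) (hP.rot_ne _).symm

theorem IsCatacondensed.not_isSquare (F : P.Face) : ¬ IsSquare F := fun h =>
  not_isSquare_of_isHexagonal hP.rot_ne (hP.isHexagonal h.1) h

theorem IsCatacondensed.isCata : IsCata P where
  inner_cycle F hF := Or.inl (hP.isHexagonal hF)
  outer_unique v := by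
    obtain ⟨d, rfl, hd⟩ := hP.exists_outer v
    exact ⟨d, ⟨rfl, hd⟩, fun d' h => eq_of_outer hP.1.twoConnected hd h.2 h.1⟩
  rot_ne := hP.rot_ne
  rot_pow d := by
    obtain ⟨o, ho, hout⟩ := hP.exists_outer d.fst
    have hin : ∀ x : P.graph.Dart, x.fst = o.fst → x ≠ o → Inner x := fun x hx hne => by
      by_contra h
      exact hne (eq_of_outer hP.1.twoConnected hout h hx)
    obtain ⟨n, rfl⟩ := exists_pow_rot (d := o) (d' := d) ho.symm
    have hcomm : ∀ m : ℕ, (P.rot ^ m) o = o → (P.rot ^ m) ((P.rot ^ n) o) = (P.rot ^ n) o := by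
      intro m hm
      rw [← Equiv.Perm.mul_apply, ← pow_add, add_comm, pow_add, Equiv.Perm.mul_apply, hm]
    by_cases h2 : P.rot (P.rot o) = o
    · exact Or.inl (hcomm 2 h2)
    · refine Or.inr (hcomm 3 ?_)
      by_contra h3
      -- All darts at the vertex except `o` are inner, so degree four or more would again yield
      -- three inner corners.
      have h3 : P.rot (P.rot (P.rot o)) ≠ o := h3
      refine hP.not_three_inner (hin _ ?_ (hP.rot_ne o)) (hin _ ?_ h2) (hin _ ?_ h3) ?_ ?_
        (hP.rot_ne _).symm ?_ (hP.rot_ne _).symm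
      · simp only [P.rot_fst]
      · simp only [P.rot_fst]
      · simp only [P.rot_fst]
      · simp only [P.rot_fst]
      · simp only [P.rot_fst]
      · exact fun h => h2 (P.rot.injective h.symm)
  square_cubic d h := absurd h (hP.not_isSquare _)
  square_unique d _ h := absurd h (hP.not_isSquare _)

end Benzenoid
end PlaneGraph

/-! ### The expansion, with its vertices indexed by inner darts. -/

namespace PlaneGraph

variable {U : Type u} {G : PlaneGraph U}

/-- The vertex of the expansion given by the initial vertex and the face of an inner dart. -/
def copy (d : {d : G.graph.Dart // Inner d}) :
    {p : U × G.InnerFace // p.1 ∈ (G.boundary p.2.1).verts} :=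
  ⟨(d.1.fst, ⟨G.faceOf d.1, d.2⟩), mem_boundary_iff.mpr ⟨d.1, rfl, rfl⟩⟩

theorem copy_surjective : Function.Surjective (copy (G := G)) := by
  rintro ⟨⟨x, F, hF⟩, hx⟩
  obtain ⟨d, rfl, rfl⟩ := mem_boundary_iff.mp hx
  exact ⟨⟨d, hF⟩, rfl⟩

/-- The quadrilateral inserted at a shared edge. -/
def quad (m : {m : G.graph.Dart // Shared m}) : G.expansion.Subgraph :=
  G.quadrilateral ⟨_, m.2.1⟩ ⟨_, m.2.2⟩ m.1.fst m.1.snd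

namespace IsCata

variable (hG : IsCata G)
include hG

theorem copy_injective : Function.Injective (copy (G := G)) := by
  rintro ⟨d, h⟩ ⟨d', h'⟩ he
  have he' := Prod.mk.inj (Subtype.ext_iff.mp he)
  exact Subtype.ext (hG.eq_of_faceOf_eq h (Subtype.ext_iff.mp he'.2) he'.1)

/-- The common edge required in the definition comes for free: by `faceOf_eq_or_exists`, two
different inner faces at a vertex share an edge at that vertex. -/
theorem expansion_adj {d d' : {d : G.graph.Dart // Inner d}} :
    G.expansion.Adj (copy d) (copy d') ↔
      d'.1 = G.next d.1 ∨ d'.1 = G.next.symm d.1 ∨ (d'.1 ≠ d.1 ∧ d'.1.fst = d.1.fst) := by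
  obtain ⟨d, h⟩ := d
  obtain ⟨d', h'⟩ := d'
  rw [Equiv.eq_symm_apply]
  constructor
  · rintro (⟨hF, m, hm, he⟩ | ⟨hF, hx, -⟩)
    · have hF : G.faceOf d = G.faceOf d' := Subtype.ext_iff.mp hF
      have hm : G.faceOf m = G.faceOf d := hm
      have hmi : Inner m := by rw [Inner, hm]; exact h
      rcases SimpleGraph.dart_edge_eq_mk'_iff'.mp he with ⟨h1, h2⟩ | ⟨h1, h2⟩
      · obtain rfl := hG.eq_of_faceOf_eq hmi hm h1
        refine Or.inl (hG.eq_of_faceOf_eq h' (by rw [faceOf_next, hF]) ?_)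
        rw [next_fst]; exact h2.symm
      · obtain rfl := hG.eq_of_faceOf_eq hmi (hm.trans hF) h1
        refine Or.inr (Or.inl (hG.eq_of_faceOf_eq (inner_next_iff.mpr hmi) ?_ ?_))
        · rw [faceOf_next, hm]
        · rw [next_fst]; exact h2
    · exact Or.inr (Or.inr ⟨fun e => hF (Subtype.ext (congrArg G.faceOf e.symm)), hx.symm⟩)
  · rintro (rfl | rfl | ⟨hne, hx⟩)
    · refine Or.inl ⟨Subtype.ext (faceOf_next d).symm, d, rfl, ?_⟩
      exact SimpleGraph.dart_edge_eq_mk'_iff.mpr (Or.inl (Prod.ext rfl (next_fst d).symm))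
    · refine Or.inl ⟨Subtype.ext (faceOf_next d'), d', (faceOf_next d').symm, ?_⟩
      exact SimpleGraph.dart_edge_eq_mk'_iff.mpr (Or.inr (Prod.ext rfl (next_fst d').symm))
    · refine Or.inr ⟨fun e => hne (hG.eq_of_faceOf_eq h' (Subtype.ext_iff.mp e).symm hx), hx.symm, ?_⟩
      rcases hG.faceOf_eq_or_exists h h' hx with e | ⟨e, -⟩ | ⟨e, -⟩
      · exact absurd e hne
      · exact ⟨d.snd, ⟨d, rfl, rfl⟩, ⟨d.symm, e, d.edge_symm⟩⟩
      · refine ⟨d'.snd, ⟨d'.symm, e, ?_⟩, ⟨d', rfl, ?_⟩⟩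
        · rw [SimpleGraph.Dart.edge_symm]
          exact congrArg (fun x => s(x, d'.snd)) hx
        · exact congrArg (fun x => s(x, d'.snd)) hx

omit hG in
theorem copy_mem_hexagonCopy {d : {d : G.graph.Dart // Inner d}} {F : G.InnerFace} :
    copy d ∈ (G.hexagonCopy F).verts ↔ G.faceOf d.1 = F.1 := Subtype.ext_iff

theorem isCycleOfLength_hexagonCopy {F : G.InnerFace} (hF : IsHexagonal F.1) :
    IsCycleOfLength (G.hexagonCopy F) 6 := by
  obtain ⟨d, hd⟩ := exists_faceOf F.1
  obtain ⟨c, hc, -⟩ := hG.exists_hexagon_cycle (d := d) (hd.symm ▸ hF)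
  rw [hd] at hc
  let x : ZMod 6 → {d : G.graph.Dart // Inner d} := fun i => ⟨c i, hc.inner F.2 i⟩
  have hx : Function.Injective x := fun i j h => hc.injective (Subtype.ext_iff.mp h)
  have hmem : ∀ i, copy (x i) ∈ (G.hexagonCopy F).verts := fun i =>
    copy_mem_hexagonCopy.mpr (hc.faceOf i)
  refine IsCycleOfLength.of_six (fun i => copy (x i)) (hG.copy_injective.comp hx) ?_ ?_
  · ext p
    obtain ⟨d, rfl⟩ := copy_surjective p
    rw [copy_mem_hexagonCopy, hc.faceOf_eq_iff]
    exact exists_congr fun i => ⟨fun h => congrArg copy (Subtype.ext h),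
      fun h => Subtype.ext_iff.mp (hG.copy_injective h)⟩
  · have key : ∀ i j, (G.hexagonCopy F).Adj (copy (x i)) (copy (x j)) ↔ j = i + 1 ∨ j = i - 1 := by
      intro i j
      have : (G.hexagonCopy F).Adj (copy (x i)) (copy (x j)) ↔
          G.expansion.Adj (copy (x i)) (copy (x j)) :=
        ⟨fun h => h.2.2, fun h => ⟨hmem i, hmem j, h⟩⟩
      rw [this, hG.expansion_adj]
      change c j = G.next (c i) ∨ c j = G.next.symm (c i) ∨ (c j ≠ c i ∧ (c j).fst = (c i).fst) ↔ _
      rw [hc.next_eq, hc.next_symm_eq, hc.injective.eq_iff, hc.injective.eq_iff]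
      refine or_congr_right (or_iff_left fun h => h.1 ?_)
      rw [hc.fst_injective h.2]
    intro p q
    constructor
    · intro h
      have hp := (G.hexagonCopy F).edge_vert h
      have hq := (G.hexagonCopy F).edge_vert h.symm
      obtain ⟨d, rfl⟩ := copy_surjective p
      obtain ⟨d', rfl⟩ := copy_surjective q
      rw [copy_mem_hexagonCopy, hc.faceOf_eq_iff] at hp hq
      obtain ⟨i, hi⟩ := hp
      obtain ⟨j, hj⟩ := hq
      obtain rfl : x i = d := Subtype.ext hi
      obtain rfl : x j = d' := Subtype.ext hj
      rcases (key i j).mp h with rfl | rfl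
      · exact ⟨i, rfl⟩
      · exact ⟨i - 1, by simp only [sub_add_cancel]; exact Sym2.eq_swap⟩
    · rintro ⟨i, h⟩
      rcases Sym2.eq_iff.mp h with ⟨rfl, rfl⟩ | ⟨rfl, rfl⟩
      · exact (key _ _).mpr (Or.inl rfl)
      · exact (key _ _).mpr (Or.inr (by ring))

/-- In an inner face a dart is determined by its initial vertex, so each of the two faces
contributes one dart for each end of `m`. -/
theorem copy_mem_quad {d : {d : G.graph.Dart // Inner d}} {m : {m : G.graph.Dart // Shared m}} :
    copy d ∈ (quad m).verts ↔ d.1 = m.1 ∨ d.1 = G.next m.1 ∨ d.1 = m.1.symm ∨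
      d.1 = G.next m.1.symm := by
  obtain ⟨d, h⟩ := d
  obtain ⟨m, hm⟩ := m
  have hmem : copy ⟨d, h⟩ ∈ (quad ⟨m, hm⟩).verts ↔
      (G.faceOf d = G.faceOf m ∨ G.faceOf d = G.faceOf m.symm) ∧ (d.fst = m.fst ∨ d.fst = m.snd) := by
    refine and_congr (or_congr ?_ ?_) Iff.rfl <;> exact Subtype.ext_iff
  rw [hmem]
  constructor
  · rintro ⟨hF | hF, hx | hx⟩
    · exact Or.inl (hG.eq_of_faceOf_eq h hF hx)
    · exact Or.inr (Or.inl (hG.eq_of_faceOf_eq h (by rw [hF, faceOf_next]) (by rw [hx, next_fst])))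
    · refine Or.inr (Or.inr (Or.inr (hG.eq_of_faceOf_eq h (by rw [hF, faceOf_next]) ?_)))
      rw [hx, next_fst]; rfl
    · exact Or.inr (Or.inr (Or.inl (hG.eq_of_faceOf_eq h hF hx)))
  · rintro (rfl | rfl | rfl | rfl)
    · exact ⟨Or.inl rfl, Or.inl rfl⟩
    · exact ⟨Or.inl (faceOf_next m), Or.inr (next_fst m)⟩
    · exact ⟨Or.inr rfl, Or.inr rfl⟩
    · exact ⟨Or.inr (faceOf_next _), Or.inl (next_fst _)⟩

omit hG in
theorem quad_symm (m : {m : G.graph.Dart // Shared m}) : quad ⟨m.1.symm, m.2.symm⟩ = quad m := by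
  obtain ⟨m, hm⟩ := m
  unfold quad quadrilateral
  congr 1
  ext p
  simp only [SimpleGraph.Dart.symm_symm, Set.mem_ofPred_eq]
  rw [or_comm]
  exact and_congr_right fun _ => or_comm

theorem mem_expansionCells {C : G.expansion.Subgraph} :
    C ∈ G.expansionCells ↔ (∃ F, C = G.hexagonCopy F) ∨ ∃ m, C = quad m := by
  refine or_congr_right ?_
  constructor
  · rintro ⟨F, F', x, y, hne, ⟨m, hm, he⟩, ⟨m', hm', he'⟩, rfl⟩
    have hm'' : G.faceOf m.symm = F'.1 := by
      rcases (SimpleGraph.dart_edge_eq_iff m' m).mp (he'.trans he.symm) with rfl | rfl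
      · exact absurd (Subtype.ext (hm.symm.trans hm')) hne
      · exact hm'
    have hs := shared_of_faceOf hm hm''
    obtain rfl : F = ⟨_, hs.1⟩ := Subtype.ext hm.symm
    obtain rfl : F' = ⟨_, hs.2⟩ := Subtype.ext hm''.symm
    refine ⟨⟨m, hs⟩, ?_⟩
    rcases SimpleGraph.dart_edge_eq_mk'_iff'.mp he with ⟨rfl, rfl⟩ | ⟨rfl, rfl⟩
    · rfl
    · unfold quad quadrilateral
      congr 1
      ext p
      exact and_congr_right fun _ => or_comm
  · rintro ⟨m, rfl⟩
    refine ⟨_, _, _, _, ?_, ⟨m.1, rfl, rfl⟩, ⟨m.1.symm, rfl, m.1.edge_symm⟩, rfl⟩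
    exact fun h => hG.faceOf_symm_ne (Subtype.ext_iff.mp h).symm

theorem isCycleOfLength_quad (m : {m : G.graph.Dart // Shared m}) :
    IsCycleOfLength (quad m) 4 := by
  obtain ⟨m, hm⟩ := m
  have hF : G.faceOf m.symm ≠ G.faceOf m := hG.faceOf_symm_ne
  have hx := m.fst_ne_snd
  let x0 : {d : G.graph.Dart // Inner d} := ⟨m, hm.1⟩
  let x1 : {d : G.graph.Dart // Inner d} := ⟨G.next m, inner_next_iff.mpr hm.1⟩
  let x2 : {d : G.graph.Dart // Inner d} := ⟨m.symm, hm.2⟩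
  let x3 : {d : G.graph.Dart // Inner d} := ⟨G.next m.symm, inner_next_iff.mpr hm.2⟩
  let x : ZMod 4 → {d : G.graph.Dart // Inner d} := ![x0, x1, x2, x3]
  have hx01 : m ≠ G.next m := fun h => hx ((congrArg (fun d : G.graph.Dart => d.fst) h).trans
    (next_fst m))
  have hx02 : m ≠ m.symm := m.symm_ne.symm
  have hx03 : m ≠ G.next m.symm := fun h => hG.rot_ne m (by rw [← next_symm]; exact h.symm)
  have hx12 : G.next m ≠ m.symm := fun h => hG.rot_ne m.symm (by rw [← next_apply]; exact h)
  have hx13 : G.next m ≠ G.next m.symm := G.next.injective.ne hx02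
  have hx23 : m.symm ≠ G.next m.symm := fun h => hx
    (((congrArg (fun d : G.graph.Dart => d.fst) h).trans (next_fst m.symm)).symm)
  have hinj : Function.Injective x := by
    have h : ∀ i j : Fin 4, i < j → (x i).1 ≠ (x j).1 := by
      intro i j hij
      fin_cases i <;> fin_cases j <;> first | exact absurd hij (by decide) | assumption
    intro i j hij
    rcases lt_trichotomy (α := Fin 4) i j with hlt | heq | hlt
    · exact absurd (Subtype.ext_iff.mp hij) (h i j hlt)
    · exact heq
    · exact absurd (Subtype.ext_iff.mp hij).symm (h j i hlt)
  have hmem : ∀ d, copy d ∈ (quad ⟨m, hm⟩).verts ↔ ∃ i, x i = d := by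
    intro d
    rw [hG.copy_mem_quad]
    constructor
    · rintro (h | h | h | h)
      · exact ⟨0, Subtype.ext h.symm⟩
      · exact ⟨1, Subtype.ext h.symm⟩
      · exact ⟨2, Subtype.ext h.symm⟩
      · exact ⟨3, Subtype.ext h.symm⟩
    · rintro ⟨i, rfl⟩
      revert i
      intro i
      fin_cases i
      · exact Or.inl rfl
      · exact Or.inr (Or.inl rfl)
      · exact Or.inr (Or.inr (Or.inl rfl))
      · exact Or.inr (Or.inr (Or.inr rfl))
  refine IsCycleOfLength.of_four (fun i => copy (x i)) (hG.copy_injective.comp hinj) ?_ ?_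
  · ext p
    obtain ⟨d, rfl⟩ := copy_surjective p
    rw [hmem]
    exact exists_congr fun i => hG.copy_injective.eq_iff.symm
  · have adj01 : G.expansion.Adj (copy x0) (copy x1) := hG.expansion_adj.mpr (Or.inl rfl)
    have adj12 : G.expansion.Adj (copy x1) (copy x2) :=
      hG.expansion_adj.mpr (Or.inr (Or.inr ⟨hx12.symm, (next_fst m).symm⟩))
    have adj23 : G.expansion.Adj (copy x2) (copy x3) := hG.expansion_adj.mpr (Or.inl rfl)
    have adj30 : G.expansion.Adj (copy x3) (copy x0) :=
      hG.expansion_adj.mpr (Or.inr (Or.inr ⟨hx03, (next_fst m.symm).symm⟩))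
    have nadj02 : ¬ G.expansion.Adj (copy x0) (copy x2) := by
      rw [hG.expansion_adj]
      rintro (h | h | h)
      · exact hx12 h.symm
      · exact hx03 ((Equiv.eq_symm_apply _).mp h).symm
      · exact hx h.2.symm
    have nadj13 : ¬ G.expansion.Adj (copy x1) (copy x3) := by
      rw [hG.expansion_adj]
      rintro (h | h | h)
      · have := congrArg G.faceOf h
        simp only [x1, x3, faceOf_next] at this
        exact hF this
      · have := congrArg G.faceOf h
        simp only [x1, x3, faceOf_next, faceOf_next_symm] at this
        exact hF this
      · exact hx ((next_fst m.symm).symm.trans (h.2.trans (next_fst m)))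
    have key : ∀ i j, (quad ⟨m, hm⟩).Adj (copy (x i)) (copy (x j)) ↔ j = i + 1 ∨ i = j + 1 := by
      intro i j
      have : (quad ⟨m, hm⟩).Adj (copy (x i)) (copy (x j)) ↔
          G.expansion.Adj (copy (x i)) (copy (x j)) :=
        ⟨fun h => h.2.2, fun h => ⟨(hmem _).mpr ⟨i, rfl⟩, (hmem _).mpr ⟨j, rfl⟩, h⟩⟩
      rw [this]
      have hstep : ∀ i, G.expansion.Adj (copy (x i)) (copy (x (i + 1))) := by
        have : ∀ i : ZMod 4, i = 0 ∨ i = 1 ∨ i = 2 ∨ i = 3 := by decide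
        intro i
        rcases this i with rfl | rfl | rfl | rfl
        · exact adj01
        · exact adj12
        · exact adj23
        · exact adj30
      constructor
      · intro h
        have : ∀ i j : ZMod 4, j = i + 1 ∨ i = j + 1 ∨ i = j ∨ (i = 0 ∧ j = 2) ∨ (i = 2 ∧ j = 0) ∨
          (i = 1 ∧ j = 3) ∨ (i = 3 ∧ j = 1) := by decide
        rcases this i j with e | e | rfl | ⟨rfl, rfl⟩ | ⟨rfl, rfl⟩ | ⟨rfl, rfl⟩ | ⟨rfl, rfl⟩
        · exact Or.inl e
        · exact Or.inr e
        · exact absurd h (SimpleGraph.irrefl _)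
        · exact absurd h nadj02
        · exact absurd h.symm nadj02
        · exact absurd h nadj13
        · exact absurd h.symm nadj13
      · rintro (rfl | rfl)
        · exact hstep i
        · exact (hstep j).symm
    intro p q
    constructor
    · intro h
      have hp := (quad ⟨m, hm⟩).edge_vert h
      have hq := (quad ⟨m, hm⟩).edge_vert h.symm
      obtain ⟨d, rfl⟩ := copy_surjective p
      obtain ⟨d', rfl⟩ := copy_surjective q
      rw [hmem] at hp hq
      obtain ⟨i, rfl⟩ := hp
      obtain ⟨j, rfl⟩ := hq
      rcases (key i j).mp h with rfl | rfl
      · exact ⟨i, rfl⟩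
      · exact ⟨j, Sym2.eq_swap⟩
    · rintro ⟨i, h⟩
      rcases Sym2.eq_iff.mp h with ⟨rfl, rfl⟩ | ⟨rfl, rfl⟩
      · exact (key _ _).mpr (Or.inl rfl)
      · exact (key _ _).mpr (Or.inr rfl)

theorem ncard_neighborSet_expansion (d : {d : G.graph.Dart // Inner d}) :
    (G.expansion.neighborSet (copy d)).ncard = {d' : G.graph.Dart | Inner d' ∧
      (d' = G.next d.1 ∨ d' = G.next.symm d.1 ∨ (d' ≠ d.1 ∧ d'.fst = d.1.fst))}.ncard := by
  rw [← Set.ncard_preimage_of_injective_subset_range hG.copy_injective (by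
      rw [copy_surjective.range_eq]; exact Set.subset_univ _),
    ← Set.ncard_image_of_injective _ Subtype.val_injective]
  congr 1
  ext d'
  simp only [Set.mem_image, Set.mem_preimage, SimpleGraph.mem_neighborSet, hG.expansion_adj,
    Subtype.exists, exists_and_left, exists_prop, exists_eq_right_right, Set.mem_ofPred_eq]
  exact and_comm

theorem next_ne_next_symm {d : G.graph.Dart} (hd : Inner d) : G.next d ≠ G.next.symm d := by
  rcases hG.isHexagonal_or_isSquare hd with h | h
  · obtain ⟨c, hc, rfl⟩ := hG.exists_hexagon_cycle h
    rw [hc.next_eq, hc.next_symm_eq]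
    exact hc.injective.ne (by decide)
  · obtain ⟨c, hc, rfl⟩ := hG.exists_square_cycle h
    rw [hc.next_eq, hc.next_symm_eq]
    exact hc.injective.ne (by decide)

theorem expansion_of_not_cubic {d : {d : G.graph.Dart // Inner d}} (h : ¬ Cubic d.1) :
    (G.expansion.neighborSet (copy d)).ncard = 2 ∧ ∀ m, copy d ∉ (quad m).verts := by
  obtain ⟨d, hd⟩ := d
  constructor
  · rw [hG.ncard_neighborSet_expansion, Set.ncard_eq_two]
    refine ⟨_, _, hG.next_ne_next_symm hd, ?_⟩
    ext d'
    constructor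
    · rintro ⟨hin, h' | h' | ⟨hne, hf⟩⟩
      · exact Or.inl h'
      · exact Or.inr h'
      · rcases hG.eq_or_of_fst_eq hf with e | rfl | e
        · exact absurd e hne
        · exact absurd (hG.cubic_of_shared (shared_iff.mpr ⟨hd, hin⟩)) h
        · rw [Cubic, not_not] at h
          exact absurd (e.trans h) hne
    · rintro (rfl | rfl)
      · exact ⟨inner_next_iff.mpr hd, Or.inl rfl⟩
      · exact ⟨inner_next_symm_iff.mpr hd, Or.inr (Or.inl rfl)⟩
  · rintro ⟨m, hm⟩ hmem
    refine h ?_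
    rcases hG.copy_mem_quad.mp hmem with e | e | e | e <;> simp only at e <;> subst e
    · exact hG.cubic_of_shared hm
    · rw [cubic_next_iff]; exact hG.cubic_of_shared hm.symm
    · exact hG.cubic_of_shared hm.symm
    · rw [cubic_next_iff, SimpleGraph.Dart.symm_symm]; exact hG.cubic_of_shared hm

/-- A vertex of degree three lies on exactly one further inner face, which adds one neighbour to the
two on the hexagon. Exactly one side of the hexagon there is shared; its two darts give the same
quadrilateral, hence uniqueness only as a subgraph. -/
theorem expansion_of_cubic {d : {d : G.graph.Dart // Inner d}} (h : Cubic d.1) :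
    (G.expansion.neighborSet (copy d)).ncard = 3 ∧
      ∃ m, copy d ∈ (quad m).verts ∧ ∀ m', copy d ∈ (quad m').verts → quad m' = quad m := by
  obtain ⟨d, hd⟩ := d
  have hd2 : G.rot (G.rot d) ≠ d := h
  constructor
  · obtain ⟨x, hx, hne, hf, huniq⟩ : ∃ x, Inner x ∧ x ≠ d ∧ x.fst = d.fst ∧
        ∀ y : G.graph.Dart, Inner y → y ≠ d → y.fst = d.fst → y = x := by
      rcases (hG.cubic_iff hd).mp h with hs | hs
      · refine ⟨G.rot d, (shared_iff.mp hs).2, hG.rot_ne d, G.rot_fst d, fun y hy hne hf => ?_⟩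
        rcases hG.eq_or_of_fst_eq hf with e | e | rfl
        · exact absurd e hne
        · exact e
        · exact absurd hy (hG.not_inner_three hd (shared_iff.mp hs).2)
      · have hs2 := hs.2
        rw [hG.symm_next_symm h] at hs2
        refine ⟨G.rot (G.rot d), hs2, hd2, by rw [G.rot_fst, G.rot_fst], fun y hy hne hf => ?_⟩
        rcases hG.eq_or_of_fst_eq hf with e | rfl | e
        · exact absurd e hne
        · exact absurd hs2 (hG.not_inner_three hd hy)
        · exact e
    rw [hG.ncard_neighborSet_expansion, Set.ncard_eq_three]
    have hn1 : G.next d ≠ x := fun e => d.fst_ne_snd (by rw [← hf, ← e, next_fst])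
    have hn2 : G.next.symm d ≠ x := fun e => (G.next.symm d).fst_ne_snd (by
      rw [next_symm_snd, ← hf, e])
    refine ⟨_, _, x, hG.next_ne_next_symm hd, hn1, hn2, ?_⟩
    ext d'
    constructor
    · rintro ⟨hin, h' | h' | ⟨hne, hf⟩⟩
      · exact Or.inl h'
      · exact Or.inr (Or.inl h')
      · exact Or.inr (Or.inr (huniq _ hin hne hf))
    · rintro (rfl | rfl | rfl)
      · exact ⟨inner_next_iff.mpr hd, Or.inl rfl⟩
      · exact ⟨inner_next_symm_iff.mpr hd, Or.inr (Or.inl rfl)⟩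
      · exact ⟨hx, Or.inr (Or.inr ⟨hne, hf⟩)⟩
  · have hmem : ∀ m', copy ⟨d, hd⟩ ∈ (quad m').verts →
        ∃ m'' : {m : G.graph.Dart // Shared m}, quad m'' = quad m' ∧
          (m''.1 = d ∨ m''.1 = G.next.symm d) := by
      intro m' h'
      rcases hG.copy_mem_quad.mp h' with e | e | e | e
      · exact ⟨m', rfl, Or.inl e.symm⟩
      · exact ⟨m', rfl, Or.inr ((Equiv.eq_symm_apply _).mpr e.symm)⟩
      · exact ⟨_, quad_symm m', Or.inl e.symm⟩
      · exact ⟨_, quad_symm m', Or.inr ((Equiv.eq_symm_apply _).mpr e.symm)⟩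
    rcases (hG.cubic_iff hd).mp h with hs | hs
    · refine ⟨⟨d, hs⟩, hG.copy_mem_quad.mpr (Or.inl rfl), fun m' h' => ?_⟩
      obtain ⟨⟨m, hm⟩, hq, rfl | rfl⟩ := hmem m' h'
      · exact hq.symm
      · exact absurd hm (hG.not_shared_next_symm hs)
    · refine ⟨⟨_, hs⟩, hG.copy_mem_quad.mpr (Or.inr (Or.inl (by simp))), fun m' h' => ?_⟩
      obtain ⟨⟨m, hm⟩, hq, e | e⟩ := hmem m' h'
      · simp only at e
        subst e
        exact absurd hs (hG.not_shared_next_symm hm)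
      · simp only at e
        subst e
        exact hq.symm

end IsCata
end PlaneGraph

/-! ### Phenylenes satisfy the axioms. -/

namespace PlaneGraph

theorem _root_.IsCycleOfLength.map {V W : Type*} {G : SimpleGraph V} {H : SimpleGraph W} (f : G →g H)
    (hf : Function.Injective f) {C : G.Subgraph} {k : ℕ} (h : IsCycleOfLength C k) :
    IsCycleOfLength (C.map f) k := by
  obtain ⟨v, p, hp, rfl, rfl⟩ := h
  exact ⟨f v, p.map f, hp.map hf, p.length_map f, p.toSubgraph_map f⟩

section Degree

variable {V : Type u} {P : PlaneGraph V}

theorem ncard_fst_eq (v : V) :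
    {d : P.graph.Dart | d.fst = v}.ncard = (P.graph.neighborSet v).ncard := by
  refine Set.ncard_congr (fun d _ => d.snd) ?_ ?_ ?_
  · rintro d rfl
    exact d.adj
  · rintro d d' h h' he
    exact dart_eq_of_fst_snd (Eq.trans h (Eq.symm h')) he
  · intro w hw
    exact ⟨⟨(v, w), hw⟩, rfl, rfl⟩

theorem rot_rot_of_ncard_le (hrot : ∀ d, P.rot d ≠ d) (d : P.graph.Dart)
    (h : {d' : P.graph.Dart | d'.fst = d.fst}.ncard ≤ 3) :
    P.rot (P.rot d) = d ∨ P.rot (P.rot (P.rot d)) = d := by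
  have := P.finite_dart
  rw [or_iff_not_imp_left]
  intro h2
  have h3 : ({d, P.rot d, P.rot (P.rot d)} : Set P.graph.Dart).ncard = 3 :=
    Set.ncard_eq_three.mpr ⟨_, _, _, (hrot d).symm, Ne.symm h2, (hrot _).symm, rfl⟩
  have hsub : ({d, P.rot d, P.rot (P.rot d)} : Set P.graph.Dart) ⊆
      {d' : P.graph.Dart | d'.fst = d.fst} := by
    rintro x (rfl | rfl | rfl) <;> simp only [Set.mem_ofPred_eq, P.rot_fst]
  have heq := Set.eq_of_subset_of_ncard_le hsub (by rw [h3]; exact h) (Set.toFinite _)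
  have hmem : P.rot (P.rot (P.rot d)) ∈ {d' : P.graph.Dart | d'.fst = d.fst} := by
    simp only [Set.mem_ofPred_eq, P.rot_fst]
  rw [← heq] at hmem
  rcases hmem with h | h | h
  · exact h
  · exact absurd (P.rot.injective h) h2
  · exact absurd h (hrot _)

theorem ncard_le_two (d : P.graph.Dart) (h : P.rot (P.rot d) = d) :
    {d' : P.graph.Dart | d'.fst = d.fst}.ncard ≤ 2 := by
  have := P.finite_dart
  refine (Set.ncard_le_ncard (t := {d, P.rot d}) (fun x hx => eq_or_of_rot_rot h hx)
    (Set.toFinite _)).trans ?_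
  exact (Set.ncard_insert_le _ _).trans (by rw [Set.ncard_singleton])

/-- The dart is a shared side of a square. -/
def IsSquareSide (d : P.graph.Dart) : Prop := Shared d ∧ IsSquare (P.faceOf d)

end Degree

section Phenylene

variable {V : Type u} {U : Type*} {P : PlaneGraph V} {G : PlaneGraph U}
  (hG : G.IsCatacondensed) (e : G.expansion ≃g P.graph)
  (hr : Set.range (fun f : P.InnerFace => P.boundary f.1) =
    (fun C : G.expansion.Subgraph => C.map e.toHom) '' G.expansionCells)
include hG hr

namespace Phenylene

omit hG hr in
theorem mem_map {C : G.expansion.Subgraph} {p} : e p ∈ (C.map e.toHom).verts ↔ p ∈ C.verts := by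
  change e p ∈ e '' C.verts ↔ _
  exact e.injective.mem_set_image

theorem face_cases {F : P.Face} (hF : F ≠ P.outer) :
    (IsHexagonal F ∧ ∃ K, P.boundary F = (G.hexagonCopy K).map e.toHom) ∨
      (IsSquare F ∧ ∃ m, P.boundary F = (quad m).map e.toHom) := by
  have h : P.boundary F ∈ Set.range (fun f : P.InnerFace => P.boundary f.1) := ⟨⟨F, hF⟩, rfl⟩
  rw [hr] at h
  obtain ⟨C, hC, hF'⟩ := h
  rcases hG.isCata.mem_expansionCells.mp hC with ⟨K, rfl⟩ | ⟨m, rfl⟩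
  · refine Or.inl ⟨⟨hF, ?_⟩, K, hF'.symm⟩
    rw [← hF']
    exact (hG.isCata.isCycleOfLength_hexagonCopy (hG.isHexagonal K.2)).map _ e.injective
  · refine Or.inr ⟨⟨hF, ?_⟩, m, hF'.symm⟩
    rw [← hF']
    exact (hG.isCata.isCycleOfLength_quad m).map _ e.injective

omit hG in
theorem exists_face {C : G.expansion.Subgraph} (hC : C ∈ G.expansionCells) :
    ∃ F, F ≠ P.outer ∧ P.boundary F = C.map e.toHom := by
  have h : C.map e.toHom ∈ Set.range (fun f : P.InnerFace => P.boundary f.1) := by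
    rw [hr]; exact ⟨C, hC, rfl⟩
  obtain ⟨F, hF⟩ := h
  exact ⟨F.1, F.2, hF⟩

omit hG hr in
theorem ncard_darts (p) : {d : P.graph.Dart | d.fst = e p}.ncard =
    (G.expansion.neighborSet p).ncard := by
  rw [ncard_fst_eq]
  exact (Nat.card_congr (e.mapNeighborSet p)).symm

include e in
omit hr in
theorem ncard_darts_cases (v : V) : {d : P.graph.Dart | d.fst = v}.ncard = 2 ∨
    {d : P.graph.Dart | d.fst = v}.ncard = 3 := by
  obtain ⟨p, rfl⟩ := e.surjective v
  obtain ⟨d, rfl⟩ := copy_surjective p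
  rw [ncard_darts]
  by_cases h : Cubic d.1
  · exact Or.inr (hG.isCata.expansion_of_cubic h).1
  · exact Or.inl (hG.isCata.expansion_of_not_cubic h).1

include e in
omit hr in
theorem rot_ne (d : P.graph.Dart) : P.rot d ≠ d := by
  intro h
  have h1 : {d' : P.graph.Dart | d'.fst = d.fst} = {d} := by
    ext x
    constructor
    · intro hx
      rcases eq_or_of_rot_rot (d := d) (by rw [h, h]) hx with h' | h'
      · exact h'
      · exact h'.trans h
    · rintro rfl
      rfl
  have h2 := ncard_darts_cases hG e d.fst
  rw [h1, Set.ncard_singleton] at h2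
  omega

theorem eq_of_boundary_eq {d d' : P.graph.Dart} (hd : Inner d) (hd' : Inner d')
    (h : P.boundary (P.faceOf d) = P.boundary (P.faceOf d')) (hf : d.fst = d'.fst) : d = d' := by
  have hF := boundary_injective hd hd' h
  rcases face_cases hG e hr hd with ⟨h6, -⟩ | ⟨h4, -⟩
  · exact eq_of_isCycleOfLength (rot_ne hG e) h6.2 hF hf
  · exact eq_of_isCycleOfLength (rot_ne hG e) h4.2 hF hf

theorem exists_hexagon (v : V) : ∃ d : P.graph.Dart, d.fst = v ∧ IsHexagonal (P.faceOf d) := by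
  obtain ⟨p, rfl⟩ := e.surjective v
  obtain ⟨d, rfl⟩ := copy_surjective p
  obtain ⟨F, hF, hb⟩ := exists_face e hr
    (hG.isCata.mem_expansionCells.mpr (Or.inl ⟨⟨G.faceOf d.1, d.2⟩, rfl⟩))
  have hmem : e (copy d) ∈ (P.boundary F).verts := by
    rw [hb, mem_map]
    exact IsCata.copy_mem_hexagonCopy.mpr rfl
  obtain ⟨x, rfl, hx⟩ := mem_boundary_iff.mp hmem
  refine ⟨x, hx, hF, ?_⟩
  rw [hb]
  exact (hG.isCata.isCycleOfLength_hexagonCopy (hG.isHexagonal (F := G.faceOf d.1) d.2)).map _ e.injective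

theorem hexagon_unique {d d' : P.graph.Dart} (h : IsHexagonal (P.faceOf d))
    (h' : IsHexagonal (P.faceOf d')) (hf : d.fst = d'.fst) : d = d' := by
  have key : ∀ x : P.graph.Dart, IsHexagonal (P.faceOf x) →
      P.boundary (P.faceOf x) = (G.hexagonCopy (e.symm x.fst).1.2).map e.toHom := by
    intro x hx
    rcases face_cases hG e hr hx.1 with ⟨-, K, hK⟩ | ⟨h4, -⟩
    · have hmem : e (e.symm x.fst) ∈ (P.boundary (P.faceOf x)).verts := by
        rw [RelIso.apply_symm_apply]
        exact mem_boundary_iff.mpr ⟨x, rfl, rfl⟩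
      rw [hK, mem_map] at hmem
      rw [hK, ← show (e.symm x.fst).1.2 = K from hmem]
    · exact absurd h4 (not_isSquare_of_isHexagonal (rot_ne hG e) hx)
  refine eq_of_boundary_eq hG e hr h.1 h'.1 ?_ hf
  rw [key d h, key d' h', hf]

theorem quad_of_isSquare {x : P.graph.Dart} (hx : IsSquare (P.faceOf x))
    {p} (hp : x.fst = e p) :
    ∃ m, p ∈ (quad m).verts ∧ P.boundary (P.faceOf x) = (quad m).map e.toHom := by
  rcases face_cases hG e hr hx.1 with ⟨h6, -⟩ | ⟨-, m, hm⟩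
  · exact absurd hx (not_isSquare_of_isHexagonal (rot_ne hG e) h6)
  · refine ⟨m, ?_, hm⟩
    rw [← mem_map e, ← hm, ← hp]
    exact mem_boundary_iff.mpr ⟨x, rfl, rfl⟩

/-- The squares at a vertex of the phenylene correspond to the quadrilaterals through its copy, so
the dichotomy is that of the initial vertex of `d` having degree two or three in `G`. -/
theorem square_cases (v : V) :
    ({d : P.graph.Dart | d.fst = v}.ncard = 2 ∧
      ∀ d : P.graph.Dart, d.fst = v → ¬ IsSquare (P.faceOf d)) ∨
    ({d : P.graph.Dart | d.fst = v}.ncard = 3 ∧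
      ∃ d : P.graph.Dart, d.fst = v ∧ IsSquare (P.faceOf d) ∧
        ∀ d' : P.graph.Dart, d'.fst = v → IsSquare (P.faceOf d') → d' = d) := by
  obtain ⟨p, rfl⟩ := e.surjective v
  obtain ⟨d, rfl⟩ := copy_surjective p
  rw [ncard_darts]
  by_cases h : Cubic d.1
  · obtain ⟨h3, m, hm, huniq⟩ := hG.isCata.expansion_of_cubic h
    refine Or.inr ⟨h3, ?_⟩
    obtain ⟨F, hF, hb⟩ := exists_face e hr
      (hG.isCata.mem_expansionCells.mpr (Or.inr ⟨m, rfl⟩))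
    have hmem : e (copy d) ∈ (P.boundary F).verts := by
      rw [hb, mem_map]
      exact hm
    obtain ⟨x, rfl, hx⟩ := mem_boundary_iff.mp hmem
    refine ⟨x, hx, ⟨hF, ?_⟩, fun y hy hsq => ?_⟩
    · rw [hb]
      exact (hG.isCata.isCycleOfLength_quad m).map _ e.injective
    · obtain ⟨m', hm', hb'⟩ := quad_of_isSquare hG e hr hsq hy
      refine eq_of_boundary_eq hG e hr hsq.1 hF ?_ (hy.trans hx.symm)
      rw [hb', hb, huniq m' hm']
  · obtain ⟨h2, hno⟩ := hG.isCata.expansion_of_not_cubic h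
    refine Or.inl ⟨h2, fun x hx hsq => ?_⟩
    obtain ⟨m, hm, -⟩ := quad_of_isSquare hG e hr hsq hx
    exact hno m hm

theorem isCata : IsCata P where
  inner_cycle F hF := (face_cases hG e hr hF).imp And.left And.left
  outer_unique v := by
    have := P.finite_dart
    obtain ⟨x, hx, hx6⟩ := exists_hexagon hG e hr v
    -- One dart remains at each vertex: 2 - 1 after removing the hexagon's dart, or 3 - 2 after
    -- removing those of the hexagon and the square.
    have key : {d : P.graph.Dart | d.fst = v ∧ ¬ Inner d}.ncard = 1 := by
      rcases square_cases hG e hr v with ⟨h2, hno⟩ | ⟨h3, y, hy, hy4, huniq⟩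
      · have : {d : P.graph.Dart | d.fst = v ∧ ¬ Inner d} =
            {d : P.graph.Dart | d.fst = v} \ {x} := by
          ext d
          refine and_congr_right fun hd : d.fst = v => ⟨?_, ?_⟩
          · rintro h rfl
            exact h hx6.1
          · intro hne hin
            rcases face_cases hG e hr hin with ⟨h6, -⟩ | ⟨h4, -⟩
            · exact hne (hexagon_unique hG e hr h6 hx6 (hd.trans hx.symm))
            · exact hno d hd h4
        rw [this, Set.ncard_sdiff_singleton_of_mem (show x ∈ {d : P.graph.Dart | d.fst = v} from hx), h2]
      · have : {d : P.graph.Dart | d.fst = v ∧ ¬ Inner d} =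
            ({d : P.graph.Dart | d.fst = v} \ {x}) \ {y} := by
          ext d
          rw [Set.mem_sdiff, Set.mem_sdiff, and_assoc]
          refine and_congr_right fun hd : d.fst = v => ⟨?_, ?_⟩
          · refine fun h => ⟨?_, ?_⟩
            · rintro rfl
              exact h hx6.1
            · rintro rfl
              exact h hy4.1
          · rintro ⟨hne, hne'⟩ hin
            rcases face_cases hG e hr hin with ⟨h6, -⟩ | ⟨h4, -⟩
            · exact hne (hexagon_unique hG e hr h6 hx6 (hd.trans hx.symm))
            · exact hne' (huniq d hd h4)
        rw [this, Set.ncard_sdiff_singleton_of_mem, Set.ncard_sdiff_singleton_of_mem (show x ∈ {d : P.graph.Dart | d.fst = v} from hx), h3]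
        refine ⟨hy, ?_⟩
        rintro rfl
        exact not_isSquare_of_isHexagonal (rot_ne hG e) hx6 hy4
    obtain ⟨o, ho⟩ := Set.ncard_eq_one.mp key
    have hmem : ∀ d : P.graph.Dart, (d.fst = v ∧ ¬ Inner d) ↔ d = o := fun d => by
      change d ∈ {d : P.graph.Dart | d.fst = v ∧ ¬ Inner d} ↔ _
      rw [ho, Set.mem_singleton_iff]
    exact ⟨o, (hmem o).mpr rfl, fun d hd => (hmem d).mp hd⟩
  rot_ne := rot_ne hG e
  rot_pow d := rot_rot_of_ncard_le (rot_ne hG e) d (by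
    rcases ncard_darts_cases hG e d.fst with h | h <;> omega)
  square_cubic d h := by
    intro h2
    have hle := ncard_le_two d h2
    rcases square_cases hG e hr d.fst with ⟨-, hno⟩ | ⟨h3, -⟩
    · exact hno d rfl h
    · omega
  square_unique d d' h h' hf := by
    rcases square_cases hG e hr d'.fst with ⟨-, hno⟩ | ⟨-, y, -, -, huniq⟩
    · exact absurd h' (hno d' rfl)
    · rw [huniq d hf h, huniq d' rfl h']

theorem isSquare_symm_iff {d : P.graph.Dart} (hd : Shared d) :
    IsSquare (P.faceOf d.symm) ↔ ¬ IsSquare (P.faceOf d) := by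
  constructor
  · exact fun h h' => (isCata hG e hr).not_isSquare_symm h' h
  · intro h
    have h6 := ((isCata hG e hr).isHexagonal_or_isSquare hd.1).resolve_right h
    refine ((isCata hG e hr).isHexagonal_or_isSquare hd.2).resolve_left fun h6' => ?_
    rw [← faceOf_rot] at h6'
    exact rot_ne hG e d (hexagon_unique hG e hr h6' h6 (P.rot_fst d))

/-- Every shared edge has a square on exactly one side and every square has two shared sides, so
there are 4q shared darts. Comparison with 2(h + q) - 2 gives q = h - 1. -/
theorem card_isSquare_add_one [Fintype V] :
    #{F : P.Face | IsSquare F} + 1 = #{F : P.Face | IsHexagonal F} := by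
  have hP := isCata hG e hr
  have h1 := hP.card_shared
  have h2 := hP.card_filter_inner (fun d => IsSquareSide d) fun d h => h.1.1
  have h6 : ∀ F ∈ ({F : P.Face | IsHexagonal F} : Finset _),
      #{d : P.graph.Dart | P.faceOf d = F ∧ IsSquareSide d} = 0 := by
    intro F hF
    rw [Finset.card_eq_zero, Finset.filter_eq_empty_iff]
    rintro d - ⟨rfl, -, h⟩
    exact hP.not_isSquare (Finset.mem_filter.mp hF).2 h
  have h4 : ∀ F ∈ ({F : P.Face | IsSquare F} : Finset _),
      #{d : P.graph.Dart | P.faceOf d = F ∧ IsSquareSide d} = 2 := by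
    intro F hF
    rw [← (hP.card_square_shared (Finset.mem_filter.mp hF).2).1]
    congr 1
    ext d
    simp only [Finset.mem_filter, Finset.mem_univ, true_and] at hF ⊢
    constructor
    · exact fun h => ⟨h.1, h.2.1⟩
    · rintro ⟨rfl, h⟩
      exact ⟨rfl, h, hF⟩
  rw [Finset.sum_eq_zero h6, zero_add, Finset.sum_congr rfl h4, Finset.sum_const,
    smul_eq_mul] at h2
  have h3 : #{d : P.graph.Dart | Shared d} =
      #{d : P.graph.Dart | IsSquareSide d} + #{d : P.graph.Dart | IsSquareSide d.symm} := by
    rw [← Finset.card_union_of_disjoint]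
    · congr 1
      ext d
      simp only [Finset.mem_filter, Finset.mem_univ, true_and, Finset.mem_union]
      constructor
      · intro h
        by_cases hs : IsSquare (P.faceOf d)
        · exact Or.inl ⟨h, hs⟩
        · exact Or.inr ⟨h.symm, (isSquare_symm_iff hG e hr h).mpr hs⟩
      · rintro (h | h)
        · exact h.1
        · simpa using h.1.symm
    · exact Finset.disjoint_filter.mpr fun d _ h h' => hP.not_isSquare_symm h.2 h'.2
  rw [IsCata.card_symm fun d => IsSquareSide d] at h3
  omega

end Phenylene

end Phenylene

end PlaneGraph

end

theorem theorem3 :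
    (∀ (V : Type u) (G₁ : PlaneGraph V), G₁.IsCatacondensed →
      (wienerPolarity G₁.graph : ℤ) =
        9 * (G₁.numHexagons : ℤ) + (G₁.numSegments : ℤ) + (G₁.numBranched : ℤ) - 7) ∧
    (∀ (V : Type u) (G₂ : PlaneGraph V), G₂.IsPhenylene →
      (wienerPolarity G₂.graph : ℤ) =
        13 * (G₂.numHexagons : ℤ) + (G₂.numSegments : ℤ) + (G₂.numBranched : ℤ) - 11) := by
  classical
  constructor
  · intro V G hG
    have := G.finite
    have := Fintype.ofFinite V
    have h := hG.isCata.wienerPolarity_eq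
    rw [Finset.filter_false_of_mem fun F _ => hG.not_isSquare F, Finset.card_empty] at h
    omega
  · rintro V P ⟨U, G, hG, -, e, hr⟩
    have := P.finite
    have := Fintype.ofFinite V
    have hP := PlaneGraph.Phenylene.isCata hG e hr
    have h := hP.wienerPolarity_eq
    have h' := PlaneGraph.Phenylene.card_isSquare_add_one hG e hr
    rw [← PlaneGraph.IsCata.numHexagons_eq] at h'
    omega
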